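/- **Setting.** Let $m,n\ge 0$ be integers and let $D_0,D_1,D_2$ be complex hermitian $m\times m$ matrices such that $\Delta(x)=\det L(x)$ is not the zero polynomial, where $L(x)=x_0D_0+x_1D_1-x_2D_2$. Let $C=\{\Delta=0\}\subset\mathbb P^2(\mathbb C)$ be the plane curve with this determinantal representation. Let $p,q\in S=\mathbb C[x_0,x_1,x_2]$ be homogeneous of degree $n$ with only finitely many common zeros on $C$; let $Z\subset C$ be the set of these common zeros. **The Bezout matrix along the curve.** Multi-indices $i,j$ below run over triples of non-negative integers with $|i|=|j|=n-1$. Let $\beta^{10}=(b^{10}_{ij})$, $\beta^{20}=(b^{20}_{ij})$, $\beta^{12}=(b^{12}_{ij})$ be any symmetric complex matrices with $$p(x)q(y)-q(x)p(y)=\sum_{i,j}\Big(b^{10}_{ij}x^i(x_1y_0-x_0y_1)y^j+b^{20}_{ij}x^i(x_2y_0-x_0y_2)y^j+b^{12}_{ij}x^i(x_1y_2-x_2y_1)y^j\Big).$$ Let $W_n=\mathbb C^{m\,n(n+1)/2}$, with its standard hermitian inner product, be the space of families $(w_i)_{|i|=n-1}$ with $w_i\in\mathbb C^m$, let $$B=\beta^{12}\otimes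 D_0+\beta^{20}\otimes D_1+\beta^{10}\otimes D_2$$ act on $W_n$, and let $$V_n=\{w\in W_n:\ D_0w_{j+e_0}+D_1w_{j+e_1}-D_2w_{j+e_2}=0\ \text{ for all } |j|=n-2\}.$$ The Bezout matrix of $p$ and $q$ along the curve is $B'=\mathcal P_{V_n}B\,\mathcal P_{V_n}$, regarded as an operator on $V_n$, where $\mathcal P_{V_n}$ is the orthogonal projection onto $V_n$. **Multiplicities.** For $x\in\mathbb P^2$ let $O_x$ be the localization of $S$ at the homogeneous prime ideal of $x$, and let $M_x=O_x^m/L\,O_x^m$. The multiplicity of $x\in Z$ along the determinantal representation is $\mu_x=\operatorname{length}_{O_x}\big(M_x/(p,q)M_x\big)$. **Theorem 2.6.** The dimension of the kernel of $B'$ on $V_n$ equals the number of common zeros of $p$ and $q$ on the curve, counted with multiplicity: $$\dim\ker B'=\sum_{x\in Z}\mu_x .$$ Here, for $x\in Z$: * if $x$ is a nonsingular point of $C$ (some partial derivative of $\Delta$ does not vanish at $x$), or more generally if $\dim\ker L(x)=1$, then $\mu_x$ is the usual multiplicity $\operatorname{length}_{O_x}O_x/(\Delta,p,q)$; * if the representation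 is saturated at $x$, that is, $M_x$ is isomorphic as an $O_x$-module to the integral closure $\widetilde R_x$ of $R_x=O_x/(\Delta)$ in its total ring of fractions, then $\mu_x=\operatorname{length}_{O_x}\widetilde R_x/(p,q)\widetilde R_x$, the number of common zeros on the normalization of $C$ over $x$, counted with multiplicity. In particular, if all points of $Z$ are nonsingular points of $C$, then $\dim\ker B'=\sum_{x\in Z}\operatorname{length}_{O_x}O_x/(\Delta,p,q)$. -/

import Mathlib

open scoped LinearAlgebra.Projectivization Kronecker Matrix

namespace CurveBezout

/-! Homogeneous coordinates on the complex projective plane are indexed by `Fin 3`. -/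

/-- The homogeneous coordinate ring `ℂ[x₀, x₁, x₂]`. -/
abbrev S : Type := MvPolynomial (Fin 3) ℂ

/-- The complex projective plane. -/
abbrev Plane : Type := ℙ ℂ (Fin 3 → ℂ)

section Pencil

variable {m : ℕ} (D : Fin 3 → Matrix (Fin m) (Fin m) ℂ)

/-- The matrix of linear forms `x₀ D₀ + x₁ D₁ - x₂ D₂`. -/
noncomputable def pencil : Matrix (Fin m) (Fin m) S :=
  (MvPolynomial.X 0 : S) • (D 0).map MvPolynomial.C
    + (MvPolynomial.X 1 : S) • (D 1).map MvPolynomial.C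
    - (MvPolynomial.X 2 : S) • (D 2).map MvPolynomial.C

/-- The polynomial `Δ(x₀, x₁, x₂) = det (x₀ D₀ + x₁ D₁ - x₂ D₂)`. -/
noncomputable def discr : S := (pencil D).det

/-- The matrix `v₀ D₀ + v₁ D₁ - v₂ D₂` at a vector `v` of homogeneous coordinates. -/
def pencilAt (v : Fin 3 → ℂ) : Matrix (Fin m) (Fin m) ℂ :=
  v 0 • D 0 + v 1 • D 1 - v 2 • D 2

/-- The common zeros of `p` and `q` on the curve `Δ = 0`, for homogeneous `p` and `q`. -/
def commonZeros (p q : S) : Set Plane :=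
  {x | MvPolynomial.eval x.rep (discr D) = 0 ∧
    MvPolynomial.eval x.rep p = 0 ∧ MvPolynomial.eval x.rep q = 0}

end Pencil

section Bezout

/-- Multi-indices `i = (i₀, i₁, i₂)` with `|i| = n - 1`. -/
abbrev Idx (n : ℕ) : Type := {i : Fin 3 → ℕ // i 0 + i 1 + i 2 + 1 = n}

noncomputable instance (n : ℕ) : Fintype (Idx n) :=
  Fintype.ofInjective
    (fun i : Idx n => fun k : Fin 3 => (⟨i.1 k, by
      have h := i.2
      fin_cases k <;> simp <;> omega⟩ : Fin n))
    (fun i j h => Subtype.ext (funext fun k => congrArg Fin.val (congrFun h k)))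

/-- The monomial `v₀^i₀ v₁^i₁ v₂^i₂`. -/
def monom (v : Fin 3 → ℂ) (i : Fin 3 → ℕ) : ℂ := v 0 ^ i 0 * v 1 ^ i 1 * v 2 ^ i 2

/-- The blown up space `W_n`: families of vectors of `ℂ^m` indexed by `|i| = n - 1`, with its
standard hermitian inner product. -/
abbrev BlownUp (n m : ℕ) : Type := EuclideanSpace ℂ (Idx n × Fin m)

/-- The component in `ℂ^m` of an element of `W_n` at a multi-index. -/
def comp {n m : ℕ} (w : BlownUp n m) (i : Idx n) : Fin m → ℂ := fun r => w (i, r)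

/-- The principal subspace `V_n` of `W_n`: for every multi-index `j` (necessarily with
`|j| = n - 2`), `D₀ w_{j+e₀} + D₁ w_{j+e₁} - D₂ w_{j+e₂} = 0`. -/
def principal {m : ℕ} (D : Fin 3 → Matrix (Fin m) (Fin m) ℂ) (n : ℕ) :
    Submodule ℂ (BlownUp n m) where
  carrier := {w | ∀ (j : Fin 3 → ℕ) (a b c : Idx n),
    a.1 = j + Pi.single 0 1 → b.1 = j + Pi.single 1 1 → c.1 = j + Pi.single 2 1 →
      D 0 *ᵥ comp w a + D 1 *ᵥ comp w b - D 2 *ᵥ comp w c = 0}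
  zero_mem' := by
    intro j a b c _ _ _
    have h : ∀ i : Idx n, comp (0 : BlownUp n m) i = 0 := fun i => rfl
    simp [h]
  add_mem' := by
    intro w w' hw hw' j a b c ha hb hc
    have h : ∀ i : Idx n, comp (w + w') i = comp w i + comp w' i := fun i => rfl
    have h1 := hw j a b c ha hb hc
    have h2 := hw' j a b c ha hb hc
    have h3 := congrArg₂ (· + ·) h1 h2
    simp only [add_zero] at h3
    rw [h, h, h, Matrix.mulVec_add, Matrix.mulVec_add, Matrix.mulVec_add, ← h3]
    abel
  smul_mem' := by
    intro t w hw j a b c ha hb hc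
    have h : ∀ i : Idx n, comp (t • w) i = t • comp w i := fun i => rfl
    have h1 := congrArg (t • ·) (hw j a b c ha hb hc)
    simp only [smul_zero] at h1
    rw [h, h, h, Matrix.mulVec_smul, Matrix.mulVec_smul, Matrix.mulVec_smul, ← h1,
      smul_sub, smul_add]

/-- `β¹⁰, β²⁰, β¹²` are symmetric matrices, indexed by the multi-indices with `|i| = n - 1`, that
decompose `p(x) q(y) - q(x) p(y)` as
`∑ b¹⁰_{ij} x^i (x₁y₀ - x₀y₁) y^j + b²⁰_{ij} x^i (x₂y₀ - x₀y₂) y^j + b¹²_{ij} x^i (x₁y₂ - x₂y₁) y^j`. -/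
structure IsBezoutDecomposition (n : ℕ) (p q : S)
    (β10 β20 β12 : Matrix (Idx n) (Idx n) ℂ) : Prop where
  symm10 : β10.IsSymm
  symm20 : β20.IsSymm
  symm12 : β12.IsSymm
  decomp : ∀ x y : Fin 3 → ℂ,
    MvPolynomial.eval x p * MvPolynomial.eval y q
        - MvPolynomial.eval x q * MvPolynomial.eval y p =
      ∑ i : Idx n, ∑ j : Idx n,
        (β10 i j * monom x i * (x 1 * y 0 - x 0 * y 1) * monom y j
          + β20 i j * monom x i * (x 2 * y 0 - x 0 * y 2) * monom y j
          + β12 i j * monom x i * (x 1 * y 2 - x 2 * y 1) * monom y j)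

variable {m n : ℕ} (D : Fin 3 → Matrix (Fin m) (Fin m) ℂ)

open Classical in
/-- The matrix `B = β¹² ⊗ D₀ + β²⁰ ⊗ D₁ + β¹⁰ ⊗ D₂` on `W_n`. -/
noncomputable def blownUpBezout (β10 β20 β12 : Matrix (Idx n) (Idx n) ℂ) :
    BlownUp n m →ₗ[ℂ] BlownUp n m :=
  Matrix.toEuclideanLin (β12 ⊗ₖ D 0 + β20 ⊗ₖ D 1 + β10 ⊗ₖ D 2)

/-- The Bezout matrix `B' = P B P` along the curve, as an operator on the principal subspace:
`w ↦ P (B w)`, where `P` is the orthogonal projection of `W_n` onto `V_n`. -/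
noncomputable def bezoutAlong (β10 β20 β12 : Matrix (Idx n) (Idx n) ℂ) :
    principal D n →ₗ[ℂ] principal D n :=
  (principal D n).orthogonalProjectionOnto.toLinearMap ∘ₗ
    blownUpBezout D β10 β20 β12 ∘ₗ (principal D n).subtype

end Bezout

section Multiplicity

/-- The homogeneous prime ideal of a point `x` of the plane: the polynomials `f` such that
`f (T v) = 0` identically in `T`, where `v` is a vector of homogeneous coordinates of `x`. -/
noncomputable def pointIdeal (x : Plane) : Ideal S :=
  RingHom.ker (MvPolynomial.aeval
    (fun k => Polynomial.C (x.rep k) * Polynomial.X) : S →ₐ[ℂ] Polynomial ℂ)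

instance (x : Plane) : (pointIdeal x).IsPrime := RingHom.ker_isPrime _

/-- The localization of the homogeneous coordinate ring at the prime ideal of the point `x`.
Multiplicities at `x` are lengths over this ring, as usual in projective geometry; they are equal
to the lengths over the local ring of the plane at `x`. -/
abbrev Loc (x : Plane) : Type := Localization.AtPrime (pointIdeal x)

/-- The image of a polynomial in the localization at `x`. -/
noncomputable def toLoc (x : Plane) : S →+* Loc x := algebraMap S (Loc x)

variable {m : ℕ} (D : Fin 3 → Matrix (Fin m) (Fin m) ℂ)

/-- The multiplicity at `x` of the common zero of `p`, `q` on the curve `Δ = 0` : the length of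
`O / (Δ, p, q)`, where `O` is the localization at `x`. -/
noncomputable def intersectionMult (p q : S) (x : Plane) : ℕ∞ :=
  Module.length (Loc x)
    (Loc x ⧸ Ideal.span {toLoc x (discr D), toLoc x p, toLoc x q})

/-- The localization at `x` of the cokernel of the matrix `x₀ D₀ + x₁ D₁ - x₂ D₂`. -/
abbrev LocCoker (x : Plane) : Type :=
  (Fin m → Loc x) ⧸ LinearMap.range ((pencil D).map (toLoc x)).mulVecLin

/-- The multiplicity at `x` of the common zero of `p`, `q` along the determinantal representation:
the length of `M / (p, q) M`, where `M` is the localization at `x` of the cokernel of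
`x₀ D₀ + x₁ D₁ - x₂ D₂`. -/
noncomputable def zeroMult (p q : S) (x : Plane) : ℕ∞ :=
  Module.length (Loc x)
    (LocCoker D x ⧸ (Ideal.span {toLoc x p, toLoc x q} •
      (⊤ : Submodule (Loc x) (LocCoker D x))))

/-- The local ring at `x` of the curve `Δ = 0`. -/
abbrev CurveLoc (x : Plane) : Type := Loc x ⧸ Ideal.span {toLoc x (discr D)}

/-- The normalization of the local ring at `x` of the curve: its integral closure in its total ring
of fractions. -/
abbrev NormLoc (x : Plane) : Type :=
  integralClosure (CurveLoc D x) (FractionRing (CurveLoc D x))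

/-- The number of common zeros of `p` and `q` on the normalization of the curve lying over `x`,
counted with multiplicity. -/
noncomputable def normalizationMult (p q : S) (x : Plane) : ℕ∞ :=
  Module.length (Loc x)
    (NormLoc D x ⧸ (Ideal.span {toLoc x p, toLoc x q} •
      (⊤ : Submodule (Loc x) (NormLoc D x))))

/-- The determinantal representation is saturated at `x` : its cokernel is, at `x`, a line bundle
on the normalization of the curve. -/
def IsSaturatedAt (x : Plane) : Prop :=
  Nonempty (LocCoker D x ≃ₗ[Loc x] NormLoc D x)

/-- `x` is a nonsingular point of the curve `Δ = 0` (for `x` on the curve). -/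
def IsNonsingularAt (x : Plane) : Prop :=
  ∃ k : Fin 3, MvPolynomial.eval x.rep (MvPolynomial.pderiv k (discr D)) ≠ 0

end Multiplicity

end CurveBezout

/-! ### Length under flat base change to several local rings. -/

namespace CurveBezout
open scoped TensorProduct

/-! Both sides of the formula are the dimension of one space: the cokernel of the pencil modulo `p`
and `q` on an affine chart that contains all common zeros.

Choose a real basis `v, u, e` of ℂ³ with `L(v)` invertible and with no point of `Z` on the line
through `v` and `u`, and write points of the chart as `τ v + s u + e`. There `L = (τ - T) L(v)` with
`T = -L(s u + e) L(v)⁻¹`. Hence the cokernel of `L` is the free module ℂ[s]^m on which `τ` acts by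
`T`, the forms `p, q` act by commuting matrix polynomials `P, Q` in `s` of degree at most `n`, and
the space in question is ℂ[s]^m modulo the images of `P` and `Q` (`nonempty_coker_presMap_equiv`).

On the geometric side, each `O_x` is flat over the chart ring, so length is additive along a
composition series, and each simple factor is seen at exactly one common zero
(`sum_length_baseChange`, `Chart.sum_zeroMult`).

On the matrix side, if the leading coefficient of `P` is invertible, the kernel of the Bezoutian
`(P(s) Q(t) - Q(s) P(t)) / (s - t)` is the kernel of multiplication by `Q` on the finite-dimensional
space ℂ[s]^m / P, so it has the dimension of the cokernel (`finrank_ker_bezoutian`). The operator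
`B'` is this Bezoutian in disguise. The space `V_n` is parametrized by `n` vectors of ℂ^m
(`Chart.paramEquiv`). As the chart is real and the `D k` are hermitian, the adjoint of the
parametrization uses the same action `X ↦ P` (`Chart.adjMat_evX`). Substituting matrices for `x` and
`y` in the decomposition of `p ⊗ q - q ⊗ p` turns the three cross terms into `(s - t) det(v, u, e)
D_i` (`smul_bezoutSum_matEval`, `Chart.smul_bezoutCoeff`). The leading coefficient of `P` becomes
invertible after replacing `p` by `p + z q`, which changes neither side.

For the local statements, a unit entry of the adjugate makes the cokernel cyclic, isomorphic to `O /
Δ`; nonsingularity or a one-dimensional kernel provides such an entry. The saturated case is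
transport along the given isomorphism. -/

/-- Length is additive over flat base change of a finite-dimensional module, summed over local
algebras `O i` that separate the maximal ideals containing the annihilating ideal. -/
theorem sum_length_baseChange {R : Type} [CommRing R] [Algebra ℂ R] {ι : Type} [Fintype ι]
    (O : ι → Type) [∀ i, CommRing (O i)] [∀ i, Algebra R (O i)] [∀ i, Module.Flat R (O i)]
    (I : Ideal R) (P : ι → Ideal R)
    (hone : ∀ i, Module.length (O i) (O i ⧸ (P i).map (algebraMap R (O i))) = 1)
    (htop : ∀ i (Q : Ideal R), Q.IsMaximal → Q ≠ P i →
      I ≤ Q → Module.Finite ℂ (R ⧸ Q) → Q.map (algebraMap R (O i)) = ⊤)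
    (hex : ∀ Q : Ideal R, Q.IsMaximal → I ≤ Q → Module.Finite ℂ (R ⧸ Q) → ∃! i, Q = P i)
    {E : Type} [AddCommGroup E] [Module R E] [Module ℂ E] [IsScalarTower ℂ R E]
    [Module.Finite ℂ E] (hI : ∀ a ∈ I, ∀ x : E, a • x = 0) :
    ∑ i, Module.length (O i) (O i ⊗[R] E) = Module.length ℂ E := by
  classical
  have hE : IsFiniteLength R E := isFiniteLength_iff_isNoetherian_isArtinian.mpr
    ⟨isNoetherian_of_tower ℂ inferInstance, isArtinian_of_tower ℂ inferInstance⟩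
  -- The ℂ-structure and the annihilation by `I` must be generalized, since they are needed for
  -- every submodule in the filtration.
  rename_i h1 h2 h3
  revert h1 h2 h3 hI
  induction hE with
  | of_subsingleton =>
    intros
    rw [Module.length_eq_zero, Finset.sum_eq_zero]
    intro i _
    exact Module.length_eq_zero
  | @of_simple_quotient M _ _ N hs hN ih =>
    intro _ _ _ hI
    have hadd : ∀ i, Module.length (O i) (O i ⊗[R] M) =
        Module.length (O i) (O i ⊗[R] N) + Module.length (O i) (O i ⊗[R] (M ⧸ N)) := fun i =>
      Module.length_eq_add_of_exact (N.subtype.baseChange (O i)) (N.mkQ.baseChange (O i))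
        (Module.Flat.lTensor_preserves_injective_linearMap (M := O i) N.subtype
          N.injective_subtype)
        (LinearMap.lTensor_surjective _ N.mkQ_surjective)
        (lTensor_exact (O i) (LinearMap.exact_subtype_mkQ N) N.mkQ_surjective)
    have : IsNoetherian ℂ M := inferInstance
    have hfinN : Module.Finite ℂ N :=
      Module.Finite.of_injective (N.subtype.restrictScalars ℂ) N.injective_subtype
    have hfinQ : Module.Finite ℂ (M ⧸ N) :=
      Module.Finite.of_surjective (N.mkQ.restrictScalars ℂ) N.mkQ_surjective
    have hC : Module.length ℂ M = Module.length ℂ N + Module.length ℂ (M ⧸ N) :=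
      Module.length_eq_add_of_exact (N.subtype.restrictScalars ℂ) (N.mkQ.restrictScalars ℂ)
        N.injective_subtype N.mkQ_surjective (LinearMap.exact_subtype_mkQ N)
    have ihN := ih (fun a ha x => Subtype.ext (hI a ha x))
    -- The simple factor is `R / Q`. Since `I` kills it, `Q` contains `I`; being finite over ℂ, it
    -- is ℂ. So it counts once over ℂ, and once among the `O i`.
    obtain ⟨Q, hQ, ⟨e⟩⟩ := isSimpleModule_iff_quot_maximal.mp
      hs
    have hfin : Module.Finite ℂ (R ⧸ Q) := Module.Finite.equiv (e.restrictScalars ℂ)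
    have hIQ : I ≤ Q := by
      intro a ha
      obtain ⟨y, hy⟩ := e.surjective 1
      obtain ⟨x, rfl⟩ := N.mkQ_surjective y
      have h0 : e (a • N.mkQ x) = 0 := by rw [← map_smul, hI a ha x, map_zero, map_zero]
      rw [map_smul, hy] at h0
      rw [← Ideal.Quotient.eq_zero_iff_mem]
      simpa [Algebra.smul_def] using h0
    have hlenC : Module.length ℂ (M ⧸ N) = 1 := by
      rw [(e.restrictScalars ℂ).length_eq, Module.length_eq_finrank]
      let := Ideal.Quotient.field Q
      have hb : Function.Bijective (algebraMap ℂ (R ⧸ Q)) :=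
        IsAlgClosed.algebraMap_bijective_of_isIntegral
      rw [← (LinearEquiv.ofBijective (Algebra.linearMap ℂ (R ⧸ Q)) hb).finrank_eq,
        Module.finrank_self]
      rfl
    obtain ⟨i, hi, huniq⟩ := hex Q hQ hIQ hfin
    have hlen : ∀ k, Module.length (O k) (O k ⊗[R] (M ⧸ N)) = (if k = i then 1 else 0 : ℕ∞) := by
      intro k
      have e2 : (O k ⊗[R] (M ⧸ N)) ≃ₗ[O k] O k ⧸ Q.map (algebraMap R (O k)) :=
        (e.baseChange R (O k) _ _).trans
          (Algebra.TensorProduct.quotIdealMapEquivTensorQuot (O k) Q).symm.toLinearEquiv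
      rw [e2.length_eq]
      split_ifs with h
      · subst h; rw [hi]; exact hone _
      · rw [htop k Q hQ (fun h' => h (huniq k h')) hIQ hfin]
        have : Subsingleton (O k ⧸ (⊤ : Ideal (O k))) := inferInstance
        exact Module.length_eq_zero
    rw [Finset.sum_congr rfl fun k _ => (hadd k).trans (by rw [hlen k]), Finset.sum_add_distrib,
      hC, hlenC, Finset.sum_ite_eq' Finset.univ i, if_pos (Finset.mem_univ _)]
    rw [ihN]

end CurveBezout

/-! ### Affine charts of the plane, and flatness of the local rings over the chart ring. -/

namespace CurveBezout
open scoped TensorProduct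
open Polynomial (eval₂RingHom)

/-- A basis `v, u, e` of `ℂ³` together with its dual basis `j, k, l`. -/
structure Chart where
  v : Fin 3 → ℂ
  u : Fin 3 → ℂ
  e : Fin 3 → ℂ
  j : Fin 3 → ℂ
  k : Fin 3 → ℂ
  l : Fin 3 → ℂ
  expand : ∀ (x : Fin 3 → ℂ) (i : Fin 3),
    (j ⬝ᵥ x) * v i + (k ⬝ᵥ x) * u i + (l ⬝ᵥ x) * e i = x i
  jv : j ⬝ᵥ v = 1
  ju : j ⬝ᵥ u = 0
  je : j ⬝ᵥ e = 0
  kv : k ⬝ᵥ v = 0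
  ku : k ⬝ᵥ u = 1
  ke : k ⬝ᵥ e = 0
  lv : l ⬝ᵥ v = 0
  lu : l ⬝ᵥ u = 0
  le : l ⬝ᵥ e = 1

/-- The linear form with coefficients `a`. -/
noncomputable def linForm (a : Fin 3 → ℂ) : S := ∑ i, MvPolynomial.C (a i) * MvPolynomial.X i

lemma aeval_linForm {A : Type*} [CommRing A] [Algebra ℂ A] (a : Fin 3 → ℂ) (y : Fin 3 → A) :
    MvPolynomial.aeval y (linForm a) = ∑ i, a i • y i := by
  simp [linForm, Algebra.smul_def]

lemma eval_linForm (a y : Fin 3 → ℂ) : MvPolynomial.eval y (linForm a) = a ⬝ᵥ y := by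
  simp [linForm, dotProduct]

/-- Substitution of the affine line `τ ↦ τ v + a`. -/
noncomputable def lineEval {R : Type*} [CommRing R] [Algebra ℂ R] (v : Fin 3 → ℂ) (a : Fin 3 → R) :
    S →ₐ[ℂ] Polynomial R :=
  MvPolynomial.aeval fun i =>
    Polynomial.C (algebraMap ℂ R (v i)) * Polynomial.X + Polynomial.C (a i)

lemma flat_polynomial_C (R : Type*) [CommRing R] :
    (Polynomial.C : R →+* Polynomial R).Flat := by
  rw [← Polynomial.algebraMap_eq, RingHom.flat_algebraMap_iff]
  infer_instance

/-- An injective ring homomorphism through which a localization map factors is flat. -/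
lemma flat_of_comp_eq_algebraMap {A B O : Type*} [CommRing A] [CommRing B] [CommRing O]
    [Algebra B O] (M : Submonoid B) [IsLocalization M O] (φ : A →+* O) (ψ : B →+* A)
    (hφ : ∀ f, φ (ψ f) = algebraMap B O f) (hinj : Function.Injective φ) : φ.Flat := by
  let := φ.toAlgebra
  -- `O` is itself a localization of `A`, at the elements that become units: fractions over `B` are
  -- already fractions over `A`, and injectivity leaves nothing to cancel.
  have : IsLocalization ((IsUnit.submonoid O).comap φ) O :=
    { map_units := fun y => y.2
      surj := fun z => by
        obtain ⟨⟨a, b⟩, hab⟩ := IsLocalization.surj M z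
        refine ⟨⟨ψ a, ⟨ψ b, ?_⟩⟩, ?_⟩
        · change IsUnit (φ (ψ b))
          rw [hφ]
          exact IsLocalization.map_units O b
        · change z * φ (ψ b) = φ (ψ a)
          rw [hφ, hφ]
          exact hab
      exists_of_eq := fun {y z} hyz => ⟨1, by rw [hinj hyz]⟩ }
  exact IsLocalization.flat O ((IsUnit.submonoid O).comap φ)

/-- The localization map of `B` factors through `R[t]` but not necessarily through `R`. So `θ` is
split as `R → R[t] → O`: the first map is free, the second a localization. -/
lemma flat_of_eval₂RingHom_comp_eq_algebraMap {R B O : Type*} [CommRing R] [CommRing B]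
    [CommRing O] [Algebra B O] (M : Submonoid B) [IsLocalization M O] (θ : R →+* O) (a : O)
    (ψ : B →+* Polynomial R) (hφ : ∀ f, eval₂RingHom θ a (ψ f) = algebraMap B O f)
    (hinj : Function.Injective (eval₂RingHom θ a)) : θ.Flat := by
  have hcomp : θ = (eval₂RingHom θ a).comp Polynomial.C := RingHom.ext fun f => by simp
  rw [hcomp]
  exact RingHom.Flat.comp (flat_polynomial_C _) (flat_of_comp_eq_algebraMap M _ ψ hφ hinj)

namespace Chart

variable (c : Chart)

/-- The base point `s u + e` of the lines of the affine chart `l = 1` in direction `v`. -/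
noncomputable def base (i : Fin 3) : Polynomial ℂ :=
  Polynomial.C (c.u i) * Polynomial.X + Polynomial.C (c.e i)

/-- Restriction of polynomials to the affine chart `l = 1`, with coordinates `τ = j`, `s = k`. -/
noncomputable def restrict : S →ₐ[ℂ] Polynomial (Polynomial ℂ) := lineEval c.v c.base

lemma restrict_X (i : Fin 3) : c.restrict (MvPolynomial.X i) =
    Polynomial.C (Polynomial.C (c.v i)) * Polynomial.X +
      Polynomial.C (Polynomial.C (c.u i) * Polynomial.X + Polynomial.C (c.e i)) := by
  simp [restrict, lineEval, base]

lemma linForm_expand (i : Fin 3) :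
    MvPolynomial.C (c.v i) * linForm c.j + MvPolynomial.C (c.u i) * linForm c.k +
      MvPolynomial.C (c.e i) * linForm c.l = (MvPolynomial.X i : S) := by
  apply MvPolynomial.funext
  intro y
  simp only [map_add, map_mul, MvPolynomial.eval_C, eval_linForm, MvPolynomial.eval_X]
  rw [← c.expand y i]; ring

variable (O : Type) [CommRing O] [Algebra S O]

/-- Dehomogenization: the coordinate ring of the affine chart `l = 1` maps to the local ring at
a point of the chart. -/
noncomputable def dehom : Polynomial (Polynomial ℂ) →+* O :=
  eval₂RingHom (eval₂RingHom ((algebraMap S O).comp MvPolynomial.C)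
      (algebraMap S O (linForm c.k) * Ring.inverse (algebraMap S O (linForm c.l))))
    (algebraMap S O (linForm c.j) * Ring.inverse (algebraMap S O (linForm c.l)))

/-- The extension of dehomogenization to a polynomial ring in one more variable, which is
sent to `l`. -/
noncomputable def dehomPoly : Polynomial (Polynomial (Polynomial ℂ)) →+* O :=
  eval₂RingHom (c.dehom O) (algebraMap S O (linForm c.l))

/-- The homomorphism `xᵢ ↦ t (τ vᵢ + s uᵢ + eᵢ)`. -/
noncomputable def homog : S →+* Polynomial (Polynomial (Polynomial ℂ)) :=
  MvPolynomial.eval₂Hom (Polynomial.C.comp (Polynomial.C.comp Polynomial.C))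
    fun i => Polynomial.X * Polynomial.C (c.restrict (MvPolynomial.X i))

variable {x : Plane} {O}

lemma mem_pointIdeal_linForm (a : Fin 3 → ℂ) : linForm a ∈ pointIdeal x ↔ a ⬝ᵥ x.rep = 0 := by
  rw [pointIdeal, RingHom.mem_ker, aeval_linForm]
  have : ∑ i, a i • (Polynomial.C (x.rep i) * Polynomial.X) =
      Polynomial.C (a ⬝ᵥ x.rep) * Polynomial.X := by
    simp [dotProduct, map_sum, Finset.sum_mul, Polynomial.smul_eq_C_mul, mul_assoc]
  rw [this, mul_eq_zero, Polynomial.C_eq_zero]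
  simp [Polynomial.X_ne_zero]

lemma isUnit_algebraMap_iff [IsLocalization.AtPrime O (pointIdeal x)] (f : S) :
    IsUnit (algebraMap S O f) ↔ f ∉ pointIdeal x :=
  IsLocalization.AtPrime.isUnit_to_map_iff O (pointIdeal x) f

lemma isUnit_algebraMap_linForm [IsLocalization.AtPrime O (pointIdeal x)]
    (h : c.l ⬝ᵥ x.rep ≠ 0) : IsUnit (algebraMap S O (linForm c.l)) := by
  rw [isUnit_algebraMap_iff (x := x), mem_pointIdeal_linForm]; exact h

lemma algebraMap_linForm_mul_dehom_restrict_X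
    (h : IsUnit (algebraMap S O (linForm c.l))) (i : Fin 3) :
    algebraMap S O (linForm c.l) * c.dehom O (c.restrict (MvPolynomial.X i)) =
      algebraMap S O (MvPolynomial.X i) := by
  have hu := Ring.mul_inverse_cancel _ h
  conv_rhs => rw [← c.linForm_expand i]
  rw [restrict_X]
  simp only [dehom, map_add, map_mul, Polynomial.coe_eval₂RingHom, Polynomial.eval₂_C,
    Polynomial.eval₂_X, RingHom.comp_apply]
  linear_combination (algebraMap S O (MvPolynomial.C (c.v i)) * algebraMap S O (linForm c.j) +
    algebraMap S O (MvPolynomial.C (c.u i)) * algebraMap S O (linForm c.k)) * hu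

/-- The scale that dehomogenization forgets is restored by the variable `t`, sent to `l`: in `O` one
has `xᵢ = l (τ vᵢ + s uᵢ + eᵢ)` with `τ = j / l` and `s = k / l`. -/
lemma dehomPoly_homog (h : IsUnit (algebraMap S O (linForm c.l))) (f : S) :
    c.dehomPoly O (c.homog f) = algebraMap S O f := by
  have : (c.dehomPoly O).comp c.homog = algebraMap S O := by
    apply MvPolynomial.ringHom_ext
    · intro a
      simp [dehomPoly, homog, dehom]
    · intro i
      rw [RingHom.comp_apply]
      simp only [homog, MvPolynomial.coe_eval₂Hom, MvPolynomial.eval₂_X]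
      rw [map_mul]
      simp only [dehomPoly, Polynomial.coe_eval₂RingHom, Polynomial.eval₂_X, Polynomial.eval₂_C]
      exact c.algebraMap_linForm_mul_dehom_restrict_X h i
  exact RingHom.congr_fun this f

/-- For homogeneous polynomials, restriction to the chart is division by a power of `l`. -/
lemma algebraMap_eq_mul_dehom_restrict (h : IsUnit (algebraMap S O (linForm c.l))) {f : S} {d : ℕ}
    (hf : f.IsHomogeneous d) :
    algebraMap S O f = algebraMap S O (linForm c.l) ^ d * c.dehom O (c.restrict f) := by
  rw [f.as_sum, map_sum, map_sum, map_sum, Finset.mul_sum]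
  refine Finset.sum_congr rfl fun s hs => ?_
  have hd : s.degree = d := by
    by_contra hne
    exact MvPolynomial.mem_support_iff.mp hs (hf.coeff_eq_zero hne)
  rw [MvPolynomial.monomial_eq, Finsupp.prod_fintype _ _ (by simp)]
  simp only [map_mul, map_prod, map_pow]
  rw [← hd, Finsupp.degree_eq_sum, ← Finset.prod_pow_eq_pow_sum]
  have hC : c.dehom O (c.restrict (MvPolynomial.C (f.coeff s))) =
      algebraMap S O (MvPolynomial.C (f.coeff s)) := by
    rw [← MvPolynomial.algebraMap_eq, AlgHom.commutes]
    simp [dehom, Polynomial.algebraMap_apply]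
  rw [hC, mul_left_comm, ← Finset.prod_mul_distrib]
  congr 1
  refine Finset.prod_congr rfl fun i _ => ?_
  rw [← mul_pow, c.algebraMap_linForm_mul_dehom_restrict_X h]

lemma sum_restrict_X (a : Fin 3 → ℂ) : c.restrict (linForm a) =
    Polynomial.C (Polynomial.C (a ⬝ᵥ c.v)) * Polynomial.X +
      Polynomial.C (Polynomial.C (a ⬝ᵥ c.u) * Polynomial.X + Polynomial.C (a ⬝ᵥ c.e)) := by
  simp only [linForm, map_mul, restrict_X, dotProduct, Fin.sum_univ_three, map_add]
  have hC : ∀ z : ℂ, c.restrict (MvPolynomial.C z) = Polynomial.C (Polynomial.C z) := by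
    intro z
    rw [← MvPolynomial.algebraMap_eq, AlgHom.commutes]
    rfl
  simp only [hC]
  ring

lemma homog_linForm (a : Fin 3 → ℂ) : c.homog (linForm a) =
    Polynomial.X * Polynomial.C (c.restrict (linForm a)) := by
  have hC : ∀ z : ℂ, c.restrict (MvPolynomial.C z) = Polynomial.C (Polynomial.C z) := by
    intro z
    rw [← MvPolynomial.algebraMap_eq, AlgHom.commutes]
    rfl
  simp only [linForm, map_sum, map_mul, hC, homog, MvPolynomial.coe_eval₂Hom,
    MvPolynomial.eval₂_X, MvPolynomial.eval₂_C, RingHom.comp_apply, Finset.mul_sum]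
  exact Finset.sum_congr rfl fun i _ => by ring

/-- Every polynomial in `τ, s, t` becomes a homogenization after multiplication by a power
of `t`. -/
lemma exists_X_pow_mul_eq_homog (f : Polynomial (Polynomial (Polynomial ℂ))) :
    ∃ (N : ℕ) (g : S), Polynomial.X ^ N * f = c.homog g := by
  have hadd : ∀ f f', (∃ (N : ℕ) (g : S), Polynomial.X ^ N * f = c.homog g) →
      (∃ (N : ℕ) (g : S), Polynomial.X ^ N * f' = c.homog g) →
      ∃ (N : ℕ) (g : S), Polynomial.X ^ N * (f + f') = c.homog g := by
    rintro f f' ⟨N, g, h⟩ ⟨N', g', h'⟩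
    refine ⟨N + N', linForm c.l ^ N' * g + linForm c.l ^ N * g', ?_⟩
    have hl : c.homog (linForm c.l) = Polynomial.X := by
      rw [homog_linForm, sum_restrict_X, c.lv, c.lu, c.le]; simp
    rw [map_add, map_mul, map_mul, map_pow, map_pow, hl, ← h, ← h']
    ring
  have hmul : ∀ f f', (∃ (N : ℕ) (g : S), Polynomial.X ^ N * f = c.homog g) →
      (∃ (N : ℕ) (g : S), Polynomial.X ^ N * f' = c.homog g) →
      ∃ (N : ℕ) (g : S), Polynomial.X ^ N * (f * f') = c.homog g := by
    rintro f f' ⟨N, g, h⟩ ⟨N', g', h'⟩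
    refine ⟨N + N', g * g', ?_⟩
    rw [map_mul, ← h, ← h']
    ring
  have hpow : ∀ f, (∃ (N : ℕ) (g : S), Polynomial.X ^ N * f = c.homog g) → ∀ d : ℕ,
      ∃ (N : ℕ) (g : S), Polynomial.X ^ N * f ^ d = c.homog g := by
    rintro f ⟨N, g, h⟩ d
    exact ⟨N * d, g ^ d, by rw [map_pow, ← h]; ring⟩
  have h0 : ∀ z : ℂ, ∃ (N : ℕ) (g : S), Polynomial.X ^ N * Polynomial.C (Polynomial.C
      (Polynomial.C z)) = c.homog g := fun z => ⟨0, MvPolynomial.C z, by simp [homog]⟩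
  have hs : ∃ (N : ℕ) (g : S), Polynomial.X ^ N * Polynomial.C (Polynomial.C
      Polynomial.X) = c.homog g := ⟨1, linForm c.k, by
    rw [homog_linForm, sum_restrict_X, c.kv, c.ku, c.ke]; simp⟩
  have hτ : ∃ (N : ℕ) (g : S), Polynomial.X ^ N * Polynomial.C Polynomial.X = c.homog g :=
    ⟨1, linForm c.j, by rw [homog_linForm, sum_restrict_X, c.jv, c.ju, c.je]; simp⟩
  have ht : ∃ (N : ℕ) (g : S), Polynomial.X ^ N * Polynomial.X = c.homog g :=
    ⟨0, linForm c.l, by rw [homog_linForm, sum_restrict_X, c.lv, c.lu, c.le]; simp⟩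
  have h1 : ∀ f : Polynomial ℂ, ∃ (N : ℕ) (g : S), Polynomial.X ^ N * Polynomial.C (Polynomial.C f)
      = c.homog g := by
    intro f
    induction f using Polynomial.induction_on' with
    | add p q hp hq => simpa only [map_add] using hadd _ _ hp hq
    | monomial d a =>
      rw [← Polynomial.C_mul_X_pow_eq_monomial, map_mul, map_mul, map_pow, map_pow]
      exact hmul _ _ (h0 a) (hpow _ hs d)
  have h2 : ∀ f : Polynomial (Polynomial ℂ), ∃ (N : ℕ) (g : S),
      Polynomial.X ^ N * Polynomial.C f = c.homog g := by
    intro f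
    induction f using Polynomial.induction_on' with
    | add p q hp hq => simpa only [map_add] using hadd _ _ hp hq
    | monomial d a =>
      rw [← Polynomial.C_mul_X_pow_eq_monomial, map_mul, map_pow]
      exact hmul _ _ (h1 a) (hpow _ hτ d)
  induction f using Polynomial.induction_on' with
  | add p q hp hq => exact hadd _ _ hp hq
  | monomial d a =>
    rw [← Polynomial.C_mul_X_pow_eq_monomial]
    exact hmul _ _ (h2 a) (hpow _ ht d)

lemma algebraMap_injective (x : Plane) [IsLocalization.AtPrime O (pointIdeal x)] :
    Function.Injective (algebraMap S O) :=
  IsLocalization.injective O (Ideal.primeCompl_le_nonZeroDivisors (pointIdeal x))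

/-- Up to a power of `t` every element comes from `S`, and the domain `S` embeds in its
localization. -/
lemma dehomPoly_injective (x : Plane) [IsLocalization.AtPrime O (pointIdeal x)]
    (h : IsUnit (algebraMap S O (linForm c.l))) : Function.Injective (c.dehomPoly O) := by
  rw [injective_iff_map_eq_zero]
  intro f hf
  obtain ⟨N, g, hg⟩ := c.exists_X_pow_mul_eq_homog f
  have h1 : algebraMap S O g = 0 := by rw [← c.dehomPoly_homog h, ← hg, map_mul, hf, mul_zero]
  have h2 : g = 0 := algebraMap_injective x (by rw [h1, map_zero])
  rw [h2, map_zero] at hg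
  exact (mul_eq_zero.mp hg).resolve_left (pow_ne_zero _ Polynomial.X_ne_zero)

lemma flat_dehom (x : Plane) [IsLocalization.AtPrime O (pointIdeal x)]
    (h : IsUnit (algebraMap S O (linForm c.l))) : (c.dehom O).Flat := by
  exact flat_of_eval₂RingHom_comp_eq_algebraMap (pointIdeal x).primeCompl (c.dehom O)
    (algebraMap S O (linForm c.l)) c.homog (c.dehomPoly_homog h) (c.dehomPoly_injective x h)

end Chart
end CurveBezout

/-! ### Points of the chart, their maximal ideals and their local rings. -/

namespace CurveBezout
open scoped TensorProduct
open Polynomial (eval₂RingHom)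

lemma eval_smul_of_isHomogeneous {f : S} {d : ℕ} (hf : f.IsHomogeneous d) (a : ℂ)
    (y : Fin 3 → ℂ) : MvPolynomial.eval (a • y) f = a ^ d * MvPolynomial.eval y f := by
  rw [MvPolynomial.eval_eq, MvPolynomial.eval_eq, Finset.mul_sum]
  refine Finset.sum_congr rfl fun s hs => ?_
  have hd : s.degree = d := by
    by_contra hne
    exact MvPolynomial.mem_support_iff.mp hs (hf.coeff_eq_zero hne)
  have : ∏ i ∈ s.support, (a • y) i ^ s i = a ^ d * ∏ i ∈ s.support, y i ^ s i := by
    simp only [Pi.smul_apply, smul_eq_mul, mul_pow]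
    rw [Finset.prod_mul_distrib, Finset.prod_pow_eq_pow_sum, ← hd, Finsupp.degree]
    rfl
  rw [this]; ring

lemma eval_discr {m : ℕ} (D : Fin 3 → Matrix (Fin m) (Fin m) ℂ) (y : Fin 3 → ℂ) :
    MvPolynomial.eval y (discr D) = (pencilAt D y).det := by
  rw [discr, RingHom.map_det]
  congr 1
  ext a b
  simp [pencil, pencilAt]

lemma pencilAt_smul {m : ℕ} (D : Fin 3 → Matrix (Fin m) (Fin m) ℂ) (a : ℂ) (y : Fin 3 → ℂ) :
    pencilAt D (a • y) = a • pencilAt D y := by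
  simp [pencilAt, smul_sub, smul_add, mul_smul]

lemma eval_discr_smul {m : ℕ} (D : Fin 3 → Matrix (Fin m) (Fin m) ℂ) (a : ℂ) (y : Fin 3 → ℂ) :
    MvPolynomial.eval (a • y) (discr D) = a ^ m * MvPolynomial.eval y (discr D) := by
  rw [eval_discr, eval_discr, pencilAt_smul, Matrix.det_smul, Fintype.card_fin]

lemma mk_mem_commonZeros {m d d' : ℕ} {D : Fin 3 → Matrix (Fin m) (Fin m) ℂ} {p q : S}
    (hp : p.IsHomogeneous d) (hq : q.IsHomogeneous d') {y : Fin 3 → ℂ} (hy : y ≠ 0)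
    (h0 : MvPolynomial.eval y (discr D) = 0) (h1 : MvPolynomial.eval y p = 0)
    (h2 : MvPolynomial.eval y q = 0) :
    Projectivization.mk ℂ y hy ∈ commonZeros D p q := by
  obtain ⟨a, ha⟩ := Projectivization.exists_smul_eq_mk_rep ℂ y hy
  have ha' : (Projectivization.mk ℂ y hy).rep = (a : ℂ) • y := ha.symm
  refine ⟨?_, ?_, ?_⟩
  · rw [ha', eval_discr_smul, h0, mul_zero]
  · rw [ha', eval_smul_of_isHomogeneous hp, h1, mul_zero]
  · rw [ha', eval_smul_of_isHomogeneous hq, h2, mul_zero]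

namespace Chart

variable (c : Chart)

/-- Evaluation at the point of the affine chart with coordinates `s, τ`. -/
noncomputable def evalAt (s τ : ℂ) : Polynomial (Polynomial ℂ) →+* ℂ :=
  eval₂RingHom (Polynomial.evalRingHom s) τ

/-- The vector of homogeneous coordinates of the point with chart coordinates `s, τ`. -/
def vec (s τ : ℂ) : Fin 3 → ℂ := τ • c.v + s • c.u + c.e

lemma l_vec (s τ : ℂ) : c.l ⬝ᵥ c.vec s τ = 1 := by
  simp [vec, dotProduct_add, dotProduct_smul, c.lv, c.lu, c.le]

lemma k_vec (s τ : ℂ) : c.k ⬝ᵥ c.vec s τ = s := by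
  simp [vec, dotProduct_add, dotProduct_smul, c.kv, c.ku, c.ke]

lemma j_vec (s τ : ℂ) : c.j ⬝ᵥ c.vec s τ = τ := by
  simp [vec, dotProduct_add, dotProduct_smul, c.jv, c.ju, c.je]

lemma vec_ne_zero (s τ : ℂ) : c.vec s τ ≠ 0 := by
  intro h
  have := c.l_vec s τ
  rw [h, dotProduct_zero] at this
  exact zero_ne_one this

lemma evalAt_restrict (s τ : ℂ) (f : S) :
    evalAt s τ (c.restrict f) = MvPolynomial.eval (c.vec s τ) f := by
  have : (evalAt s τ).comp (c.restrict : S →+* _) = MvPolynomial.eval (c.vec s τ) := by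
    apply MvPolynomial.ringHom_ext
    · intro a
      simp only [RingHom.comp_apply, MvPolynomial.eval_C]
      rw [← MvPolynomial.algebraMap_eq]
      change evalAt s τ (c.restrict (algebraMap ℂ S a)) = a
      rw [AlgHom.commutes]
      simp [evalAt, Polynomial.algebraMap_apply]
    · intro i
      change evalAt s τ (c.restrict (MvPolynomial.X i)) = _
      rw [restrict_X]
      simp [evalAt, vec]; ring
  exact RingHom.congr_fun this f

/-- The `s` coordinate of a point in the chart. -/
noncomputable def sCoord (x : Plane) : ℂ := (c.k ⬝ᵥ x.rep) / (c.l ⬝ᵥ x.rep)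

/-- The `τ` coordinate of a point in the chart. -/
noncomputable def tCoord (x : Plane) : ℂ := (c.j ⬝ᵥ x.rep) / (c.l ⬝ᵥ x.rep)

/-- The maximal ideal of a point in the coordinate ring of the affine chart. -/
noncomputable def maxIdeal (x : Plane) : Ideal (Polynomial (Polynomial ℂ)) :=
  RingHom.ker (evalAt (c.sCoord x) (c.tCoord x))

lemma rep_eq_smul_vec {x : Plane} (h : c.l ⬝ᵥ x.rep ≠ 0) :
    x.rep = (c.l ⬝ᵥ x.rep) • c.vec (c.sCoord x) (c.tCoord x) := by
  ext i
  rw [← c.expand x.rep i]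
  simp only [vec, sCoord, tCoord, Pi.smul_apply, Pi.add_apply, smul_eq_mul]
  rw [c.expand x.rep i]
  field_simp
  rw [c.expand x.rep i]

lemma mk_vec_coord {x : Plane} (h : c.l ⬝ᵥ x.rep ≠ 0) :
    Projectivization.mk ℂ (c.vec (c.sCoord x) (c.tCoord x)) (c.vec_ne_zero _ _) = x := by
  conv_rhs => rw [← x.mk_rep]
  rw [Projectivization.mk_eq_mk_iff']
  exact ⟨(c.l ⬝ᵥ x.rep)⁻¹, by rw [inv_smul_eq_iff₀ h]; exact c.rep_eq_smul_vec h⟩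

lemma sCoord_mk {s τ : ℂ} (hy : c.vec s τ ≠ 0) :
    c.sCoord (Projectivization.mk ℂ (c.vec s τ) hy) = s := by
  obtain ⟨a, ha⟩ := Projectivization.exists_smul_eq_mk_rep ℂ _ hy
  have ha' : (Projectivization.mk ℂ (c.vec s τ) hy).rep = (a : ℂ) • c.vec s τ := ha.symm
  rw [sCoord, ha', dotProduct_smul, dotProduct_smul, c.l_vec, c.k_vec]
  simp

lemma tCoord_mk {s τ : ℂ} (hy : c.vec s τ ≠ 0) :
    c.tCoord (Projectivization.mk ℂ (c.vec s τ) hy) = τ := by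
  obtain ⟨a, ha⟩ := Projectivization.exists_smul_eq_mk_rep ℂ _ hy
  have ha' : (Projectivization.mk ℂ (c.vec s τ) hy).rep = (a : ℂ) • c.vec s τ := ha.symm
  rw [tCoord, ha', dotProduct_smul, dotProduct_smul, c.l_vec, c.j_vec]
  simp

/-- A residue field finite over ℂ is ℂ, so the classes of the two variables are numbers; they are
the coordinates of the point. -/
lemma exists_eq_ker_evalAt (Q : Ideal (Polynomial (Polynomial ℂ))) [hQ : Q.IsMaximal]
    [Module.Finite ℂ (Polynomial (Polynomial ℂ) ⧸ Q)] :
    ∃ s τ : ℂ, Q = RingHom.ker (evalAt s τ) := by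
  let := Ideal.Quotient.field Q
  have hb : Function.Bijective (algebraMap ℂ (Polynomial (Polynomial ℂ) ⧸ Q)) :=
    IsAlgClosed.algebraMap_bijective_of_isIntegral
  obtain ⟨s, hs⟩ := hb.2 (Ideal.Quotient.mk Q (Polynomial.C Polynomial.X))
  obtain ⟨τ, hτ⟩ := hb.2 (Ideal.Quotient.mk Q Polynomial.X)
  have hcomp : (algebraMap ℂ (Polynomial (Polynomial ℂ) ⧸ Q)).comp (evalAt s τ) =
      Ideal.Quotient.mk Q := by
    refine Polynomial.ringHom_ext' (Polynomial.ringHom_ext ?_ ?_) ?_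
    · intro a
      simp only [RingHom.comp_apply, evalAt, Polynomial.coe_eval₂RingHom, Polynomial.eval₂_C,
        Polynomial.coe_evalRingHom, Polynomial.eval_C]
      rfl
    · simpa [evalAt] using hs
    · simpa [evalAt] using hτ
  refine ⟨s, τ, ?_⟩
  ext f
  rw [RingHom.mem_ker, ← Ideal.Quotient.eq_zero_iff_mem, ← hcomp, RingHom.comp_apply,
    map_eq_zero_iff _ hb.1]

section Local

variable {x : Plane} {O : Type} [CommRing O] [Algebra S O] [IsLocalization.AtPrime O (pointIdeal x)]

variable (x) in
lemma dehom_sub_mem_maximalIdeal [IsLocalRing O] (h : c.l ⬝ᵥ x.rep ≠ 0)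
    (f : Polynomial (Polynomial ℂ)) :
    c.dehom O f - algebraMap S O (MvPolynomial.C (evalAt (c.sCoord x) (c.tCoord x) f)) ∈
      IsLocalRing.maximalIdeal O := by
  have hu : IsUnit (algebraMap S O (linForm c.l)) := c.isUnit_algebraMap_linForm (x := x) h
  have hlin : ∀ a : Fin 3 → ℂ, algebraMap S O (linForm a) * Ring.inverse
      (algebraMap S O (linForm c.l)) - algebraMap S O (MvPolynomial.C
        ((a ⬝ᵥ x.rep) / (c.l ⬝ᵥ x.rep))) ∈ IsLocalRing.maximalIdeal O := by
    intro a
    have h1 : linForm a - MvPolynomial.C ((a ⬝ᵥ x.rep) / (c.l ⬝ᵥ x.rep)) * linForm c.l ∈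
        pointIdeal x := by
      have : linForm a - MvPolynomial.C ((a ⬝ᵥ x.rep) / (c.l ⬝ᵥ x.rep)) * linForm c.l =
          linForm (a - ((a ⬝ᵥ x.rep) / (c.l ⬝ᵥ x.rep)) • c.l) := by
        simp only [linForm, Finset.mul_sum, ← Finset.sum_sub_distrib]
        refine Finset.sum_congr rfl fun i _ => ?_
        simp only [Pi.sub_apply, Pi.smul_apply, smul_eq_mul, map_sub, map_mul]
        ring
      rw [this, mem_pointIdeal_linForm, sub_dotProduct, smul_dotProduct, smul_eq_mul,
        div_mul_cancel₀ _ h, sub_self]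
    have h2 : algebraMap S O (linForm a - MvPolynomial.C ((a ⬝ᵥ x.rep) / (c.l ⬝ᵥ x.rep)) *
        linForm c.l) ∈ IsLocalRing.maximalIdeal O := by
      rw [IsLocalRing.mem_maximalIdeal, mem_nonunits_iff, isUnit_algebraMap_iff (x := x)]
      exact not_not.mpr h1
    have h3 := Ideal.mul_mem_right (Ring.inverse (algebraMap S O (linForm c.l))) _ h2
    rw [map_sub, map_mul, sub_mul, mul_assoc, Ring.mul_inverse_cancel _ hu, mul_one] at h3
    exact h3
  have hcomp : (Ideal.Quotient.mk (IsLocalRing.maximalIdeal O)).comp (c.dehom O) =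
      ((Ideal.Quotient.mk (IsLocalRing.maximalIdeal O)).comp ((algebraMap S O).comp
        MvPolynomial.C)).comp (evalAt (c.sCoord x) (c.tCoord x)) := by
    refine Polynomial.ringHom_ext' (Polynomial.ringHom_ext ?_ ?_) ?_
    · intro a
      simp [evalAt, dehom]
    · have := hlin c.k
      rw [← Ideal.Quotient.eq] at this
      simpa [evalAt, dehom, sCoord] using this
    · have := hlin c.j
      rw [← Ideal.Quotient.eq] at this
      simpa [evalAt, dehom, tCoord] using this
  rw [← Ideal.Quotient.eq]
  exact RingHom.congr_fun hcomp f

variable (x) in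
lemma isUnit_dehom [IsLocalRing O] (h : c.l ⬝ᵥ x.rep ≠ 0)
    {f : Polynomial (Polynomial ℂ)} (hf : f ∉ c.maxIdeal x) : IsUnit (c.dehom O f) := by
  by_contra hn
  have h1 := c.dehom_sub_mem_maximalIdeal x (O := O) h f
  have h2 : algebraMap S O (MvPolynomial.C (evalAt (c.sCoord x) (c.tCoord x) f)) ∈
      IsLocalRing.maximalIdeal O := by
    have := Ideal.sub_mem _ ((IsLocalRing.mem_maximalIdeal _).mpr hn) h1
    rwa [sub_sub_cancel] at this
  rw [IsLocalRing.mem_maximalIdeal, mem_nonunits_iff] at h2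
  refine h2 (((isUnit_iff_ne_zero.mpr ?_).map MvPolynomial.C).map (algebraMap S O))
  exact hf

-- The residue field of `O` is larger than ℂ, because `O` inverts elements of all degrees; still,
-- its maximal ideal is generated by that of the point in the chart. Modulo the latter, `xᵢ` is a
-- constant multiple of `l`, so `S → O / J` factors through restriction to the line ℂ `x.rep`, whose
-- kernel is the ideal of the point.
variable (x) in
lemma map_dehom_maxIdeal [IsLocalRing O] (h : c.l ⬝ᵥ x.rep ≠ 0) :
    (c.maxIdeal x).map (c.dehom O) = IsLocalRing.maximalIdeal O := by
  apply le_antisymm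
  · rw [Ideal.map_le_iff_le_comap]
    intro f hf
    have h1 := c.dehom_sub_mem_maximalIdeal x (O := O) h f
    have h0 : evalAt (c.sCoord x) (c.tCoord x) f = 0 := hf
    rw [h0, map_zero, map_zero, sub_zero] at h1
    exact h1
  · have hu : IsUnit (algebraMap S O (linForm c.l)) := c.isUnit_algebraMap_linForm (x := x) h
    rw [← IsLocalization.AtPrime.map_eq_maximalIdeal (pointIdeal x) O, Ideal.map_le_iff_le_comap]
    intro f hf
    rw [Ideal.mem_comap, ← Ideal.Quotient.eq_zero_iff_mem]
    set J := (c.maxIdeal x).map (c.dehom O)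
    have hX : ∀ i, Ideal.Quotient.mk J (algebraMap S O (MvPolynomial.X i)) =
        Ideal.Quotient.mk J (algebraMap S O (MvPolynomial.C
          ((x.rep i) / (c.l ⬝ᵥ x.rep)) * linForm c.l)) := by
      intro i
      have h1 : c.restrict (MvPolynomial.X i) - Polynomial.C (Polynomial.C
          ((x.rep i) / (c.l ⬝ᵥ x.rep))) ∈ c.maxIdeal x := by
        rw [maxIdeal, RingHom.mem_ker, map_sub, evalAt_restrict, MvPolynomial.eval_X]
        have h2 : x.rep i / (c.l ⬝ᵥ x.rep) = c.vec (c.sCoord x) (c.tCoord x) i := by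
          have h3 := congrFun (c.rep_eq_smul_vec h) i
          rw [Pi.smul_apply, smul_eq_mul] at h3
          rw [div_eq_iff h, mul_comm]
          exact h3
        rw [h2]
        simp [evalAt]
      have h2 := Ideal.mul_mem_left _ (algebraMap S O (linForm c.l))
        (Ideal.mem_map_of_mem (c.dehom O) h1)
      rw [map_sub, mul_sub, c.algebraMap_linForm_mul_dehom_restrict_X hu] at h2
      have h3 : c.dehom O (Polynomial.C (Polynomial.C ((x.rep i) / (c.l ⬝ᵥ x.rep)))) =
          algebraMap S O (MvPolynomial.C ((x.rep i) / (c.l ⬝ᵥ x.rep))) := by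
        simp [dehom]
      rw [h3] at h2
      rw [Ideal.Quotient.eq, map_mul, mul_comm (algebraMap S O (MvPolynomial.C _))]
      exact h2
    have hcomp : (Ideal.Quotient.mk J).comp (algebraMap S O) =
        (eval₂RingHom ((Ideal.Quotient.mk J).comp ((algebraMap S O).comp MvPolynomial.C))
          (Ideal.Quotient.mk J (algebraMap S O (MvPolynomial.C (c.l ⬝ᵥ x.rep)⁻¹ *
            linForm c.l)))).comp
          (MvPolynomial.aeval (fun k => Polynomial.C (x.rep k) * Polynomial.X) :
            S →ₐ[ℂ] Polynomial ℂ).toRingHom := by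
      apply MvPolynomial.ringHom_ext
      · intro a
        simp
      · intro i
        simp only [RingHom.comp_apply, hX i]
        simp [div_eq_mul_inv, mul_assoc]
    have h3 := RingHom.congr_fun hcomp f
    rw [RingHom.comp_apply, RingHom.comp_apply] at h3
    have h4 : (MvPolynomial.aeval (fun k => Polynomial.C (x.rep k) * Polynomial.X) :
            S →ₐ[ℂ] Polynomial ℂ).toRingHom f = 0 := hf
    rw [h3, h4, map_zero]

variable (x) in
lemma length_quotient_map_maxIdeal [IsLocalRing O] (h : c.l ⬝ᵥ x.rep ≠ 0) :
    Module.length O (O ⧸ (c.maxIdeal x).map (c.dehom O)) = 1 := by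
  rw [c.map_dehom_maxIdeal x h, Module.length_eq_one_iff, isSimpleModule_iff_isCoatom]
  exact (IsLocalRing.maximalIdeal.isMaximal O).out

end Local

end Chart
end CurveBezout

/-! ### Presentation of the cokernel modulo `p` and `q`, and its base change. -/

namespace CurveBezout
open scoped TensorProduct

section Presentation

variable {A : Type*} [CommRing A] {m : ℕ}

/-- The map `(x, y, z) ↦ L x + p y + q z`, whose cokernel is `(A^m / L A^m) / (p, q)`. -/
noncomputable def presMap (L : Matrix (Fin m) (Fin m) A) (p q : A) :
    ((Fin m → A) × (Fin m → A) × (Fin m → A)) →ₗ[A] (Fin m → A) :=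
  L.mulVecLin.coprod ((p • LinearMap.id).coprod (q • LinearMap.id))

lemma presMap_apply (L : Matrix (Fin m) (Fin m) A) (p q : A)
    (x : (Fin m → A) × (Fin m → A) × (Fin m → A)) :
    presMap L p q x = L *ᵥ x.1 + (p • x.2.1 + q • x.2.2) := rfl

lemma range_presMap (L : Matrix (Fin m) (Fin m) A) (p q : A) :
    LinearMap.range (presMap L p q) =
      LinearMap.range L.mulVecLin ⊔ Ideal.span {p, q} • (⊤ : Submodule A (Fin m → A)) := by
  rw [presMap, LinearMap.range_coprod, LinearMap.range_coprod]
  congr 1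
  rw [Ideal.span_insert, Submodule.sup_smul, Submodule.ideal_span_singleton_smul,
    Submodule.ideal_span_singleton_smul]
  congr 1 <;> ext x <;>
  simp [Submodule.mem_smul_pointwise_iff_exists]

lemma length_coker_quotient (L : Matrix (Fin m) (Fin m) A) (p q : A) :
    Module.length A (((Fin m → A) ⧸ LinearMap.range L.mulVecLin) ⧸
      (Ideal.span {p, q} • (⊤ : Submodule A ((Fin m → A) ⧸ LinearMap.range L.mulVecLin)))) =
    Module.length A ((Fin m → A) ⧸ LinearMap.range (presMap L p q)) := by
  have h : Ideal.span {p, q} • (⊤ : Submodule A ((Fin m → A) ⧸ LinearMap.range L.mulVecLin)) =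
      (Ideal.span {p, q} • (⊤ : Submodule A (Fin m → A))).map
        (LinearMap.range L.mulVecLin).mkQ := by
    rw [Submodule.map_smul'', Submodule.map_top, Submodule.range_mkQ]
  rw [h, (Submodule.quotientQuotientEquivQuotientSup _ _).length_eq, range_presMap]

lemma range_presMap_le {L L' : Matrix (Fin m) (Fin m) A} {p p' q q' : A} (a b c : A)
    (hL : L = a • L') (hp : p = b * p') (hq : q = c * q') :
    LinearMap.range (presMap L p q) ≤ LinearMap.range (presMap L' p' q') := by
  subst hL hp hq
  rintro _ ⟨y, rfl⟩
  refine ⟨(a • y.1, b • y.2.1, c • y.2.2), ?_⟩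
  simp [presMap_apply, Matrix.mulVec_smul, Matrix.smul_mulVec, mul_smul, smul_comm p',
    smul_comm q']

lemma range_presMap_of_isUnit {L L' : Matrix (Fin m) (Fin m) A} {p p' q q' a b c : A}
    (ha : IsUnit a) (hb : IsUnit b) (hc : IsUnit c) (hL : L = a • L') (hp : p = b * p')
    (hq : q = c * q') : LinearMap.range (presMap L p q) = LinearMap.range (presMap L' p' q') := by
  obtain ⟨a, rfl⟩ := ha
  obtain ⟨b, rfl⟩ := hb
  obtain ⟨c, rfl⟩ := hc
  refine le_antisymm (range_presMap_le _ _ _ hL hp hq)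
    (range_presMap_le (↑a⁻¹ : A) (↑b⁻¹ : A) (↑c⁻¹ : A) ?_ ?_ ?_)
  · rw [hL, smul_smul, Units.inv_mul, one_smul]
  · rw [hp, Units.inv_mul_cancel_left]
  · rw [hq, Units.inv_mul_cancel_left]

variable {R O : Type} [CommRing R] [CommRing O] [Algebra R O]

/-- Tensor products are right exact, so base change of a cokernel is the cokernel of the
base-changed presentation. -/
lemma length_baseChange_coker_presMap (L : Matrix (Fin m) (Fin m) R) (p q : R) :
    Module.length O (O ⊗[R] ((Fin m → R) ⧸ LinearMap.range (presMap L p q))) =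
      Module.length O ((Fin m → O) ⧸ LinearMap.range
        (presMap (L.map (algebraMap R O)) (algebraMap R O p) (algebraMap R O q))) := by
  set f := presMap L p q
  set f' := presMap (L.map (algebraMap R O)) (algebraMap R O p) (algebraMap R O q)
  let h2 : (Fin m → R) →ₗ[R] (Fin m → O) := (Algebra.linearMap R O).compLeft (Fin m)
  have hb : IsBaseChange O h2 := (IsBaseChange.linearMap R O).finitePow (Fin m)
  let h1 := h2.prodMap (h2.prodMap h2)
  have hb1 : IsBaseChange O h1 := hb.prodMap _ _ (hb.prodMap _ _ hb)
  have hcomm : h2.comp f = (f'.restrictScalars R).comp h1 := by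
    refine LinearMap.ext fun x => funext fun i => ?_
    change algebraMap R O (f x i) = f' (h1 x) i
    simp only [f, f', presMap_apply, Pi.add_apply, map_add, Pi.smul_apply, smul_eq_mul, map_mul,
      RingHom.map_mulVec]
    rfl
  let h3 : ((Fin m → R) ⧸ LinearMap.range f) →ₗ[R] ((Fin m → O) ⧸ LinearMap.range f') :=
    (LinearMap.range f).liftQ (((LinearMap.range f').mkQ.restrictScalars R).comp h2) (by
      rintro _ ⟨x, rfl⟩
      have h := LinearMap.congr_fun hcomm x
      rw [LinearMap.mem_ker]
      change (LinearMap.range f').mkQ (h2.comp f x) = 0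
      rw [h]
      exact (Submodule.Quotient.mk_eq_zero _).mpr ⟨h1 x, rfl⟩)
  have hb3 : IsBaseChange O h3 :=
    IsBaseChange.of_right_exact (f := f) (g := (LinearMap.range f).mkQ) (f' := f')
      (g' := (LinearMap.range f').mkQ) O h1 h2 h3 hcomm (by ext; rfl) hb1 hb
      (LinearMap.exact_map_mkQ_range f) (Submodule.mkQ_surjective _)
      (LinearMap.exact_map_mkQ_range f') (Submodule.mkQ_surjective _)
  exact hb3.equiv.length_eq

end Presentation
end CurveBezout

/-! ### The sum of the multiplicities as a dimension on the chart. -/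

namespace CurveBezout
open scoped TensorProduct

lemma pencil_apply_isHomogeneous {m : ℕ} (D : Fin 3 → Matrix (Fin m) (Fin m) ℂ) (a b : Fin m) :
    (pencil D a b).IsHomogeneous 1 := by
  have h : ∀ (k : Fin 3) (z : ℂ),
      (MvPolynomial.X k * MvPolynomial.C z : S).IsHomogeneous 1 := by
    intro k z
    rw [mul_comm]
    exact MvPolynomial.isHomogeneous_C_mul_X z k
  simp only [pencil, Matrix.add_apply, Matrix.sub_apply, Matrix.smul_apply, Matrix.map_apply,
    smul_eq_mul]
  exact ((h _ _).add (h _ _)).sub (h _ _)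

namespace Chart

variable (c : Chart) {m n : ℕ} (D : Fin 3 → Matrix (Fin m) (Fin m) ℂ) (p q : S)

/-- The cokernel of the determinantal representation modulo `p` and `q`, restricted to the
affine chart. -/
abbrev ChartCoker : Type :=
  (Fin m → Polynomial (Polynomial ℂ)) ⧸ LinearMap.range
    (presMap ((pencil D).map c.restrict) (c.restrict p) (c.restrict q))

variable {D p q}

/-- For `Δ` this is Cramer's rule: `L adj(L) = Δ`, so every multiple of `Δ` is in the image of `L`.
-/
lemma smul_chartCoker_eq_zero (a : Polynomial (Polynomial ℂ))
    (ha : a ∈ Ideal.span {c.restrict p, c.restrict q, c.restrict (discr D)})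
    (x : c.ChartCoker D p q) : a • x = 0 := by
  have hle : Ideal.span {c.restrict p, c.restrict q, c.restrict (discr D)} ≤
      Module.annihilator (Polynomial (Polynomial ℂ)) (c.ChartCoker D p q) := by
    rw [Ideal.span_le]
    intro b hb
    rw [SetLike.mem_coe, Module.mem_annihilator]
    intro y
    obtain ⟨f, rfl⟩ := Submodule.mkQ_surjective _ y
    rw [← map_smul, Submodule.mkQ_apply, Submodule.Quotient.mk_eq_zero]
    rcases hb with rfl | rfl | rfl
    · exact ⟨(0, f, 0), by simp [presMap_apply]⟩
    · exact ⟨(0, 0, f), by simp [presMap_apply]⟩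
    · refine ⟨(((pencil D).map c.restrict).adjugate *ᵥ f, 0, 0), ?_⟩
      have h : c.restrict (discr D) = ((pencil D).map c.restrict).det := by
        rw [discr, AlgHom.map_det]; rfl
      simp only [presMap_apply, smul_zero, add_zero, Matrix.mulVec_mulVec, Matrix.mul_adjugate]
      rw [h, Matrix.smul_mulVec, Matrix.one_mulVec]
  exact Module.mem_annihilator.mp (hle ha) x

/-- Homogeneous data and their restrictions to the chart differ by powers of `l`, units at `x`; the
image of the presentation does not see units. -/
lemma zeroMult_eq_length_baseChange (hp : p.IsHomogeneous n) (hq : q.IsHomogeneous n) {x : Plane}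
    (h : c.l ⬝ᵥ x.rep ≠ 0) :
    letI := (c.dehom (Loc x)).toAlgebra
    zeroMult D p q x =
      Module.length (Loc x) (Loc x ⊗[Polynomial (Polynomial ℂ)] c.ChartCoker D p q) := by
  let := (c.dehom (Loc x)).toAlgebra
  have hu : IsUnit (algebraMap S (Loc x) (linForm c.l)) := c.isUnit_algebraMap_linForm (x := x) h
  rw [length_baseChange_coker_presMap]
  refine (length_coker_quotient ((pencil D).map (toLoc x)) (toLoc x p) (toLoc x q)).trans ?_
  have hr : LinearMap.range (presMap ((pencil D).map (toLoc x)) (toLoc x p) (toLoc x q)) =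
      LinearMap.range (presMap (((pencil D).map c.restrict).map
        (algebraMap (Polynomial (Polynomial ℂ)) (Loc x)))
        (algebraMap (Polynomial (Polynomial ℂ)) (Loc x) (c.restrict p))
        (algebraMap (Polynomial (Polynomial ℂ)) (Loc x) (c.restrict q))) := by
    refine range_presMap_of_isUnit (hu.pow 1) (hu.pow n) (hu.pow n) ?_
      (c.algebraMap_eq_mul_dehom_restrict hu hp) (c.algebraMap_eq_mul_dehom_restrict hu hq)
    ext a b
    exact c.algebraMap_eq_mul_dehom_restrict hu (pencil_apply_isHomogeneous D a b)
  rw [hr]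

/-- The sum of the multiplicities is the dimension of the cokernel on an affine chart that
contains all common zeros. -/
theorem sum_zeroMult (hp : p.IsHomogeneous n) (hq : q.IsHomogeneous n)
    (hfin : (commonZeros D p q).Finite) (hl : ∀ x ∈ commonZeros D p q, c.l ⬝ᵥ x.rep ≠ 0)
    [Module.Finite ℂ (c.ChartCoker D p q)] :
    ∑ᶠ x ∈ commonZeros D p q, zeroMult D p q x = Module.length ℂ (c.ChartCoker D p q) := by
  let := hfin.fintype
  let alg : ∀ x : commonZeros D p q, Algebra (Polynomial (Polynomial ℂ)) (Loc x.1) :=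
    fun x => (c.dehom (Loc x.1)).toAlgebra
  have hflat : ∀ x : commonZeros D p q, Module.Flat (Polynomial (Polynomial ℂ)) (Loc x.1) :=
    fun x => c.flat_dehom x.1 (c.isUnit_algebraMap_linForm (x := x.1) (hl x.1 x.2))
  rw [← finsum_set_coe_eq_finsum_mem, finsum_eq_sum_of_fintype,
    Finset.sum_congr rfl fun (x : commonZeros D p q) _ =>
      c.zeroMult_eq_length_baseChange hp hq (hl x.1 x.2)]
  refine sum_length_baseChange (fun x : commonZeros D p q => Loc x.1)
    (Ideal.span {c.restrict p, c.restrict q, c.restrict (discr D)})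
    (fun x => c.maxIdeal x.1) (fun x => c.length_quotient_map_maxIdeal x.1 (hl x.1 x.2))
    ?_ ?_ c.smul_chartCoker_eq_zero
  -- Any other maximal ideal contains a function not vanishing at `x`, which is a unit in the local
  -- ring.
  · intro x Q hQ hne _ _
    have hprime : (c.maxIdeal x.1).IsPrime := RingHom.ker_isPrime _
    obtain ⟨f, hfQ, hf⟩ : ∃ f ∈ Q, f ∉ c.maxIdeal x.1 := by
      by_contra! hcon
      exact hne (hQ.eq_of_le hprime.ne_top hcon)
    exact Ideal.eq_top_of_isUnit_mem _ (Ideal.mem_map_of_mem _ hfQ)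
      (c.isUnit_dehom x.1 (hl x.1 x.2) hf)
  -- A maximal ideal containing `p, q, Δ` is a point of the chart where all three vanish, so it is a
  -- common zero; its chart coordinates determine it.
  · intro Q hQ hI _
    obtain ⟨s, τ, rfl⟩ := exists_eq_ker_evalAt Q
    have hz : ∀ f, c.restrict f ∈ Ideal.span {c.restrict p, c.restrict q, c.restrict (discr D)} →
        MvPolynomial.eval (c.vec s τ) f = 0 := by
      intro f hf
      rw [← evalAt_restrict]
      exact hI hf
    have hmem : Projectivization.mk ℂ (c.vec s τ) (c.vec_ne_zero s τ) ∈ commonZeros D p q :=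
      mk_mem_commonZeros hp hq _ (hz _ (Ideal.subset_span (by simp)))
        (hz _ (Ideal.subset_span (by simp))) (hz _ (Ideal.subset_span (by simp)))
    refine ⟨⟨_, hmem⟩, ?_, ?_⟩
    · simp only [maxIdeal, sCoord_mk, tCoord_mk]
    · rintro ⟨y, hy⟩ h
      apply Subtype.ext
      have hs : s = c.sCoord y := by
        have h1 : Polynomial.C (Polynomial.X - Polynomial.C (c.sCoord y)) ∈ c.maxIdeal y := by
          simp [maxIdeal, RingHom.mem_ker, evalAt]
        have h2 : Polynomial.C (Polynomial.X - Polynomial.C (c.sCoord y)) ∈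
          RingHom.ker (evalAt s τ) := by rw [h]; exact h1
        simpa [RingHom.mem_ker, evalAt, sub_eq_zero] using h2
      have ht : τ = c.tCoord y := by
        have h1 : Polynomial.X - Polynomial.C (Polynomial.C (c.tCoord y)) ∈ c.maxIdeal y := by
          simp [maxIdeal, RingHom.mem_ker, evalAt]
        have h2 : Polynomial.X - Polynomial.C (Polynomial.C (c.tCoord y)) ∈
          RingHom.ker (evalAt s τ) := by rw [h]; exact h1
        simpa [RingHom.mem_ker, evalAt, sub_eq_zero] using h2
      subst hs ht
      exact (c.mk_vec_coord (hl y hy)).symm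

end Chart
end CurveBezout

/-! ### The cokernel of a characteristic matrix. -/

namespace CurveBezout
open Polynomial (aeval)

section CharMatrix

variable {A : Type*} [CommRing A] {m : ℕ} (T : Matrix (Fin m) (Fin m) A)

/-- Evaluation of vectors of polynomials at the matrix `T`: `Σ_r f_r e_r ↦ Σ_r f_r(T) e_r`. -/
noncomputable def evalVec : (Fin m → Polynomial A) →ₗ[A] (Fin m → A) :=
  ∑ r : Fin m, ((Matrix.mulVecBilin A A).flip (Pi.single r (1 : A))) ∘ₗ
    (aeval T : Polynomial A →ₐ[A] _).toLinearMap ∘ₗ LinearMap.proj r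

lemma evalVec_apply (f : Fin m → Polynomial A) :
    evalVec T f = ∑ r, aeval T (f r) *ᵥ Pi.single r (1 : A) := by
  simp [evalVec]

lemma evalVec_smul (h : Polynomial A) (f : Fin m → Polynomial A) :
    evalVec T (h • f) = aeval T h *ᵥ evalVec T f := by
  simp only [evalVec_apply, Pi.smul_apply, smul_eq_mul, map_mul, Matrix.mulVec_sum,
    Matrix.mulVec_mulVec]

lemma evalVec_C (w : Fin m → A) : evalVec T (fun r => Polynomial.C (w r)) = w := by
  simp only [evalVec_apply, Polynomial.aeval_C]
  ext i
  simp [Finset.sum_apply, Algebra.algebraMap_eq_smul_one, Matrix.one_apply]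

lemma charmatrix_mulVec_C (w : Fin m → A) :
    T.charmatrix *ᵥ (fun r => Polynomial.C (w r)) =
      (Polynomial.X : Polynomial A) • (fun r => Polynomial.C (w r)) -
        fun r => Polynomial.C ((T *ᵥ w) r) := by
  rw [Matrix.charmatrix, Matrix.sub_mulVec]
  congr 1
  · ext1 i
    simp [Matrix.scalar_apply, Matrix.mulVec_diagonal]
  · ext1 i
    rw [RingHom.map_mulVec]
    rfl

/-- `evalVec` is linear over polynomials when `X` acts on `A^m` by `T`, so `X - T` goes to zero. -/
lemma evalVec_charmatrix_mulVec (f : Fin m → Polynomial A) :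
    evalVec T (T.charmatrix *ᵥ f) = 0 := by
  have hf : f = ∑ r, f r • (fun k => Polynomial.C ((Pi.single r 1 : Fin m → A) k)) := by
    ext1 i
    simp [Finset.sum_apply, Pi.single_apply]
  rw [hf, Matrix.mulVec_sum, map_sum]
  refine Finset.sum_eq_zero fun r _ => ?_
  rw [Matrix.mulVec_smul, evalVec_smul, charmatrix_mulVec_C, map_sub, evalVec_smul, evalVec_C,
    evalVec_C, Polynomial.aeval_X, sub_self, Matrix.mulVec_zero]

/-- Division with remainder by `X - T`: the claim is additive, clear for constants, and stable under
multiplication by `X` because `X c` and `T c` are congruent for constant `c`. -/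
lemma sub_C_evalVec_mem_range_charmatrix (f : Fin m → Polynomial A) :
    f - (fun r => Polynomial.C (evalVec T f r)) ∈ LinearMap.range T.charmatrix.mulVecLin := by
  have hadd : ∀ f g : Fin m → Polynomial A,
      f - (fun r => Polynomial.C (evalVec T f r)) ∈ LinearMap.range T.charmatrix.mulVecLin →
      g - (fun r => Polynomial.C (evalVec T g r)) ∈ LinearMap.range T.charmatrix.mulVecLin →
      (f + g) - (fun r => Polynomial.C (evalVec T (f + g) r)) ∈
        LinearMap.range T.charmatrix.mulVecLin := by
    intro f g hf hg
    convert Submodule.add_mem _ hf hg using 1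
    ext1 i
    simp only [map_add, Pi.sub_apply, Pi.add_apply]
    ring
  have hX : ∀ f : Fin m → Polynomial A,
      f - (fun r => Polynomial.C (evalVec T f r)) ∈ LinearMap.range T.charmatrix.mulVecLin →
      (Polynomial.X : Polynomial A) • f -
        (fun r => Polynomial.C (evalVec T ((Polynomial.X : Polynomial A) • f) r)) ∈
        LinearMap.range T.charmatrix.mulVecLin := by
    intro f hf
    have h1 := Submodule.smul_mem _ (Polynomial.X : Polynomial A) hf
    have h2 : T.charmatrix *ᵥ (fun r => Polynomial.C (evalVec T f r)) ∈
      LinearMap.range T.charmatrix.mulVecLin := ⟨_, rfl⟩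
    convert Submodule.add_mem _ h1 h2 using 1
    rw [charmatrix_mulVec_C, evalVec_smul, Polynomial.aeval_X, smul_sub]
    abel
  have hpow : ∀ (k : ℕ) (w : Fin m → A),
      (Polynomial.X : Polynomial A) ^ k • (fun r => Polynomial.C (w r)) -
        (fun r => Polynomial.C (evalVec T ((Polynomial.X : Polynomial A) ^ k •
          (fun r => Polynomial.C (w r))) r)) ∈ LinearMap.range T.charmatrix.mulVecLin := by
    intro k w
    induction k with
    | zero => simp [evalVec_C]
    | succ k ih =>
      rw [pow_succ', mul_smul]
      exact hX _ ih
  have hzero : (0 : Fin m → Polynomial A) - (fun r => Polynomial.C (evalVec T 0 r)) ∈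
      LinearMap.range T.charmatrix.mulVecLin := by
    convert Submodule.zero_mem _
    simp
    rfl
  have hsingle : ∀ (i : Fin m) (g : Polynomial A), (Pi.single i g : Fin m → Polynomial A) -
      (fun r => Polynomial.C (evalVec T (Pi.single i g) r)) ∈
        LinearMap.range T.charmatrix.mulVecLin := by
    intro i g
    induction g using Polynomial.induction_on' with
    | add p q hp hq => rw [Pi.single_add]; exact hadd _ _ hp hq
    | monomial k a =>
      have : (Pi.single i (Polynomial.monomial k a) : Fin m → Polynomial A) =
          (Polynomial.X : Polynomial A) ^ k •
            (fun r => Polynomial.C ((Pi.single i a : Fin m → A) r)) := by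
        ext1 r
        by_cases h : r = i
        · subst h
          rw [Pi.single_eq_same, Pi.smul_apply, Pi.single_eq_same, smul_eq_mul,
            Polynomial.X_pow_mul_C, Polynomial.C_mul_X_pow_eq_monomial]
        · simp [Pi.single_eq_of_ne h]
      rw [this]
      exact hpow k _
  rw [← Finset.univ_sum_single f]
  induction (Finset.univ : Finset (Fin m)) using Finset.induction_on with
  | empty => simpa using hzero
  | insert i s his ih =>
    rw [Finset.sum_insert his]
    exact hadd _ _ (hsingle i _) ih

/-- The right factor `U` is invertible and does not affect the image. Modulo `X - T` every vector is
constant, and there `p` and `q` act as `p(T)` and `q(T)`. -/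
lemma evalVec_mem_iff {L : Matrix (Fin m) (Fin m) (Polynomial A)}
    {U : Matrix (Fin m) (Fin m) (Polynomial A)} (hU : IsUnit U) (hL : L = T.charmatrix * U)
    (p q : Polynomial A) (f : Fin m → Polynomial A) :
    evalVec T f ∈ LinearMap.range (aeval T p).mulVecLin ⊔ LinearMap.range (aeval T q).mulVecLin ↔
      f ∈ LinearMap.range (presMap L p q) := by
  have hr : ∀ g, g ∈ LinearMap.range T.charmatrix.mulVecLin → ∃ y, L *ᵥ y = g := by
    rintro _ ⟨y, rfl⟩
    obtain ⟨U, rfl⟩ := hU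
    refine ⟨(↑U⁻¹ : Matrix (Fin m) (Fin m) (Polynomial A)) *ᵥ y, ?_⟩
    rw [hL, Matrix.mulVec_mulVec, mul_assoc, Units.mul_inv, mul_one]
    rfl
  constructor
  · intro h
    obtain ⟨_, ⟨a, rfl⟩, _, ⟨b, rfl⟩, hab⟩ := Submodule.mem_sup.mp h
    simp only [Matrix.mulVecLin_apply] at hab
    obtain ⟨y, hy⟩ := hr _ (sub_C_evalVec_mem_range_charmatrix T
      (f - (p • (fun r => Polynomial.C (a r)) + q • (fun r => Polynomial.C (b r)))))
    refine ⟨(y, fun r => Polynomial.C (a r), fun r => Polynomial.C (b r)), ?_⟩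
    have h0 : evalVec T
        (f - (p • (fun r => Polynomial.C (a r)) + q • (fun r => Polynomial.C (b r)))) = 0 := by
      rw [map_sub, map_add, evalVec_smul, evalVec_smul, evalVec_C, evalVec_C, hab, sub_self]
    rw [presMap_apply, hy, h0]
    ext1 i
    simp
  · rintro ⟨y, rfl⟩
    rw [presMap_apply, hL, ← Matrix.mulVec_mulVec, map_add, evalVec_charmatrix_mulVec, zero_add,
      map_add, evalVec_smul, evalVec_smul]
    exact Submodule.add_mem_sup ⟨_, rfl⟩ ⟨_, rfl⟩

/-- The cokernel of `L = (X - T) U` modulo `p` and `q` is `A^m / (p(T), q(T))`. -/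
lemma nonempty_coker_presMap_equiv [Algebra ℂ A] {L : Matrix (Fin m) (Fin m) (Polynomial A)}
    {U : Matrix (Fin m) (Fin m) (Polynomial A)} (hU : IsUnit U) (hL : L = T.charmatrix * U)
    (p q : Polynomial A) :
    Nonempty (((Fin m → Polynomial A) ⧸ LinearMap.range (presMap L p q)) ≃ₗ[ℂ]
      ((Fin m → A) ⧸ (LinearMap.range (aeval T p).mulVecLin ⊔
        LinearMap.range (aeval T q).mulVecLin))) := by
  set K := LinearMap.range (aeval T p).mulVecLin ⊔ LinearMap.range (aeval T q).mulVecLin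
  let φ : (Fin m → Polynomial A) →ₗ[ℂ] ((Fin m → A) ⧸ K) :=
    (K.mkQ ∘ₗ evalVec T).restrictScalars ℂ
  have hφ : Function.Surjective φ := by
    intro y
    obtain ⟨w, rfl⟩ := K.mkQ_surjective y
    exact ⟨fun r => Polynomial.C (w r), by simp [φ, evalVec_C]⟩
  have hker : LinearMap.ker φ = (LinearMap.range (presMap L p q)).restrictScalars ℂ := by
    ext f
    rw [LinearMap.mem_ker, Submodule.restrictScalars_mem, ← evalVec_mem_iff T hU hL]
    exact Submodule.Quotient.mk_eq_zero K
  let e1 := Submodule.quotEquivOfEq _ _ hker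
  exact ⟨((Submodule.Quotient.restrictScalarsEquiv ℂ
    (LinearMap.range (presMap L p q))).symm.trans e1.symm).trans
      (φ.quotKerEquivOfSurjective hφ)⟩

end CharMatrix
end CurveBezout

/-! ### Matrix polynomials, divided differences and the kernel of the Bezoutian. -/

namespace CurveBezout
open Polynomial (aeval)

section MatrixPolynomial

variable {m : ℕ}

/-- The coefficient of `X ^ k` of a matrix of polynomials. -/
def coeffMat {R : Type*} [Semiring R] (k : ℕ) (M : Matrix (Fin m) (Fin m) (Polynomial R)) :
    Matrix (Fin m) (Fin m) R :=
  M.map fun f => f.coeff k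

/-- The matrices `Γ_b = Σ_a X^a M_{a+b+1}`, with generating function `(M(X) - M(t)) / (X - t)`. -/
noncomputable def divDiff (b : ℕ) (M : Matrix (Fin m) (Fin m) (Polynomial ℂ)) :
    Matrix (Fin m) (Fin m) (Polynomial ℂ) :=
  M.map fun f => Polynomial.divX^[b + 1] f

lemma coeff_divX_iterate (k : ℕ) (f : Polynomial ℂ) (i : ℕ) :
    (Polynomial.divX^[k] f).coeff i = f.coeff (i + k) := by
  induction k generalizing f with
  | zero => rfl
  | succ k ih => rw [Function.iterate_succ_apply, ih, Polynomial.coeff_divX]; congr 1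

lemma coeff_divDiff (b a : ℕ) (M : Matrix (Fin m) (Fin m) (Polynomial ℂ)) (i r : Fin m) :
    (divDiff b M i r).coeff a = (M i r).coeff (a + b + 1) := by
  rw [divDiff, Matrix.map_apply, coeff_divX_iterate, add_assoc]

/-- Together with `X_smul_divDiff_succ`, these are the coefficients of the powers of `t` in `(X - t)
Γ(X, t) = M(X) - M(t)`. -/
lemma X_smul_divDiff_zero (M : Matrix (Fin m) (Fin m) (Polynomial ℂ)) :
    (Polynomial.X : Polynomial ℂ) • divDiff 0 M = M - (coeffMat 0 M).map Polynomial.C := by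
  ext i r a
  cases a with
  | zero => simp [coeffMat]
  | succ a => simp [coeffMat, coeff_divDiff]

lemma X_smul_divDiff_succ (b : ℕ) (M : Matrix (Fin m) (Fin m) (Polynomial ℂ)) :
    (Polynomial.X : Polynomial ℂ) • divDiff (b + 1) M =
      divDiff b M - (coeffMat (b + 1) M).map Polynomial.C := by
  ext i r a
  cases a with
  | zero => simp [coeffMat, coeff_divDiff]
  | succ a =>
    simp only [coeffMat, Matrix.smul_apply, smul_eq_mul, Polynomial.coeff_X_mul, coeff_divDiff,
      Matrix.sub_apply, Matrix.map_apply, Polynomial.coeff_sub, Polynomial.coeff_C,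
      Nat.succ_ne_zero, if_false, sub_zero]
    congr 1; ring

/-- A constant vector of polynomials. -/
noncomputable def constVec : (Fin m → ℂ) →ₗ[ℂ] (Fin m → Polynomial ℂ) :=
  (Algebra.linearMap ℂ (Polynomial ℂ)).compLeft (Fin m)

lemma constVec_apply (w : Fin m → ℂ) (r : Fin m) : constVec w r = Polynomial.C (w r) := rfl

/-- The map `(z_b) ↦ Σ_b G_b z_b` defined by a sequence of matrix polynomials. -/
noncomputable def seqMap (n : ℕ) (G : ℕ → Matrix (Fin m) (Fin m) (Polynomial ℂ)) :
    (Fin n → Fin m → ℂ) →ₗ[ℂ] (Fin m → Polynomial ℂ) :=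
  ∑ b : Fin n, ((G b).mulVecLin.restrictScalars ℂ) ∘ₗ constVec ∘ₗ LinearMap.proj b

lemma seqMap_apply (n : ℕ) (G : ℕ → Matrix (Fin m) (Fin m) (Polynomial ℂ))
    (z : Fin n → Fin m → ℂ) : seqMap n G z = ∑ b : Fin n, G b *ᵥ constVec (z b) := by
  simp [seqMap]

variable {n : ℕ} {P Q : Matrix (Fin m) (Fin m) (Polynomial ℂ)}

/-- If `d` is the largest degree in `y ≠ 0`, the coefficient of degree `n + d` in `P y` is the
leading matrix of `P` applied to a nonzero vector. This gives uniqueness in division by `P`. -/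
lemma eq_zero_of_mulVec_coeff_eq_zero (hP : ∀ i r, (P i r).natDegree ≤ n)
    (hlead : IsUnit (coeffMat n P)) (y : Fin m → Polynomial ℂ)
    (hy : ∀ i a, n ≤ a → ((P *ᵥ y) i).coeff a = 0) : y = 0 := by
  by_contra hne
  obtain ⟨d, hd1, i0, hd2⟩ : ∃ d, (∀ r, (y r).natDegree ≤ d) ∧ ∃ i, (y i).coeff d ≠ 0 := by
    obtain ⟨i1, hi1⟩ := Function.ne_iff.mp hne
    obtain ⟨i0, h0, hmax⟩ := Finset.exists_max_image
      (Finset.univ.filter fun i => y i ≠ 0) (fun i => (y i).natDegree) ⟨i1, by simpa using hi1⟩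
    refine ⟨(y i0).natDegree, fun r => ?_, i0, ?_⟩
    · by_cases hr : y r = 0
      · simp [hr]
      · exact hmax r (by simpa using hr)
    · simpa using (Finset.mem_filter.mp h0).2
  have h1 : coeffMat n P *ᵥ (fun r => (y r).coeff d) = 0 := by
    ext i
    have := hy i (n + d) (Nat.le_add_right _ _)
    rw [Matrix.mulVec, dotProduct, Polynomial.finsetSum_coeff] at this
    rw [Matrix.mulVec, dotProduct, Pi.zero_apply, ← this]
    refine Finset.sum_congr rfl fun r _ => ?_
    rw [Polynomial.coeff_mul_add_eq_of_natDegree_le (hP i r) (hd1 r)]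
    rfl
  have h2 := (Matrix.mulVec_injective_iff_isUnit.mpr hlead) (h1.trans (Matrix.mulVec_zero _).symm)
  exact hd2 (congrFun h2 i0)

lemma coeff_seqMap_divDiff (z : Fin n → Fin m → ℂ) (i : Fin m) (a : ℕ) :
    (seqMap n (fun b => divDiff b P) z i).coeff a =
      ∑ b : Fin n, (coeffMat (a + b + 1) P *ᵥ z b) i := by
  rw [seqMap_apply, Finset.sum_apply, Polynomial.finsetSum_coeff]
  refine Finset.sum_congr rfl fun b _ => ?_
  rw [Matrix.mulVec, dotProduct, Polynomial.finsetSum_coeff]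
  refine Finset.sum_congr rfl fun r _ => ?_
  rw [constVec_apply, Polynomial.coeff_mul_C, coeff_divDiff]
  rfl

lemma coeffMat_eq_zero (hP : ∀ i r, (P i r).natDegree ≤ n) {a : ℕ} (ha : n < a) :
    coeffMat a P = 0 := by
  ext i r
  exact Polynomial.coeff_eq_zero_of_natDegree_lt ((hP i r).trans_lt ha)

lemma seqMap_divDiff_injective (hP : ∀ i r, (P i r).natDegree ≤ n)
    (hlead : IsUnit (coeffMat n P)) : Function.Injective (seqMap n fun b => divDiff b P) := by
  rw [injective_iff_map_eq_zero]
  intro z hz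
  have key : ∀ k (hk : k < n), z ⟨k, hk⟩ = 0 := by
    intro k
    induction k using Nat.strong_induction_on with
    | _ k ih =>
      intro hk
      have h1 : coeffMat n P *ᵥ z ⟨k, hk⟩ = 0 := by
        ext i
        -- The system is triangular: in degree `n - 1 - k` the terms with `b > k` involve
        -- coefficients of `P` beyond degree `n`, and those with `b < k` vanish by induction.
        have h2 := coeff_seqMap_divDiff (P := P) z i (n - 1 - k)
        rw [hz, Finset.sum_eq_single ⟨k, hk⟩] at h2
        · have h3 : n - 1 - k + k + 1 = n := by omega
          simp only [h3] at h2
          rw [← h2]; simp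
        · intro b _ hb
          rcases lt_or_gt_of_ne (fun h => hb (Fin.ext h) : (b : ℕ) ≠ k) with h | h
          · have : z b = 0 := ih b h b.2
            simp [this]
          · rw [coeffMat_eq_zero hP (by omega)]
            simp
        · simp
      exact (Matrix.mulVec_injective_iff_isUnit.mpr hlead) (h1.trans (Matrix.mulVec_zero _).symm)
  exact funext fun b => key b b.2

/-- The divided differences of `P` represent the quotient by `P` bijectively. -/
lemma mkQ_seqMap_divDiff_bijective (hP : ∀ i r, (P i r).natDegree ≤ n)
    (hlead : IsUnit (coeffMat n P)) :
    Function.Bijective ((LinearMap.range P.mulVecLin).mkQ.restrictScalars ℂ ∘ₗ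
      seqMap n fun b => divDiff b P) := by
  constructor
  · rw [injective_iff_map_eq_zero]
    intro z hz
    have h1 : seqMap n (fun b => divDiff b P) z ∈ LinearMap.range P.mulVecLin :=
      (Submodule.Quotient.mk_eq_zero _).mp hz
    obtain ⟨y, hy⟩ := h1
    -- Divided differences of `P` have degree below `n`, which no nonzero multiple of `P` has.
    have h2 : y = 0 := by
      refine eq_zero_of_mulVec_coeff_eq_zero hP hlead y fun i a ha => ?_
      rw [Matrix.mulVecLin_apply] at hy
      rw [hy, coeff_seqMap_divDiff]
      refine Finset.sum_eq_zero fun b _ => ?_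
      rw [coeffMat_eq_zero hP (by omega), Matrix.zero_mulVec, Pi.zero_apply]
    rw [h2, map_zero] at hy
    exact seqMap_divDiff_injective hP hlead (hy.symm.trans (map_zero _).symm)
  · set φ := (LinearMap.range P.mulVecLin).mkQ.restrictScalars ℂ ∘ₗ seqMap n fun b => divDiff b P
    have hsingle : ∀ (b : ℕ) (hb : b < n) (w : Fin m → ℂ),
        (LinearMap.range P.mulVecLin).mkQ (divDiff b P *ᵥ constVec w) ∈ LinearMap.range φ := by
      intro b hb w
      refine ⟨Pi.single ⟨b, hb⟩ w, ?_⟩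
      simp only [φ, LinearMap.comp_apply, seqMap_apply, LinearMap.restrictScalars_apply]
      rw [Finset.sum_eq_single ⟨b, hb⟩]
      · simp
      · intro b' _ hb'
        simp [Pi.single_eq_of_ne hb']
      · simp
    -- The last divided difference is the constant leading matrix, which is invertible, so all
    -- constants are reached. For `n = 0` the matrix `P` is itself this constant and the quotient is
    -- zero.
    have hconst : ∀ w : Fin m → ℂ,
        (LinearMap.range P.mulVecLin).mkQ (constVec w) ∈ LinearMap.range φ := by
      intro w
      obtain ⟨w', rfl⟩ := (Matrix.mulVec_surjective_iff_isUnit.mpr hlead) w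
      have hC : ∀ k, (constVec (coeffMat k P *ᵥ w') : Fin m → Polynomial ℂ) =
          (coeffMat k P).map Polynomial.C *ᵥ constVec w' := by
        intro k
        ext1 i
        rw [constVec_apply, RingHom.map_mulVec]
        rfl
      rw [hC]
      rcases Nat.eq_zero_or_pos n with rfl | hn
      · have h1 : P = (coeffMat 0 P).map Polynomial.C := by
          ext1 i r
          exact Polynomial.eq_C_of_natDegree_le_zero (hP i r)
        have h2 : (LinearMap.range P.mulVecLin).mkQ
            ((coeffMat 0 P).map Polynomial.C *ᵥ constVec w') = 0 := by
          rw [← h1]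
          exact (Submodule.Quotient.mk_eq_zero _).mpr ⟨_, rfl⟩
        rw [h2]
        exact Submodule.zero_mem _
      · have h1 : (coeffMat n P).map Polynomial.C = divDiff (n - 1) P := by
          ext i r a
          rw [coeff_divDiff, Matrix.map_apply, Polynomial.coeff_C]
          split_ifs with h
          · rw [h, coeffMat, Matrix.map_apply]; congr 1; omega
          · exact (Polynomial.coeff_eq_zero_of_natDegree_lt
              ((hP i r).trans_lt (by omega))).symm
        rw [h1]
        exact hsingle _ (by omega) _
    have hCP : ∀ (k : ℕ) (w : Fin m → ℂ), (LinearMap.range P.mulVecLin).mkQ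
        ((coeffMat k P).map Polynomial.C *ᵥ constVec w) ∈ LinearMap.range φ := by
      intro k w
      convert hconst (coeffMat k P *ᵥ w) using 2
      ext1 i
      rw [constVec_apply, RingHom.map_mulVec]
      rfl
    -- The recursion for divided differences shows stability under `X`, as `P` itself dies in the
    -- quotient. Constants and multiplication by `X` then give everything.
    have hX : ∀ y ∈ LinearMap.range φ, (Polynomial.X : Polynomial ℂ) • y ∈ LinearMap.range φ := by
      rintro _ ⟨z, rfl⟩
      simp only [φ, LinearMap.comp_apply, seqMap_apply, LinearMap.restrictScalars_apply, map_sum,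
        Finset.smul_sum]
      refine Submodule.sum_mem _ fun b _ => ?_
      rw [← map_smul, ← Matrix.smul_mulVec]
      obtain ⟨b, hb⟩ := b
      cases b with
      | zero =>
        simp only
        rw [X_smul_divDiff_zero, Matrix.sub_mulVec, map_sub]
        refine Submodule.sub_mem _ ?_ (hCP _ _)
        convert Submodule.zero_mem _
        exact (Submodule.Quotient.mk_eq_zero _).mpr ⟨_, rfl⟩
      | succ b =>
        simp only
        rw [X_smul_divDiff_succ, Matrix.sub_mulVec, map_sub]
        exact Submodule.sub_mem _ (hsingle _ (by omega) _) (hCP _ _)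
    have hpow : ∀ (k : ℕ) (w : Fin m → ℂ), (Polynomial.X : Polynomial ℂ) ^ k •
        (LinearMap.range P.mulVecLin).mkQ (constVec w) ∈ LinearMap.range φ := by
      intro k w
      induction k with
      | zero => simpa using hconst w
      | succ k ih => rw [pow_succ', mul_smul]; exact hX _ ih
    intro y
    obtain ⟨f, rfl⟩ := Submodule.mkQ_surjective _ y
    change (LinearMap.range P.mulVecLin).mkQ f ∈ LinearMap.range φ
    rw [← Finset.univ_sum_single f, map_sum]
    refine Submodule.sum_mem _ fun i _ => ?_
    generalize f i = g
    induction g using Polynomial.induction_on' with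
    | add p q hp hq => rw [Pi.single_add, map_add]; exact Submodule.add_mem _ hp hq
    | monomial k a =>
      convert hpow k (Pi.single i a) using 1
      rw [← map_smul]
      congr 1
      ext1 r
      by_cases h : r = i
      · subst h
        rw [Pi.single_eq_same, Pi.smul_apply, constVec_apply, Pi.single_eq_same, smul_eq_mul,
          Polynomial.X_pow_mul_C, Polynomial.C_mul_X_pow_eq_monomial]
      · simp [Pi.single_eq_of_ne h, constVec_apply]

/-- The coefficient matrices of the Bezoutian of two matrix polynomials. -/
noncomputable def bezoutian (P Q : Matrix (Fin m) (Fin m) (Polynomial ℂ)) (b : ℕ) :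
    Matrix (Fin m) (Fin m) (Polynomial ℂ) :=
  Q * divDiff b P - P * divDiff b Q

lemma natDegree_mul_map_C_le (hP : ∀ i r, (P i r).natDegree ≤ n)
    (M : Matrix (Fin m) (Fin m) ℂ) (i r : Fin m) :
    ((P * M.map Polynomial.C : Matrix (Fin m) (Fin m) (Polynomial ℂ)) i r).natDegree ≤ n := by
  rw [Matrix.mul_apply]
  refine Polynomial.natDegree_sum_le_of_forall_le _ _ fun k _ => ?_
  rw [Matrix.map_apply]
  exact (Polynomial.natDegree_mul_C_le _ _).trans (hP i k)

/-- By commutation `X` times the first coefficient is `P Q₀ - Q P₀`, of degree at most `n`; dividing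
by `X` lowers the degree by one. The same relation, with the preceding coefficient added, carries
the bound to the next one. -/
lemma coeff_bezoutian_eq_zero (hPQ : P * Q = Q * P) (hP : ∀ i r, (P i r).natDegree ≤ n)
    (hQ : ∀ i r, (Q i r).natDegree ≤ n) (b : ℕ) (i r : Fin m) (a : ℕ) (ha : n ≤ a) :
    (bezoutian P Q b i r).coeff a = 0 := by
  induction b generalizing a with
  | zero =>
    have h : (Polynomial.X : Polynomial ℂ) • bezoutian P Q 0 =
        P * (coeffMat 0 Q).map Polynomial.C - Q * (coeffMat 0 P).map Polynomial.C := by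
      rw [bezoutian, smul_sub, ← Matrix.mul_smul, ← Matrix.mul_smul, X_smul_divDiff_zero,
        X_smul_divDiff_zero, mul_sub, mul_sub, hPQ]
      abel
    have h1 := congrArg (fun M : Matrix (Fin m) (Fin m) (Polynomial ℂ) => (M i r).coeff (a + 1)) h
    simp only [Matrix.smul_apply, smul_eq_mul, Polynomial.coeff_X_mul, Matrix.sub_apply,
      Polynomial.coeff_sub] at h1
    rw [h1, Polynomial.coeff_eq_zero_of_natDegree_lt
        ((natDegree_mul_map_C_le hP _ i r).trans_lt (by omega)),
      Polynomial.coeff_eq_zero_of_natDegree_lt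
        ((natDegree_mul_map_C_le hQ _ i r).trans_lt (by omega)), sub_zero]
  | succ b ih =>
    have h : (Polynomial.X : Polynomial ℂ) • bezoutian P Q (b + 1) = bezoutian P Q b +
        (P * (coeffMat (b + 1) Q).map Polynomial.C -
          Q * (coeffMat (b + 1) P).map Polynomial.C) := by
      rw [bezoutian, smul_sub, ← Matrix.mul_smul, ← Matrix.mul_smul, X_smul_divDiff_succ,
        X_smul_divDiff_succ, mul_sub, mul_sub, bezoutian]
      abel
    have h1 := congrArg (fun M : Matrix (Fin m) (Fin m) (Polynomial ℂ) => (M i r).coeff (a + 1)) h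
    simp only [Matrix.smul_apply, smul_eq_mul, Polynomial.coeff_X_mul, Matrix.sub_apply,
      Matrix.add_apply, Polynomial.coeff_add, Polynomial.coeff_sub] at h1
    rw [h1, ih (a + 1) (by omega), Polynomial.coeff_eq_zero_of_natDegree_lt
        ((natDegree_mul_map_C_le hP _ i r).trans_lt (by omega)),
      Polynomial.coeff_eq_zero_of_natDegree_lt
        ((natDegree_mul_map_C_le hQ _ i r).trans_lt (by omega)), sub_zero, zero_add]

lemma seqMap_bezoutian (z : Fin n → Fin m → ℂ) : seqMap n (bezoutian P Q) z =
    Q *ᵥ seqMap n (fun b => divDiff b P) z - P *ᵥ seqMap n (fun b => divDiff b Q) z := by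
  simp only [seqMap_apply, bezoutian, Matrix.sub_mulVec, Finset.sum_sub_distrib,
    Matrix.mulVec_sum, Matrix.mulVec_mulVec]

/-- The value of the Bezoutian is `Q f - P g`, with `f, g` the combinations of divided differences
of `P` and `Q`. If `Q f` is a multiple of `P`, so is this value; its degree is below `n`, so it
vanishes. -/
lemma seqMap_bezoutian_eq_zero_iff (hPQ : P * Q = Q * P) (hP : ∀ i r, (P i r).natDegree ≤ n)
    (hQ : ∀ i r, (Q i r).natDegree ≤ n) (hlead : IsUnit (coeffMat n P))
    (z : Fin n → Fin m → ℂ) : seqMap n (bezoutian P Q) z = 0 ↔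
      Q *ᵥ seqMap n (fun b => divDiff b P) z ∈ LinearMap.range P.mulVecLin := by
  constructor
  · intro h
    rw [seqMap_bezoutian, sub_eq_zero] at h
    exact ⟨_, h.symm⟩
  · rintro ⟨y, hy⟩
    rw [Matrix.mulVecLin_apply] at hy
    have h1 : seqMap n (bezoutian P Q) z =
        P *ᵥ (y - seqMap n (fun b => divDiff b Q) z) := by
      rw [seqMap_bezoutian, ← hy, Matrix.mulVec_sub]
    have h2 : y - seqMap n (fun b => divDiff b Q) z = 0 := by
      refine eq_zero_of_mulVec_coeff_eq_zero hP hlead _ fun i a ha => ?_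
      rw [← h1, seqMap_apply, Finset.sum_apply, Polynomial.finsetSum_coeff]
      refine Finset.sum_eq_zero fun b _ => ?_
      rw [Matrix.mulVec, dotProduct, Polynomial.finsetSum_coeff]
      refine Finset.sum_eq_zero fun r _ => ?_
      rw [constVec_apply, Polynomial.coeff_mul_C, coeff_bezoutian_eq_zero hPQ hP hQ b i r a ha,
        zero_mul]
    rw [h1, h2, Matrix.mulVec_zero]

/-- The kernel of the Bezoutian of commuting matrix polynomials `P`, `Q`, with `P` of invertible
leading coefficient, has the dimension of the common cokernel of `P` and `Q`. -/
theorem finrank_ker_bezoutian (hPQ : P * Q = Q * P) (hP : ∀ i r, (P i r).natDegree ≤ n)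
    (hQ : ∀ i r, (Q i r).natDegree ≤ n) (hlead : IsUnit (coeffMat n P)) :
    Module.Finite ℂ ((Fin m → Polynomial ℂ) ⧸
      (LinearMap.range P.mulVecLin ⊔ LinearMap.range Q.mulVecLin)) ∧
    Module.finrank ℂ (LinearMap.ker (seqMap n (bezoutian P Q))) =
      Module.finrank ℂ ((Fin m → Polynomial ℂ) ⧸
        (LinearMap.range P.mulVecLin ⊔ LinearMap.range Q.mulVecLin)) := by
  let φ := LinearEquiv.ofBijective _ (mkQ_seqMap_divDiff_bijective hP hlead)
  have hfin : Module.Finite ℂ ((Fin m → Polynomial ℂ) ⧸ LinearMap.range P.mulVecLin) :=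
    Module.Finite.equiv φ
  have hle : LinearMap.range P.mulVecLin ≤ (LinearMap.range P.mulVecLin).comap Q.mulVecLin := by
    rintro _ ⟨y, rfl⟩
    refine ⟨Q *ᵥ y, ?_⟩
    simp [Matrix.mulVec_mulVec, hPQ]
  let Qb := (LinearMap.range P.mulVecLin).mapQ (LinearMap.range P.mulVecLin) Q.mulVecLin hle
  let Qc := Qb.restrictScalars ℂ
  have hrange : LinearMap.range Qb =
      (LinearMap.range Q.mulVecLin).map (LinearMap.range P.mulVecLin).mkQ := by
    ext y
    constructor
    · rintro ⟨z, rfl⟩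
      obtain ⟨f, rfl⟩ := Submodule.mkQ_surjective _ z
      exact ⟨Q *ᵥ f, ⟨f, rfl⟩, rfl⟩
    · rintro ⟨_, ⟨f, rfl⟩, rfl⟩
      exact ⟨Submodule.mkQ _ f, rfl⟩
  have e0 : (((Fin m → Polynomial ℂ) ⧸ LinearMap.range P.mulVecLin) ⧸ LinearMap.range Qc) ≃ₗ[ℂ]
      ((Fin m → Polynomial ℂ) ⧸ (LinearMap.range P.mulVecLin ⊔ LinearMap.range Q.mulVecLin)) :=
    (Submodule.quotEquivOfEq _ ((LinearMap.range Qb).restrictScalars ℂ) rfl).trans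
      ((Submodule.Quotient.restrictScalarsEquiv ℂ (LinearMap.range Qb)).trans
        (((Submodule.quotEquivOfEq _ _ hrange).trans
          (Submodule.quotientQuotientEquivQuotientSup _ _)).restrictScalars ℂ))
  refine ⟨Module.Finite.equiv e0, ?_⟩
  rw [← e0.finrank_eq]
  -- Multiplication by `Q` is an endomorphism of the finite-dimensional quotient by `P`, so its
  -- kernel and cokernel have equal dimension.
  have h1 := LinearMap.finrank_range_add_finrank_ker Qc
  have h2 := Submodule.finrank_quotient_add_finrank (LinearMap.range Qc)
  have h3 : (LinearMap.ker (seqMap n (bezoutian P Q))).map φ.toLinearMap = LinearMap.ker Qc := by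
    ext y
    rw [Submodule.mem_map]
    constructor
    · rintro ⟨z, hz, rfl⟩
      rw [LinearMap.mem_ker, seqMap_bezoutian_eq_zero_iff hPQ hP hQ hlead] at hz
      exact (Submodule.Quotient.mk_eq_zero _).mpr hz
    · intro hy
      obtain ⟨z, rfl⟩ := φ.surjective y
      refine ⟨z, ?_, rfl⟩
      rw [LinearMap.mem_ker, seqMap_bezoutian_eq_zero_iff hPQ hP hQ hlead]
      exact (Submodule.Quotient.mk_eq_zero _).mp hy
  have h4 : Module.finrank ℂ (LinearMap.ker (seqMap n (bezoutian P Q))) =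
      Module.finrank ℂ (LinearMap.ker Qc) := by
    rw [← h3]
    exact (LinearEquiv.finrank_map_eq φ _).symm
  omega

end MatrixPolynomial
end CurveBezout

/-! ### Substitution of matrices for the coordinates. -/

namespace CurveBezout
open Polynomial (aeval)
open scoped TensorProduct

section Tensor

/-- An element of `S ⊗ S` that vanishes at all pairs of points is zero. -/
lemma tensor_eq_zero_of_eval (z : S ⊗[ℂ] S)
    (h : ∀ x y : Fin 3 → ℂ, Algebra.TensorProduct.productMap (MvPolynomial.aeval x : S →ₐ[ℂ] ℂ)
      (MvPolynomial.aeval y : S →ₐ[ℂ] ℂ) z = 0) : z = 0 := by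
  obtain ⟨κ, s, f, g, rfl⟩ : ∃ (κ : Type) (s : Finset κ) (f g : κ → S),
      z = ∑ a ∈ s, f a ⊗ₜ[ℂ] g a := by
    obtain ⟨s, hs⟩ := TensorProduct.exists_finset z
    exact ⟨S × S, s, Prod.fst, Prod.snd, hs⟩
  -- The variables are separated: for fixed `y` this is an identity of polynomials in `x`, and each
  -- of its coefficients is then a polynomial in `y` vanishing everywhere.
  have h1 : ∀ y : Fin 3 → ℂ, ∑ a ∈ s, MvPolynomial.eval y (g a) • f a = 0 := by
    intro y
    apply MvPolynomial.funext
    intro x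
    have := h x y
    simp only [map_sum, Algebra.TensorProduct.productMap_apply_tmul] at this
    rw [map_sum, map_zero, ← this]
    refine Finset.sum_congr rfl fun a _ => ?_
    rw [MvPolynomial.smul_eval, mul_comm]
    rfl
  have h2 : ∀ μ : Fin 3 →₀ ℕ, ∑ a ∈ s, (f a).coeff μ • g a = 0 := by
    intro μ
    apply MvPolynomial.funext
    intro y
    have := congrArg (MvPolynomial.coeff μ) (h1 y)
    rw [MvPolynomial.coeff_sum, MvPolynomial.coeff_zero] at this
    rw [map_sum, map_zero, ← this]
    refine Finset.sum_congr rfl fun a _ => ?_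
    rw [MvPolynomial.smul_eval, MvPolynomial.coeff_smul, smul_eq_mul, mul_comm]
  classical
  let F := s.biUnion fun a => (f a).support
  have h3 : ∀ a ∈ s, f a = ∑ μ ∈ F, (f a).coeff μ • MvPolynomial.monomial μ (1 : ℂ) := by
    intro a ha
    conv_lhs => rw [(f a).as_sum]
    refine (Finset.sum_subset (Finset.subset_biUnion_of_mem (fun a => (f a).support) ha) ?_).trans
      (Finset.sum_congr rfl fun μ _ => ?_)
    · intro μ _ hμ
      rw [MvPolynomial.notMem_support_iff.mp hμ, map_zero]
    · rw [MvPolynomial.smul_monomial, smul_eq_mul, mul_one]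
  rw [Finset.sum_congr rfl fun a ha => by rw [h3 a ha]]
  simp only [TensorProduct.sum_tmul, TensorProduct.smul_tmul]
  rw [Finset.sum_comm]
  refine Finset.sum_eq_zero fun μ _ => ?_
  rw [← TensorProduct.tmul_sum, h2, TensorProduct.tmul_zero]

end Tensor

section MatEval

variable {m : ℕ} {R : Type*} [CommRing R] [Algebra ℂ R]

/-- Substitution of the commuting matrices `xᵢ = vᵢ T + aᵢ`. -/
noncomputable def matEval (v : Fin 3 → ℂ) (a : Fin 3 → R) (T : Matrix (Fin m) (Fin m) R) :
    S →ₐ[ℂ] Matrix (Fin m) (Fin m) R :=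
  ((aeval T : Polynomial R →ₐ[R] Matrix (Fin m) (Fin m) R).restrictScalars ℂ).comp (lineEval v a)

lemma matEval_X (v : Fin 3 → ℂ) (a : Fin 3 → R) (T : Matrix (Fin m) (Fin m) R) (i : Fin 3) :
    matEval v a T (MvPolynomial.X i) =
      algebraMap ℂ R (v i) • T + a i • (1 : Matrix (Fin m) (Fin m) R) := by
  simp [matEval, lineEval, Algebra.algebraMap_eq_smul_one]

lemma matEval_map {R' : Type*} [CommRing R'] [Algebra ℂ R'] (φ : R →ₐ[ℂ] R') (v : Fin 3 → ℂ)
    (a : Fin 3 → R) (T : Matrix (Fin m) (Fin m) R) (f : S) :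
    (matEval v a T f).map φ = matEval v (fun i => φ (a i)) (T.map φ) f := by
  have : φ.mapMatrix.comp (matEval v a T) = matEval v (fun i => φ (a i)) (T.map φ) := by
    apply MvPolynomial.algHom_ext
    intro i
    rw [AlgHom.comp_apply, matEval_X, matEval_X]
    ext r k
    simp [Matrix.one_apply, apply_ite φ]
  exact DFunLike.congr_fun this f

lemma matEval_mul_comm (v : Fin 3 → ℂ) (a : Fin 3 → R) (T : Matrix (Fin m) (Fin m) R) (f g : S) :
    matEval v a T f * matEval v a T g = matEval v a T g * matEval v a T f := by
  rw [← map_mul, mul_comm, map_mul]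

lemma mul_matEval_of_intertwine (v : Fin 3 → ℂ) (a : Fin 3 → R)
    {T T' N : Matrix (Fin m) (Fin m) R} (h : N * T' = T * N) (f : S) :
    N * matEval v a T' f = matEval v a T f * N := by
  induction f using MvPolynomial.induction_on with
  | C z =>
    rw [← MvPolynomial.algebraMap_eq, AlgHom.commutes, AlgHom.commutes, Algebra.commutes]
  | add p q hp hq => rw [map_add, map_add, mul_add, hp, hq, add_mul]
  | mul_X p i hp =>
    rw [map_mul, map_mul, ← mul_assoc, hp, mul_assoc, mul_assoc]
    congr 1
    rw [matEval_X, matEval_X, mul_add, add_mul, Matrix.mul_smul, Matrix.smul_mul, h,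
      Matrix.mul_smul, Matrix.smul_mul, mul_one, one_mul]

/-- The matrix `a₀ D₀ + a₁ D₁ - a₂ D₂` over a `ℂ`-algebra. -/
def pencilOver (D : Fin 3 → Matrix (Fin m) (Fin m) ℂ) (a : Fin 3 → R) :
    Matrix (Fin m) (Fin m) R :=
  a 0 • (D 0).map (algebraMap ℂ R) + a 1 • (D 1).map (algebraMap ℂ R) -
    a 2 • (D 2).map (algebraMap ℂ R)

/-- The monomial `x₀^i₀ x₁^i₁ x₂^i₂` as a polynomial. -/
noncomputable def monomPoly (i : Fin 3 → ℕ) : S :=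
  MvPolynomial.X 0 ^ i 0 * MvPolynomial.X 1 ^ i 1 * MvPolynomial.X 2 ^ i 2

lemma aeval_monomPoly (y : Fin 3 → ℂ) (i : Fin 3 → ℕ) :
    MvPolynomial.aeval y (monomPoly i) = monom y i := by
  simp [monomPoly, monom]

/-- The determinant of the matrix with columns `v, u, e`. -/
def tripleProduct (v u e : Fin 3 → ℂ) : ℂ :=
  v 0 * (u 1 * e 2 - u 2 * e 1) - v 1 * (u 0 * e 2 - u 2 * e 0) + v 2 * (u 0 * e 1 - u 1 * e 0)

variable (D : Fin 3 → Matrix (Fin m) (Fin m) ℂ) (v u e : Fin 3 → ℂ) {s t : R}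
  {T T' : Matrix (Fin m) (Fin m) R}

/-- The terms `v_k v_l T N T'`, with `N = L(v)`, cancel by antisymmetry. In the rest `T N` and `N
T'` are values of the pencil at the two base points, so everything is linear in the `D i`, and only
multiples of `s - t` survive. -/
lemma matEval_cross
    (hT : T * pencilOver D (fun i => algebraMap ℂ R (v i)) =
      -pencilOver D (fun i => algebraMap ℂ R (u i) * s + algebraMap ℂ R (e i)))
    (hT' : pencilOver D (fun i => algebraMap ℂ R (v i)) * T' =
      -pencilOver D (fun i => algebraMap ℂ R (u i) * t + algebraMap ℂ R (e i))) (k l : Fin 3) :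
    matEval v (fun i => algebraMap ℂ R (u i) * s + algebraMap ℂ R (e i)) T (MvPolynomial.X k) *
        pencilOver D (fun i => algebraMap ℂ R (v i)) *
        matEval v (fun i => algebraMap ℂ R (u i) * t + algebraMap ℂ R (e i)) T'
          (MvPolynomial.X l) -
      matEval v (fun i => algebraMap ℂ R (u i) * s + algebraMap ℂ R (e i)) T (MvPolynomial.X l) *
        pencilOver D (fun i => algebraMap ℂ R (v i)) *
        matEval v (fun i => algebraMap ℂ R (u i) * t + algebraMap ℂ R (e i)) T'
          (MvPolynomial.X k) =
      (s - t) • (algebraMap ℂ R (v k * u l - v l * u k) •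
          pencilOver D (fun i => algebraMap ℂ R (e i)) -
        algebraMap ℂ R (v k * e l - v l * e k) • pencilOver D (fun i => algebraMap ℂ R (u i)) +
        algebraMap ℂ R (u k * e l - u l * e k) •
          pencilOver D (fun i => algebraMap ℂ R (v i))) := by
  simp only [matEval_X, add_mul, mul_add, Matrix.smul_mul, Matrix.mul_smul, hT, hT',
    one_mul, mul_one]
  ext a b
  simp only [pencilOver, Matrix.add_apply, Matrix.sub_apply, Matrix.smul_apply, Matrix.neg_apply,
    smul_eq_mul, map_sub, map_mul]
  ring
end MatEval
end CurveBezout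

/-! ### The Bezout decomposition evaluated at matrices, and leading coefficients. -/

namespace CurveBezout
open Polynomial (aeval)
open scoped TensorProduct

section Cross

variable {m : ℕ} {R : Type*} [CommRing R] [Algebra ℂ R]
variable (D : Fin 3 → Matrix (Fin m) (Fin m) ℂ) (v u e : Fin 3 → ℂ) {s t : R}
  {T T' : Matrix (Fin m) (Fin m) R}

/-- Laplace expansion of `det(v, u, e)`: the combination of `v, u, e` with these minors as
coefficients is a multiple of a coordinate vector. The order `1, 0` for `i = 2` absorbs the minus
sign of `D 2` in the pencil. -/
lemma cross_pencilOver (i k l : Fin 3)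
    (hikl : (i = 0 ∧ k = 1 ∧ l = 2) ∨ (i = 1 ∧ k = 2 ∧ l = 0) ∨
      (i = 2 ∧ k = 1 ∧ l = 0)) :
    algebraMap ℂ R (v k * u l - v l * u k) • pencilOver D (fun i => algebraMap ℂ R (e i)) -
        algebraMap ℂ R (v k * e l - v l * e k) • pencilOver D (fun i => algebraMap ℂ R (u i)) +
        algebraMap ℂ R (u k * e l - u l * e k) • pencilOver D (fun i => algebraMap ℂ R (v i)) =
      algebraMap ℂ R (tripleProduct v u e) • (D i).map (algebraMap ℂ R) := by
  rcases hikl with ⟨rfl, rfl, rfl, -⟩ | ⟨rfl, rfl, rfl, -⟩ | ⟨rfl, rfl, rfl, -⟩ <;>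
  · ext a b
    simp only [pencilOver, tripleProduct, Matrix.add_apply, Matrix.sub_apply, Matrix.smul_apply,
      Matrix.map_apply, smul_eq_mul, ← map_mul, ← map_add, ← map_sub]
    congr 1
    ring

variable {n : ℕ}

/-- The matrix `Σ b_{ij} X^i D' Y^j` of the Bezoutian. -/
noncomputable def bezoutSum (β10 β20 β12 : Matrix (Idx n) (Idx n) ℂ)
    (M N : (Fin 3 → ℕ) → Matrix (Fin m) (Fin m) R) : Matrix (Fin m) (Fin m) R :=
  ∑ i : Idx n, ∑ j : Idx n,
    M i.1 * (β12 i j • D 0 + β20 i j • D 1 + β10 i j • D 2).map (algebraMap ℂ R) * N j.1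

/-- The identity between values at vectors is lifted to `S ⊗ S`, so that the two factors can be
replaced by matrices that do not commute with each other. -/
lemma IsBezoutDecomposition.tensor {p q : S} {β10 β20 β12 : Matrix (Idx n) (Idx n) ℂ}
    (hβ : IsBezoutDecomposition n p q β10 β20 β12) :
    p ⊗ₜ[ℂ] q - q ⊗ₜ[ℂ] p = ∑ i : Idx n, ∑ j : Idx n,
      (β10 i j • ((monomPoly i.1 * MvPolynomial.X 1) ⊗ₜ[ℂ] (MvPolynomial.X 0 * monomPoly j.1) -
          (monomPoly i.1 * MvPolynomial.X 0) ⊗ₜ[ℂ] (MvPolynomial.X 1 * monomPoly j.1)) +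
        β20 i j • ((monomPoly i.1 * MvPolynomial.X 2) ⊗ₜ[ℂ] (MvPolynomial.X 0 * monomPoly j.1) -
          (monomPoly i.1 * MvPolynomial.X 0) ⊗ₜ[ℂ] (MvPolynomial.X 2 * monomPoly j.1)) +
        β12 i j • ((monomPoly i.1 * MvPolynomial.X 1) ⊗ₜ[ℂ] (MvPolynomial.X 2 * monomPoly j.1) -
          (monomPoly i.1 * MvPolynomial.X 2) ⊗ₜ[ℂ] (MvPolynomial.X 1 * monomPoly j.1))) := by
  rw [← sub_eq_zero]
  apply tensor_eq_zero_of_eval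
  intro x y
  have h := hβ.decomp x y
  simp only [map_sub, map_sum, map_add, map_smul, Algebra.TensorProduct.productMap_apply_tmul,
    map_mul, aeval_monomPoly, MvPolynomial.aeval_X, smul_eq_mul]
  change MvPolynomial.eval x p * MvPolynomial.eval y q -
    MvPolynomial.eval x q * MvPolynomial.eval y p - _ = 0
  rw [h, sub_eq_zero]
  refine Finset.sum_congr rfl fun i _ => Finset.sum_congr rfl fun j _ => ?_
  ring

/-- The Bezout decomposition evaluated at matrices on two lines through `v`. -/
theorem smul_bezoutSum_matEval {p q : S} {β10 β20 β12 : Matrix (Idx n) (Idx n) ℂ}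
    (hβ : IsBezoutDecomposition n p q β10 β20 β12)
    (hT : T * pencilOver D (fun i => algebraMap ℂ R (v i)) =
      -pencilOver D (fun i => algebraMap ℂ R (u i) * s + algebraMap ℂ R (e i)))
    (hT' : pencilOver D (fun i => algebraMap ℂ R (v i)) * T' =
      -pencilOver D (fun i => algebraMap ℂ R (u i) * t + algebraMap ℂ R (e i))) :
    (s - t) • algebraMap ℂ R (tripleProduct v u e) • bezoutSum D β10 β20 β12
      (fun i => matEval v (fun i => algebraMap ℂ R (u i) * s + algebraMap ℂ R (e i)) T
        (monomPoly i))
      (fun i => matEval v (fun i => algebraMap ℂ R (u i) * t + algebraMap ℂ R (e i)) T'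
        (monomPoly i)) =
    matEval v (fun i => algebraMap ℂ R (u i) * s + algebraMap ℂ R (e i)) T p *
        pencilOver D (fun i => algebraMap ℂ R (v i)) *
        matEval v (fun i => algebraMap ℂ R (u i) * t + algebraMap ℂ R (e i)) T' q -
      matEval v (fun i => algebraMap ℂ R (u i) * s + algebraMap ℂ R (e i)) T q *
        pencilOver D (fun i => algebraMap ℂ R (v i)) *
        matEval v (fun i => algebraMap ℂ R (u i) * t + algebraMap ℂ R (e i)) T' p := by
  have hc := matEval_cross D v u e hT hT'
  set X := matEval v (fun i => algebraMap ℂ R (u i) * s + algebraMap ℂ R (e i)) T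
  set Y := matEval v (fun i => algebraMap ℂ R (u i) * t + algebraMap ℂ R (e i)) T'
  set N := pencilOver D (fun i => algebraMap ℂ R (v i)) with hN
  have h0 := (hc 1 2).trans (congrArg ((s - t) • ·)
    (cross_pencilOver D v u e 0 1 2 (by simp)))
  have h1 := (hc 2 0).trans (congrArg ((s - t) • ·)
    (cross_pencilOver D v u e 1 2 0 (by simp)))
  have h2 := (hc 1 0).trans (congrArg ((s - t) • ·)
    (cross_pencilOver D v u e 2 1 0 (by simp)))
  -- The `x`-factor is evaluated to the left of `N = L(v)` and the `y`-factor to its right, which is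
  -- the shape in which the cross terms simplify.
  let Λ : S ⊗[ℂ] S →ₗ[ℂ] Matrix (Fin m) (Fin m) R :=
    TensorProduct.lift (((LinearMap.mul ℂ _).compl₁₂
      ((LinearMap.mulRight ℂ N).comp X.toLinearMap) Y.toLinearMap))
  have hΛ : ∀ f g : S, Λ (f ⊗ₜ g) = X f * N * Y g := fun f g => rfl
  have key := congrArg Λ hβ.tensor
  rw [map_sub, hΛ, hΛ] at key
  rw [key]
  simp only [bezoutSum, map_sum, Finset.smul_sum, map_add, map_smul, map_sub, hΛ, map_mul]
  refine Finset.sum_congr rfl fun i _ => Finset.sum_congr rfl fun j _ => ?_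
  have e1 : ∀ k l : Fin 3, X (monomPoly i.1) * X (MvPolynomial.X k) * N *
      (Y (MvPolynomial.X l) * Y (monomPoly j.1)) -
      X (monomPoly i.1) * X (MvPolynomial.X l) * N *
      (Y (MvPolynomial.X k) * Y (monomPoly j.1)) = X (monomPoly i.1) *
        (X (MvPolynomial.X k) * N * Y (MvPolynomial.X l) -
          X (MvPolynomial.X l) * N * Y (MvPolynomial.X k)) * Y (monomPoly j.1) := by
    intro k l
    noncomm_ring
  rw [e1 1 0, e1 2 0, e1 1 2, h0, h1, h2]
  have e3 : ∀ (z : ℂ) (M : Matrix (Fin m) (Fin m) R), z • M = algebraMap ℂ R z • M :=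
    fun z M => (algebraMap_smul R z M).symm
  have e4 : (β12 i j • D 0 + β20 i j • D 1 + β10 i j • D 2).map (algebraMap ℂ R) =
      algebraMap ℂ R (β12 i j) • (D 0).map (algebraMap ℂ R) +
      algebraMap ℂ R (β20 i j) • (D 1).map (algebraMap ℂ R) +
      algebraMap ℂ R (β10 i j) • (D 2).map (algebraMap ℂ R) := by
    ext a b
    simp only [Matrix.map_apply, Matrix.add_apply, Matrix.smul_apply, smul_eq_mul, map_add, map_mul]
  rw [e4]
  simp only [e3, mul_add, add_mul, Matrix.mul_smul, Matrix.smul_mul, smul_add, smul_smul]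
  module

end Cross

section Degree

variable {m : ℕ}

/-- `M` is a matrix polynomial of degree at most `d`, with `N` as coefficient of degree `d`. -/
def HasLead (d : ℕ) (M : Matrix (Fin m) (Fin m) (Polynomial ℂ)) (N : Matrix (Fin m) (Fin m) ℂ) :
    Prop :=
  (∀ i r, (M i r).natDegree ≤ d) ∧ coeffMat d M = N

lemma HasLead.mul {d d' : ℕ} {M M' : Matrix (Fin m) (Fin m) (Polynomial ℂ)}
    {N N' : Matrix (Fin m) (Fin m) ℂ} (h : HasLead d M N) (h' : HasLead d' M' N') :
    HasLead (d + d') (M * M') (N * N') := by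
  constructor
  · intro i r
    rw [Matrix.mul_apply]
    exact Polynomial.natDegree_sum_le_of_forall_le _ _ fun k _ =>
      Polynomial.natDegree_mul_le.trans (add_le_add (h.1 i k) (h'.1 k r))
  · ext i r
    rw [coeffMat, Matrix.map_apply, Matrix.mul_apply, Polynomial.finsetSum_coeff, Matrix.mul_apply]
    refine Finset.sum_congr rfl fun k _ => ?_
    rw [Polynomial.coeff_mul_add_eq_of_natDegree_le (h.1 i k) (h'.1 k r), ← h.2, ← h'.2]
    rfl

lemma HasLead.add {d : ℕ} {M M' : Matrix (Fin m) (Fin m) (Polynomial ℂ)}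
    {N N' : Matrix (Fin m) (Fin m) ℂ} (h : HasLead d M N) (h' : HasLead d M' N') :
    HasLead d (M + M') (N + N') := by
  constructor
  · intro i r
    exact Polynomial.natDegree_add_le_of_degree_le (h.1 i r) (h'.1 i r)
  · ext i r
    rw [← h.2, ← h'.2]
    simp [coeffMat]

lemma HasLead.zero (d : ℕ) : HasLead d (0 : Matrix (Fin m) (Fin m) (Polynomial ℂ)) 0 :=
  ⟨by simp, by ext; simp [coeffMat]⟩

lemma HasLead.smul {d : ℕ} {M : Matrix (Fin m) (Fin m) (Polynomial ℂ)}
    {N : Matrix (Fin m) (Fin m) ℂ} (h : HasLead d M N) (a : ℂ) : HasLead d (a • M) (a • N) := by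
  constructor
  · intro i r
    exact (Polynomial.natDegree_smul_le a _).trans (h.1 i r)
  · ext i r
    rw [← h.2]
    simp [coeffMat]

lemma HasLead.one : HasLead 0 (1 : Matrix (Fin m) (Fin m) (Polynomial ℂ)) 1 := by
  constructor
  · intro i r
    rw [Matrix.one_apply]
    split_ifs <;> simp
  · ext i r
    rw [coeffMat, Matrix.map_apply, Matrix.one_apply, Matrix.one_apply]
    split_ifs <;> simp

/-- `HasLead` allows a zero top coefficient, so it is multiplicative without exception; homogeneity
makes all monomials contribute in the same degree. -/
lemma hasLead_of_isHomogeneous {ev : S →ₐ[ℂ] Matrix (Fin m) (Fin m) (Polynomial ℂ)}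
    {ev1 : S →ₐ[ℂ] Matrix (Fin m) (Fin m) ℂ}
    (hX : ∀ i, HasLead 1 (ev (MvPolynomial.X i)) (ev1 (MvPolynomial.X i)))
    {f : S} {d : ℕ} (hf : f.IsHomogeneous d) : HasLead d (ev f) (ev1 f) := by
  have hmon : ∀ s : Fin 3 →₀ ℕ, HasLead s.degree (ev (MvPolynomial.monomial s 1))
      (ev1 (MvPolynomial.monomial s 1)) := by
    intro s
    induction s using Finsupp.induction_linear with
    | zero => simpa using HasLead.one
    | add s s' h h' =>
      rw [show MvPolynomial.monomial (s + s') (1 : ℂ) = MvPolynomial.monomial s 1 *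
        MvPolynomial.monomial s' 1 by simp [MvPolynomial.monomial_mul], map_mul, map_mul, map_add]
      exact h.mul h'
    | single i k =>
      rw [← MvPolynomial.X_pow_eq_monomial, Finsupp.degree_single]
      induction k with
      | zero => simpa using HasLead.one
      | succ k ih => rw [pow_succ, map_mul, map_mul]; exact ih.mul (hX i)
  rw [f.as_sum]
  simp only [map_sum]
  have hsum : ∀ F : Finset (Fin 3 →₀ ℕ), (∀ s ∈ F, s.degree = d) →
      HasLead d (∑ s ∈ F, ev (MvPolynomial.monomial s (f.coeff s)))
        (∑ s ∈ F, ev1 (MvPolynomial.monomial s (f.coeff s))) := by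
    classical
    intro F
    induction F using Finset.induction_on with
    | empty => intro _; simpa using HasLead.zero d
    | insert s F hs ih =>
      intro hF
      rw [Finset.sum_insert hs, Finset.sum_insert hs]
      refine HasLead.add ?_ (ih fun s' hs' => hF s' (Finset.mem_insert_of_mem hs'))
      have h1 := (hmon s).smul (f.coeff s)
      rw [← map_smul ev, ← map_smul ev1, MvPolynomial.smul_monomial, smul_eq_mul, mul_one,
        hF s (Finset.mem_insert_self _ _)] at h1
      exact h1
  refine hsum _ fun s hs => ?_
  by_contra hne
  exact MvPolynomial.mem_support_iff.mp hs (hf.coeff_eq_zero hne)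

end Degree
end CurveBezout

/-! ### The blown up Bezout matrix as a Bezoutian of matrix polynomials. -/

namespace CurveBezout
open Polynomial (aeval)

section Bivariate

variable {m : ℕ}

lemma pencilOver_map {R R' : Type*} [CommRing R] [Algebra ℂ R] [CommRing R'] [Algebra ℂ R']
    (D : Fin 3 → Matrix (Fin m) (Fin m) ℂ) (φ : R →ₐ[ℂ] R') (a : Fin 3 → R) :
    (pencilOver D a).map φ = pencilOver D (fun i => φ (a i)) := by
  ext r k
  simp [pencilOver]

lemma pencilOver_algebraMap {R : Type*} [CommRing R] [Algebra ℂ R]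
    (D : Fin 3 → Matrix (Fin m) (Fin m) ℂ) (a : Fin 3 → ℂ) :
    pencilOver D (fun i => algebraMap ℂ R (a i)) = (pencilAt D a).map (algebraMap ℂ R) := by
  ext r k
  simp only [pencilOver, pencilAt, Matrix.add_apply, Matrix.sub_apply, Matrix.smul_apply,
    Matrix.map_apply, smul_eq_mul, map_add, map_sub, map_mul]

/-- The inclusion `ℂ[s] → ℂ[s, t]`. -/
noncomputable def inclLeft : Polynomial ℂ →ₐ[ℂ] Polynomial (Polynomial ℂ) :=
  IsScalarTower.toAlgHom ℂ (Polynomial ℂ) (Polynomial (Polynomial ℂ))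

/-- The inclusion `ℂ[t] → ℂ[s, t]`. -/
noncomputable def inclRight : Polynomial ℂ →ₐ[ℂ] Polynomial (Polynomial ℂ) :=
  Polynomial.mapAlgHom (Algebra.ofId ℂ (Polynomial ℂ))

lemma inclLeft_apply (f : Polynomial ℂ) : inclLeft f = Polynomial.C f := rfl

lemma coeff_inclRight (b : ℕ) (f : Polynomial ℂ) :
    (inclRight f).coeff b = Polynomial.C (f.coeff b) := by
  rw [inclRight, Polynomial.coe_mapAlgHom, Polynomial.coeff_map]
  rfl

lemma inclRight_X : inclRight Polynomial.X = Polynomial.X := by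
  rw [inclRight, Polynomial.coe_mapAlgHom, Polynomial.map_X]

lemma coeffMat_map_mul_map (b : ℕ) (M N : Matrix (Fin m) (Fin m) (Polynomial ℂ)) :
    coeffMat b (M.map inclLeft * N.map inclRight) = M * (coeffMat b N).map Polynomial.C := by
  ext1 i r
  rw [coeffMat, Matrix.map_apply, Matrix.mul_apply, Polynomial.finsetSum_coeff, Matrix.mul_apply]
  refine Finset.sum_congr rfl fun k _ => ?_
  rw [Matrix.map_apply, inclLeft_apply, Polynomial.coeff_C_mul, Matrix.map_apply, coeff_inclRight]
  rfl

lemma coeffMat_add {R : Type*} [Semiring R] (b : ℕ)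
    (M N : Matrix (Fin m) (Fin m) (Polynomial R)) :
    coeffMat b (M + N) = coeffMat b M + coeffMat b N := by
  ext1 i r; simp [coeffMat]

lemma coeffMat_sub {R : Type*} [Ring R] (b : ℕ)
    (M N : Matrix (Fin m) (Fin m) (Polynomial R)) :
    coeffMat b (M - N) = coeffMat b M - coeffMat b N := by
  ext1 i r; simp [coeffMat]

lemma coeffMat_sum {R : Type*} [Semiring R] {κ : Type*} (s : Finset κ) (b : ℕ)
    (M : κ → Matrix (Fin m) (Fin m) (Polynomial R)) :
    coeffMat b (∑ a ∈ s, M a) = ∑ a ∈ s, coeffMat b (M a) := by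
  ext1 i r
  simp [coeffMat, Matrix.sum_apply, Polynomial.finsetSum_coeff]

lemma coeffMat_sub_X_smul (b : ℕ)
    (M : Matrix (Fin m) (Fin m) (Polynomial (Polynomial ℂ))) :
    coeffMat (b + 1) ((Polynomial.C Polynomial.X - Polynomial.X : Polynomial (Polynomial ℂ)) • M) =
      (Polynomial.X : Polynomial ℂ) • coeffMat (b + 1) M - coeffMat b M := by
  ext1 i r
  simp [coeffMat, sub_mul]

lemma X_smul_bezoutian_succ (P Q : Matrix (Fin m) (Fin m) (Polynomial ℂ)) (b : ℕ) :
    (Polynomial.X : Polynomial ℂ) • bezoutian P Q (b + 1) - bezoutian P Q b =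
      P * (coeffMat (b + 1) Q).map Polynomial.C - Q * (coeffMat (b + 1) P).map Polynomial.C := by
  rw [bezoutian, smul_sub, ← Matrix.mul_smul, ← Matrix.mul_smul, X_smul_divDiff_succ,
    X_smul_divDiff_succ, mul_sub, mul_sub, bezoutian]
  abel

lemma divDiff_eq_zero {n : ℕ} {P : Matrix (Fin m) (Fin m) (Polynomial ℂ)}
    (hP : ∀ i r, (P i r).natDegree ≤ n) {b : ℕ} (hb : n ≤ b) : divDiff b P = 0 := by
  ext i r a
  rw [coeff_divDiff]
  exact Polynomial.coeff_eq_zero_of_natDegree_lt ((hP i r).trans_lt (by omega))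

end Bivariate

namespace Chart

variable (c : Chart) {m n : ℕ} (D : Fin 3 → Matrix (Fin m) (Fin m) ℂ)

/-- The action of the coordinate `τ` on the cokernel, as a free `ℂ[s]`-module. -/
noncomputable def actX : Matrix (Fin m) (Fin m) (Polynomial ℂ) :=
  -(pencilOver D c.base * (pencilAt D c.v)⁻¹.map Polynomial.C)

/-- The adjoint action of the coordinate `τ`. -/
noncomputable def actY : Matrix (Fin m) (Fin m) (Polynomial ℂ) :=
  -((pencilAt D c.v)⁻¹.map Polynomial.C * pencilOver D c.base)

/-- The action of `S` on the cokernel, restricted to the chart, as a free `ℂ[s]`-module. -/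
noncomputable def evX : S →ₐ[ℂ] Matrix (Fin m) (Fin m) (Polynomial ℂ) :=
  matEval c.v c.base (c.actX D)

/-- The adjoint action of `S`. -/
noncomputable def evY : S →ₐ[ℂ] Matrix (Fin m) (Fin m) (Polynomial ℂ) :=
  matEval c.v c.base (c.actY D)

variable {D} (hv : IsUnit (pencilAt D c.v))

include hv in
lemma actX_mul : c.actX D * (pencilAt D c.v).map Polynomial.C = -pencilOver D c.base := by
  rw [actX, neg_mul, mul_assoc, ← Matrix.map_mul,
    Matrix.nonsing_inv_mul _ ((Matrix.isUnit_iff_isUnit_det _).mp hv)]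
  simp

include hv in
lemma mul_actY : (pencilAt D c.v).map Polynomial.C * c.actY D = -pencilOver D c.base := by
  rw [actY, mul_neg, ← mul_assoc, ← Matrix.map_mul,
    Matrix.mul_nonsing_inv _ ((Matrix.isUnit_iff_isUnit_det _).mp hv)]
  simp

-- `L(v)` intertwines the two actions of `τ`, hence those of all polynomials.
include hv in
lemma mul_evY (f : S) : (pencilAt D c.v).map Polynomial.C * c.evY D f =
    c.evX D f * (pencilAt D c.v).map Polynomial.C :=
  mul_matEval_of_intertwine _ _ ((c.mul_actY hv).trans (c.actX_mul hv).symm) f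

variable (D) in
/-- The coefficient of `t ^ b` in the blown up Bezout matrix on the two lines. -/
noncomputable def bezoutCoeff (β10 β20 β12 : Matrix (Idx n) (Idx n) ℂ) (b : ℕ) :
    Matrix (Fin m) (Fin m) (Polynomial ℂ) :=
  ∑ i : Idx n, ∑ j : Idx n, c.evX D (monomPoly i.1) *
    (β12 i j • D 0 + β20 i j • D 1 + β10 i j • D 2).map Polynomial.C *
      (coeffMat b (c.evY D (monomPoly j.1))).map Polynomial.C

-- This is the coefficient of `t ^ (b + 1)` in `smul_bezoutSum_matEval`, with `T` over ℂ[s] and `T'`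
-- over ℂ[t]. Moving `L(v)` to the right of the `t`-factor leaves only the action used for `P` and
-- `Q`, so the recursion is that of `X_smul_bezoutian_succ`.
include hv in
lemma X_smul_bezoutCoeff {p q : S} {β10 β20 β12 : Matrix (Idx n) (Idx n) ℂ}
    (hβ : IsBezoutDecomposition n p q β10 β20 β12) (b : ℕ) :
    tripleProduct c.v c.u c.e • ((Polynomial.X : Polynomial ℂ) •
        c.bezoutCoeff D β10 β20 β12 (b + 1) - c.bezoutCoeff D β10 β20 β12 b) =
      (c.evX D p * (coeffMat (b + 1) (c.evX D q)).map Polynomial.C -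
        c.evX D q * (coeffMat (b + 1) (c.evX D p)).map Polynomial.C) *
          (pencilAt D c.v).map Polynomial.C := by
  have hl : ∀ f : S, (c.evX D f).map inclLeft = matEval c.v (fun i =>
      algebraMap ℂ (Polynomial (Polynomial ℂ)) (c.u i) * Polynomial.C Polynomial.X +
        algebraMap ℂ (Polynomial (Polynomial ℂ)) (c.e i)) ((c.actX D).map inclLeft) f := by
    intro f
    rw [evX, matEval_map]
    congr 2
    funext i
    simp only [base, map_add, map_mul, inclLeft_apply]
    rfl
  have hr : ∀ f : S, (c.evY D f).map inclRight = matEval c.v (fun i =>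
      algebraMap ℂ (Polynomial (Polynomial ℂ)) (c.u i) * Polynomial.X +
        algebraMap ℂ (Polynomial (Polynomial ℂ)) (c.e i)) ((c.actY D).map inclRight) f := by
    intro f
    rw [evY, matEval_map]
    congr 2
    funext i
    simp only [base, map_add, map_mul, inclRight_X]
    simp only [inclRight, Polynomial.coe_mapAlgHom, Polynomial.map_C]
    rfl
  have hCl : ∀ M : Matrix (Fin m) (Fin m) ℂ, (M.map Polynomial.C).map inclLeft =
      M.map (algebraMap ℂ (Polynomial (Polynomial ℂ))) := fun M => by
    ext1 i r; rfl
  have hCr : ∀ M : Matrix (Fin m) (Fin m) ℂ, (M.map Polynomial.C).map inclRight =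
      M.map (algebraMap ℂ (Polynomial (Polynomial ℂ))) := fun M => by
    ext1 i r
    simp only [Matrix.map_apply, inclRight, Polynomial.coe_mapAlgHom, Polynomial.map_C]
    rfl
  have hmul : ∀ (φ : Polynomial ℂ →ₐ[ℂ] Polynomial (Polynomial ℂ))
      (M N : Matrix (Fin m) (Fin m) (Polynomial ℂ)), (M * N).map φ = M.map φ * N.map φ :=
    fun φ M N => φ.mapMatrix.map_mul M N
  have hneg : ∀ (φ : Polynomial ℂ →ₐ[ℂ] Polynomial (Polynomial ℂ))
      (M : Matrix (Fin m) (Fin m) (Polynomial ℂ)), (-M).map φ = -M.map φ :=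
    fun φ M => map_neg φ.mapMatrix M
  have hT : (c.actX D).map inclLeft * pencilOver D
      (fun i => algebraMap ℂ (Polynomial (Polynomial ℂ)) (c.v i)) =
      -pencilOver D (fun i => algebraMap ℂ (Polynomial (Polynomial ℂ)) (c.u i) *
        Polynomial.C Polynomial.X + algebraMap ℂ (Polynomial (Polynomial ℂ)) (c.e i)) := by
    rw [pencilOver_algebraMap, ← hCl, ← hmul, c.actX_mul hv, hneg, pencilOver_map]
    congr 2
    funext i
    simp only [base, map_add, map_mul, inclLeft_apply]
    rfl
  have hT' : pencilOver D (fun i => algebraMap ℂ (Polynomial (Polynomial ℂ)) (c.v i)) *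
      (c.actY D).map inclRight =
      -pencilOver D (fun i => algebraMap ℂ (Polynomial (Polynomial ℂ)) (c.u i) *
        Polynomial.X + algebraMap ℂ (Polynomial (Polynomial ℂ)) (c.e i)) := by
    rw [pencilOver_algebraMap, ← hCr, ← hmul, c.mul_actY hv, hneg, pencilOver_map]
    congr 2
    funext i
    simp only [base, map_add, map_mul, inclRight_X]
    simp only [inclRight, Polynomial.coe_mapAlgHom, Polynomial.map_C]
    rfl
  have key := smul_bezoutSum_matEval D c.v c.u c.e hβ hT hT'
  simp only [← hl, ← hr] at key
  have hmid : ∀ f g : S, (c.evX D f).map inclLeft * pencilOver D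
      (fun i => algebraMap ℂ (Polynomial (Polynomial ℂ)) (c.v i)) * (c.evY D g).map inclRight =
      (c.evX D f).map inclLeft *
        (c.evX D g * (pencilAt D c.v).map Polynomial.C).map inclRight := by
    intro f g
    rw [pencilOver_algebraMap, mul_assoc, ← hCr, ← hmul, c.mul_evY hv]
  rw [hmid, hmid] at key
  have key2 := congrArg (coeffMat (b + 1)) key
  have hconst : ∀ (k : ℕ) (M : Matrix (Fin m) (Fin m) (Polynomial ℂ))
      (N : Matrix (Fin m) (Fin m) ℂ),
      (coeffMat k (M * N.map Polynomial.C)).map (Polynomial.C : ℂ → Polynomial ℂ) =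
        (coeffMat k M).map Polynomial.C * N.map Polynomial.C := by
    intro k M N
    rw [← Matrix.map_mul]
    congr 1
    ext1 i r
    simp [coeffMat, Matrix.mul_apply, Polynomial.finsetSum_coeff, Polynomial.coeff_mul_C]
  rw [coeffMat_sub_X_smul, coeffMat_sub, coeffMat_map_mul_map, coeffMat_map_mul_map,
    hconst, hconst] at key2
  have hG : ∀ k, coeffMat k (algebraMap ℂ (Polynomial (Polynomial ℂ))
      (tripleProduct c.v c.u c.e) • bezoutSum D β10 β20 β12
        (fun i => (c.evX D (monomPoly i)).map inclLeft)
        (fun i => (c.evY D (monomPoly i)).map inclRight)) =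
      tripleProduct c.v c.u c.e • c.bezoutCoeff D β10 β20 β12 k := by
    intro k
    have h1 : coeffMat k (bezoutSum D β10 β20 β12
        (fun i => (c.evX D (monomPoly i)).map inclLeft)
        (fun i => (c.evY D (monomPoly i)).map inclRight)) = c.bezoutCoeff D β10 β20 β12 k := by
      rw [bezoutSum, bezoutCoeff, coeffMat_sum]
      refine Finset.sum_congr rfl fun i _ => ?_
      rw [coeffMat_sum]
      refine Finset.sum_congr rfl fun j _ => ?_
      rw [← hCl, ← hmul, coeffMat_map_mul_map]
    rw [← h1, algebraMap_smul]
    ext1 i r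
    simp [coeffMat]
  rw [hG, hG] at key2
  rw [smul_sub, smul_comm, key2, sub_mul, mul_assoc, mul_assoc]

include hv in
/-- The blown up Bezout matrix is the Bezoutian of the matrix polynomials of `p` and `q`. -/
theorem smul_bezoutCoeff {p q : S} {β10 β20 β12 : Matrix (Idx n) (Idx n) ℂ}
    (hβ : IsBezoutDecomposition n p q β10 β20 β12)
    (hP : ∀ i r, (c.evX D p i r).natDegree ≤ n) (hQ : ∀ i r, (c.evX D q i r).natDegree ≤ n)
    (hY : ∀ (j : Idx n) (b : ℕ), n ≤ b → coeffMat b (c.evY D (monomPoly j.1)) = 0) (b : ℕ) :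
    tripleProduct c.v c.u c.e • c.bezoutCoeff D β10 β20 β12 b =
      bezoutian (c.evX D p) (c.evX D q) b * (pencilAt D c.v).map Polynomial.C := by
  have hlarge : ∀ b, n ≤ b → tripleProduct c.v c.u c.e • c.bezoutCoeff D β10 β20 β12 b =
      bezoutian (c.evX D p) (c.evX D q) b * (pencilAt D c.v).map Polynomial.C := by
    intro b hb
    rw [bezoutian, divDiff_eq_zero hP hb, divDiff_eq_zero hQ hb, bezoutCoeff,
      Finset.sum_eq_zero]
    · simp
    · intro i _
      refine Finset.sum_eq_zero fun j _ => ?_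
      rw [hY j b hb]
      simp
  have hstep : ∀ b, tripleProduct c.v c.u c.e • c.bezoutCoeff D β10 β20 β12 (b + 1) =
      bezoutian (c.evX D p) (c.evX D q) (b + 1) * (pencilAt D c.v).map Polynomial.C →
      tripleProduct c.v c.u c.e • c.bezoutCoeff D β10 β20 β12 b =
      bezoutian (c.evX D p) (c.evX D q) b * (pencilAt D c.v).map Polynomial.C := by
    intro b h
    have h1 := c.X_smul_bezoutCoeff hv hβ b
    rw [← X_smul_bezoutian_succ, smul_sub, smul_comm, h, sub_mul, Matrix.smul_mul] at h1
    exact sub_right_injective h1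
  -- Both sequences satisfy the same recursion and vanish from index `n` on, so the equality
  -- descends from there.
  obtain hb | hb := le_total n b
  · exact hlarge b hb
  · exact Nat.decreasingInduction (motive := fun b _ =>
      tripleProduct c.v c.u c.e • c.bezoutCoeff D β10 β20 β12 b =
        bezoutian (c.evX D p) (c.evX D q) b * (pencilAt D c.v).map Polynomial.C)
      (fun k _ hk => hstep k hk) (hlarge n le_rfl) hb

end Chart
end CurveBezout

/-! ### Degree bounds and adjoints. -/

namespace CurveBezout
open Polynomial (aeval)

section Degree

variable {m : ℕ}

lemma HasLead.map_C (M : Matrix (Fin m) (Fin m) ℂ) : HasLead 0 (M.map Polynomial.C) M :=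
  ⟨by simp, by ext; simp [coeffMat]⟩

lemma HasLead.neg {d : ℕ} {M : Matrix (Fin m) (Fin m) (Polynomial ℂ)}
    {N : Matrix (Fin m) (Fin m) ℂ} (h : HasLead d M N) : HasLead d (-M) (-N) := by
  simpa using h.smul (-1)

end Degree

section Adjoint

variable {m : ℕ}

/-- The matrix polynomial whose coefficients are the adjoints of those of `M`. -/
noncomputable def adjMat (M : Matrix (Fin m) (Fin m) (Polynomial ℂ)) :
    Matrix (Fin m) (Fin m) (Polynomial ℂ) :=
  (M.map (Polynomial.mapRingHom (starRingEnd ℂ)))ᵀ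

lemma coeffMat_adjMat (k : ℕ) (M : Matrix (Fin m) (Fin m) (Polynomial ℂ)) :
    coeffMat k (adjMat M) = (coeffMat k M)ᴴ := by
  ext i r
  simp [coeffMat, adjMat]

lemma adjMat_mul (M N : Matrix (Fin m) (Fin m) (Polynomial ℂ)) :
    adjMat (M * N) = adjMat N * adjMat M := by
  rw [adjMat, Matrix.map_mul, Matrix.transpose_mul]; rfl

lemma adjMat_one : adjMat (1 : Matrix (Fin m) (Fin m) (Polynomial ℂ)) = 1 := by
  rw [adjMat, Matrix.map_one _ (map_zero _) (map_one _), Matrix.transpose_one]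

lemma adjMat_add (M N : Matrix (Fin m) (Fin m) (Polynomial ℂ)) :
    adjMat (M + N) = adjMat M + adjMat N := by
  ext1 i r; simp [adjMat]

lemma adjMat_neg (M : Matrix (Fin m) (Fin m) (Polynomial ℂ)) : adjMat (-M) = -adjMat M := by
  ext1 i r; simp [adjMat]

lemma adjMat_smul (a : Polynomial ℂ) (M : Matrix (Fin m) (Fin m) (Polynomial ℂ)) :
    adjMat (a • M) = Polynomial.mapRingHom (starRingEnd ℂ) a • adjMat M := by
  ext1 i r; simp [adjMat]

lemma adjMat_map_C (M : Matrix (Fin m) (Fin m) ℂ) :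
    adjMat (M.map Polynomial.C) = Mᴴ.map Polynomial.C := by
  ext1 i r; simp [adjMat]

end Adjoint

lemma monomPoly_add_single (j : Fin 3 → ℕ) (k : Fin 3) :
    monomPoly (j + Pi.single k 1) = MvPolynomial.X k * monomPoly j := by
  fin_cases k <;> simp [monomPoly, pow_succ] <;> ring

lemma monomPoly_isHomogeneous (i : Fin 3 → ℕ) : (monomPoly i).IsHomogeneous (i 0 + i 1 + i 2) :=
  ((MvPolynomial.isHomogeneous_X_pow _ _).mul (MvPolynomial.isHomogeneous_X_pow _ _)).mul
    (MvPolynomial.isHomogeneous_X_pow _ _)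

lemma monomPoly_eq_monomial (s : Fin 3 →₀ ℕ) :
    monomPoly s = MvPolynomial.monomial s (1 : ℂ) := by
  rw [MvPolynomial.monomial_eq, Finsupp.prod_fintype _ _ (by simp), Fin.prod_univ_three]
  simp [monomPoly]

namespace Chart

variable (c : Chart) {m n : ℕ} (D : Fin 3 → Matrix (Fin m) (Fin m) ℂ)

lemma hasLead_pencilOver_base : HasLead 1 (pencilOver D c.base) (pencilAt D c.u) := by
  constructor
  · intro i r
    have h : ∀ k : Fin 3, (c.base k * (algebraMap ℂ (Polynomial ℂ) (D k i r))).natDegree ≤ 1 := by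
      intro k
      refine (Polynomial.natDegree_mul_C_le _ _).trans ?_
      exact Polynomial.natDegree_linear_le
    simp only [pencilOver, Matrix.add_apply, Matrix.sub_apply, Matrix.smul_apply, Matrix.map_apply,
      smul_eq_mul]
    exact (Polynomial.natDegree_sub_le_of_le (Polynomial.natDegree_add_le_of_degree_le
      (h 0) (h 1)) (h 2))
  · ext i r
    simp [coeffMat, pencilOver, pencilAt, base]

lemma hasLead_actX : HasLead 1 (c.actX D) (-(pencilAt D c.u * (pencilAt D c.v)⁻¹)) :=
  ((c.hasLead_pencilOver_base D).mul (HasLead.map_C _)).neg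

lemma hasLead_actY : HasLead 1 (c.actY D) (-((pencilAt D c.v)⁻¹ * pencilAt D c.u)) :=
  ((HasLead.map_C _).mul (c.hasLead_pencilOver_base D)).neg

lemma hasLead_matEval {T : Matrix (Fin m) (Fin m) (Polynomial ℂ)} {T1 : Matrix (Fin m) (Fin m) ℂ}
    (h : HasLead 1 T T1) {f : S} {d : ℕ} (hf : f.IsHomogeneous d) :
    HasLead d (matEval c.v c.base T f) (matEval c.v c.u T1 f) := by
  refine hasLead_of_isHomogeneous (fun i => ?_) hf
  rw [matEval_X, matEval_X]
  refine HasLead.add ?_ ?_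
  · rw [algebraMap_smul]
    exact h.smul (c.v i)
  · constructor
    · intro k r
      rw [Matrix.smul_apply, Matrix.one_apply]
      split_ifs
      · simpa [base] using (Polynomial.natDegree_linear_le (a := c.u i) (b := c.e i))
      · simp
    · ext k r
      rw [coeffMat, Matrix.map_apply, Matrix.smul_apply, Matrix.one_apply, Matrix.smul_apply,
        Matrix.one_apply]
      split_ifs <;> simp [base]

lemma coeffMat_evY_monomPoly (j : Idx n) (b : ℕ) (hb : n ≤ b) :
    coeffMat b (c.evY D (monomPoly j.1)) = 0 := by
  refine coeffMat_eq_zero (c.hasLead_matEval (c.hasLead_actY D)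
    (monomPoly_isHomogeneous j.1)).1 ?_
  have := j.2
  omega

lemma natDegree_evX_monomPoly (j : Idx n) (i r : Fin m) :
    (c.evX D (monomPoly j.1) i r).natDegree < n := by
  have h := (c.hasLead_matEval (c.hasLead_actX D) (monomPoly_isHomogeneous j.1)).1 i r
  have := j.2
  exact lt_of_le_of_lt h (by omega)

variable {D}

/-- The vectors of the chart are real. -/
structure IsReal : Prop where
  v : ∀ i, star (c.v i) = c.v i
  u : ∀ i, star (c.u i) = c.u i
  e : ∀ i, star (c.e i) = c.e i

-- The pencil is hermitian at real vectors, so taking adjoints exchanges the two actions of `τ`. The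
-- reversal of products is harmless because the images of `S` commute.
variable {c} in
lemma adjMat_evX (hc : c.IsReal) (hD : ∀ k, (D k).IsHermitian) (i : Fin 3 → ℕ) :
    adjMat (c.evX D (monomPoly i)) = c.evY D (monomPoly i) := by
  have hbase : ∀ k, Polynomial.mapRingHom (starRingEnd ℂ) (c.base k) = c.base k := by
    intro k
    have hu : (starRingEnd ℂ) (c.u k) = c.u k := hc.u k
    have he : (starRingEnd ℂ) (c.e k) = c.e k := hc.e k
    simp [base, hu, he]
  have hherm : (pencilAt D c.v).IsHermitian := by
    have hsm : ∀ k, (c.v k • D k).IsHermitian := by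
      intro k
      rw [Matrix.IsHermitian, Matrix.conjTranspose_smul, hc.v k, hD k]
    exact ((hsm 0).add (hsm 1)).sub (hsm 2)
  have hb : adjMat (pencilOver D c.base) = pencilOver D c.base := by
    ext1 i r
    have hDk : ∀ k, (starRingEnd ℂ) (D k r i) = D k i r := fun k => (hD k).apply i r
    have h0 := hbase 0
    have h1 := hbase 1
    have h2 := hbase 2
    simp only [Polynomial.coe_mapRingHom] at h0 h1 h2
    simp [adjMat, pencilOver, hDk, h0, h1, h2]
  have hact : adjMat (c.actX D) = c.actY D := by
    rw [actX, adjMat_neg, adjMat_mul, hb, adjMat_map_C, Matrix.conjTranspose_nonsing_inv, hherm,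
      actY]
  have hX : ∀ k, adjMat (c.evX D (MvPolynomial.X k)) = c.evY D (MvPolynomial.X k) := by
    intro k
    have hv : (starRingEnd ℂ) (c.v k) = c.v k := hc.v k
    rw [evX, evY, matEval_X, matEval_X, adjMat_add, adjMat_smul, adjMat_smul, hact, hbase,
      adjMat_one]
    congr 2
    simp [hv]
  have hmul : ∀ f g : S, adjMat (c.evX D f) = c.evY D f → adjMat (c.evX D g) = c.evY D g →
      adjMat (c.evX D (f * g)) = c.evY D (f * g) := by
    intro f g hf hg
    rw [mul_comm, map_mul, adjMat_mul, hf, hg, map_mul, evY, matEval_mul_comm, ← map_mul]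
  have hpow : ∀ (k : Fin 3) (d : ℕ),
      adjMat (c.evX D (MvPolynomial.X k ^ d)) = c.evY D (MvPolynomial.X k ^ d) := by
    intro k d
    induction d with
    | zero => simp [adjMat_one]
    | succ d ih => rw [pow_succ]; exact hmul _ _ ih (hX k)
  exact hmul _ _ (hmul _ _ (hpow 0 _) (hpow 1 _)) (hpow 2 _)

end Chart
end CurveBezout

/-! ### Parametrization of the principal subspace by `n` vectors. -/

namespace CurveBezout

section FormValue

variable {m n : ℕ}

/-- A multi-index as an exponent of a monomial. -/
noncomputable def Idx.exponent (i : Idx n) : Fin 3 →₀ ℕ := Finsupp.equivFunOnFinite.symm i.1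

lemma Idx.degree_exponent (i : Idx n) : i.exponent.degree + 1 = n := by
  rw [Finsupp.degree_eq_sum, Fin.sum_univ_three]
  exact i.2

lemma monomPoly_idx (i : Idx n) : monomPoly i.1 = MvPolynomial.monomial i.exponent 1 :=
  monomPoly_eq_monomial i.exponent

lemma Idx.exponent_injective : Function.Injective (Idx.exponent (n := n)) :=
  Finsupp.equivFunOnFinite.symm.injective.comp Subtype.val_injective

lemma Idx.exists_exponent_eq {s : Fin 3 →₀ ℕ} (h : s.degree + 1 = n) :
    ∃ i : Idx n, i.exponent = s := by
  rw [Finsupp.degree_eq_sum, Fin.sum_univ_three] at h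
  exact ⟨⟨s, h⟩, Finsupp.equivFunOnFinite.symm_apply_apply s⟩

lemma sum_coeff_smul_monomPoly {f : S} {d : ℕ} (hf : f.IsHomogeneous d) (hd : d + 1 = n) :
    ∑ i : Idx n, f.coeff i.exponent • monomPoly i.1 = f := by
  classical
  ext s
  simp only [MvPolynomial.coeff_sum, MvPolynomial.coeff_smul, monomPoly_idx,
    MvPolynomial.coeff_monomial, smul_eq_mul, mul_ite, mul_one, mul_zero]
  by_cases hs : s.degree = d
  · obtain ⟨i, rfl⟩ := Idx.exists_exponent_eq (hs ▸ hd : s.degree + 1 = n)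
    rw [Finset.sum_eq_single i]
    · simp
    · intro j _ hj
      rw [if_neg fun h => hj (Idx.exponent_injective h)]
    · simp
  · rw [hf.coeff_eq_zero hs]
    refine Finset.sum_eq_zero fun i _ => ?_
    rw [if_neg]
    rintro rfl
    exact hs (by have := i.degree_exponent; omega)

/-- The linear function on polynomials with values `w_i` at the monomials of degree `n - 1`. -/
noncomputable def formValue (w : BlownUp n m) : S →ₗ[ℂ] (Fin m → ℂ) :=
  ∑ i : Idx n, (LinearMap.toSpanSingleton ℂ _ (comp w i)) ∘ₗ MvPolynomial.lcoeff ℂ i.exponent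

lemma formValue_apply (w : BlownUp n m) (f : S) :
    formValue w f = ∑ i : Idx n, f.coeff i.exponent • comp w i := by
  simp [formValue]

lemma formValue_monomPoly (w : BlownUp n m) (i : Idx n) :
    formValue w (monomPoly i.1) = comp w i := by
  classical
  rw [formValue_apply, Finset.sum_eq_single i]
  · simp [monomPoly_idx]
  · intro j _ hj
    rw [monomPoly_idx, MvPolynomial.coeff_monomial,
      if_neg fun h => hj (Idx.exponent_injective h.symm), zero_smul]
  · simp

lemma formValue_of_isHomogeneous (w : BlownUp n m) {f : S} {d : ℕ} (hf : f.IsHomogeneous d)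
    (hd : d + 1 ≠ n) : formValue w f = 0 := by
  rw [formValue_apply]
  refine Finset.sum_eq_zero fun i _ => ?_
  rw [hf.coeff_eq_zero, zero_smul]
  intro h
  exact hd (h ▸ i.degree_exponent)

variable {D : Fin 3 → Matrix (Fin m) (Fin m) ℂ}

/-- By linearity `g` may be a monomial. In degree `n - 2` this is the condition defining
`principal`; in every other degree all three values are zero. -/
lemma formValue_principal {w : BlownUp n m} (hw : w ∈ principal D n) (g : S) :
    D 0 *ᵥ formValue w (MvPolynomial.X 0 * g) + D 1 *ᵥ formValue w (MvPolynomial.X 1 * g) -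
      D 2 *ᵥ formValue w (MvPolynomial.X 2 * g) = 0 := by
  induction g using MvPolynomial.induction_on' with
  | add f g hf hg =>
    simp only [mul_add, map_add, Matrix.mulVec_add]
    rw [← add_zero (0 : Fin m → ℂ)]
    nth_rw 1 [← hf]
    rw [← hg]
    abel
  | monomial s a =>
    have hsm : MvPolynomial.monomial s a = a • monomPoly s := by
      rw [monomPoly_eq_monomial, MvPolynomial.smul_monomial, smul_eq_mul, mul_one]
    have hX : ∀ k, (MvPolynomial.X k : S) * MvPolynomial.monomial s a =
        a • monomPoly (⇑s + Pi.single k 1 : Fin 3 → ℕ) := by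
      intro k
      rw [hsm, mul_smul_comm, monomPoly_add_single]
    simp only [hX, map_smul, Matrix.mulVec_smul]
    rw [← smul_add, ← smul_sub]
    by_cases hs : s 0 + s 1 + s 2 + 2 = n
    · have hidx : ∀ k : Fin 3, (⇑s + Pi.single k 1 : Fin 3 → ℕ) 0 +
          (⇑s + Pi.single k 1 : Fin 3 → ℕ) 1 + (⇑s + Pi.single k 1 : Fin 3 → ℕ) 2 + 1 = n := by
        intro k
        fin_cases k <;> simp <;> omega
      have h : ∀ k : Fin 3, formValue w (monomPoly (⇑s + Pi.single k 1 : Fin 3 → ℕ)) =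
          comp w ⟨_, hidx k⟩ := fun k => formValue_monomPoly w ⟨_, hidx k⟩
      rw [h, h, h, hw s ⟨_, hidx 0⟩ ⟨_, hidx 1⟩ ⟨_, hidx 2⟩ rfl rfl rfl, smul_zero]
    · have h : ∀ k : Fin 3, formValue w (monomPoly (⇑s + Pi.single k 1 : Fin 3 → ℕ)) = 0 := by
        intro k
        refine formValue_of_isHomogeneous w (monomPoly_isHomogeneous _) ?_
        fin_cases k <;> simp <;> omega
      simp [h]

lemma linForm_isHomogeneous (a : Fin 3 → ℂ) : (linForm a).IsHomogeneous 1 := by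
  refine MvPolynomial.IsHomogeneous.sum _ _ _ fun i _ => ?_
  simpa using (MvPolynomial.isHomogeneous_C (Fin 3) (a i)).mul (MvPolynomial.isHomogeneous_X ℂ i)

namespace Chart

variable (c : Chart)

lemma formValue_principal {w : BlownUp n m} (hw : w ∈ principal D n) (g : S) :
    pencilAt D c.v *ᵥ formValue w (linForm c.j * g) +
      pencilAt D c.u *ᵥ formValue w (linForm c.k * g) +
        pencilAt D c.e *ᵥ formValue w (linForm c.l * g) = 0 := by
  have hX : ∀ i, formValue w (MvPolynomial.X i * g) = c.v i • formValue w (linForm c.j * g) +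
      c.u i • formValue w (linForm c.k * g) + c.e i • formValue w (linForm c.l * g) := by
    intro i
    rw [← c.linForm_expand i, ← map_smul, ← map_smul, ← map_smul, ← map_add, ← map_add]
    congr 1
    simp only [MvPolynomial.smul_eq_C_mul]
    ring
  rw [← CurveBezout.formValue_principal hw g, hX, hX, hX]
  simp only [pencilAt, Matrix.mulVec_add, Matrix.mulVec_smul, Matrix.add_mulVec,
    Matrix.sub_mulVec, Matrix.smul_mulVec]
  module

/-- An element of the principal subspace is determined by its values at the forms
`k ^ b * l ^ (n - 1 - b)`. -/
lemma eq_zero_of_formValue (hv : IsUnit (pencilAt D c.v)) {w : BlownUp n m}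
    (hw : w ∈ principal D n)
    (h : ∀ b d, b + d + 1 = n → formValue w (linForm c.k ^ b * linForm c.l ^ d) = 0) : w = 0 := by
  -- In the chart basis the defining relation expresses `L(v)` applied to the value at `j g` by the
  -- values at `k g` and `l g`; as `L(v)` is invertible, powers of `j` can be removed one by one.
  have h1 : ∀ a b d, a + b + d + 1 = n →
      formValue w (linForm c.j ^ a * (linForm c.k ^ b * linForm c.l ^ d)) = 0 := by
    intro a
    induction a with
    | zero =>
      intro b d hbd
      rw [pow_zero, one_mul]
      exact h b d (by omega)
    | succ a ih =>
      intro b d hbd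
      have h2 := c.formValue_principal hw
        (linForm c.j ^ a * (linForm c.k ^ b * linForm c.l ^ d))
      have e1 : linForm c.k * (linForm c.j ^ a * (linForm c.k ^ b * linForm c.l ^ d)) =
          linForm c.j ^ a * (linForm c.k ^ (b + 1) * linForm c.l ^ d) := by ring
      have e2 : linForm c.l * (linForm c.j ^ a * (linForm c.k ^ b * linForm c.l ^ d)) =
          linForm c.j ^ a * (linForm c.k ^ b * linForm c.l ^ (d + 1)) := by ring
      rw [e1, e2, ih _ _ (by omega), ih _ _ (by omega), Matrix.mulVec_zero, Matrix.mulVec_zero,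
        add_zero, add_zero, ← mul_assoc, ← pow_succ'] at h2
      exact Matrix.mulVec_injective_of_isUnit hv (h2.trans (Matrix.mulVec_zero _).symm)
  have h2 : ∀ i : Idx n, comp w i = 0 := by
    intro i
    -- Expanding `xᵢ` in `j, k, l` writes each monomial of degree `n - 1` as a combination of the
    -- products `j ^ a k ^ b l ^ d` of that degree.
    let ψ : S →ₐ[ℂ] S := MvPolynomial.aeval ![linForm c.j, linForm c.k, linForm c.l]
    let ψ' : S →ₐ[ℂ] S := MvPolynomial.aeval fun a =>
      MvPolynomial.C (c.v a) * MvPolynomial.X 0 + MvPolynomial.C (c.u a) * MvPolynomial.X 1 +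
        MvPolynomial.C (c.e a) * MvPolynomial.X 2
    have hψ : ψ.comp ψ' = AlgHom.id ℂ S := by
      apply MvPolynomial.algHom_ext
      intro a
      simp only [ψ, ψ', AlgHom.comp_apply, MvPolynomial.aeval_X, map_add, map_mul,
        MvPolynomial.algHom_C, AlgHom.id_apply, MvPolynomial.algebraMap_eq]
      exact c.linForm_expand a
    have hlin : ∀ (z : ℂ) (k : Fin 3),
        (MvPolynomial.C z * MvPolynomial.X k : S).IsHomogeneous 1 := fun z k => by
      simpa using (MvPolynomial.isHomogeneous_C (Fin 3) z).mul (MvPolynomial.isHomogeneous_X ℂ k)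
    have hhom : (ψ' (monomPoly i.1)).IsHomogeneous (1 * (i.1 0 + i.1 1 + i.1 2)) :=
      (monomPoly_isHomogeneous i.1).aeval _ fun a =>
        ((hlin _ _).add (hlin _ _)).add (hlin _ _)
    have h3 := DFunLike.congr_fun hψ (monomPoly i.1)
    rw [AlgHom.comp_apply, AlgHom.id_apply,
      ← sum_coeff_smul_monomPoly (n := n) hhom (by rw [one_mul]; exact i.2), map_sum] at h3
    rw [← formValue_monomPoly w i, ← h3, map_sum]
    refine Finset.sum_eq_zero fun a _ => ?_
    have h4 : ψ (monomPoly a.1) =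
        linForm c.j ^ a.1 0 * (linForm c.k ^ a.1 1 * linForm c.l ^ a.1 2) := by
      simp [ψ, monomPoly, mul_assoc]
    rw [map_smul, map_smul, h4, h1 _ _ _ a.2, smul_zero]
  ext ⟨i, r⟩
  exact congrFun (h2 i) r

lemma evY_eq_aeval_restrict (f : S) :
    c.evY D f = Polynomial.aeval (c.actY D) (c.restrict f) := rfl

lemma evY_linForm_k : c.evY D (linForm c.k) = (Polynomial.X : Polynomial ℂ) • 1 := by
  rw [evY_eq_aeval_restrict, sum_restrict_X, c.kv, c.ku, c.ke]
  simp [Algebra.algebraMap_eq_smul_one]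

lemma evY_linForm_l : c.evY D (linForm c.l) = 1 := by
  rw [evY_eq_aeval_restrict, sum_restrict_X, c.lv, c.lu, c.le]
  simp

variable (D)

/-- The parametrization of the principal subspace by the sequences of `n` vectors of `ℂ^m`. -/
noncomputable def paramMap (n : ℕ) : (Fin n → Fin m → ℂ) →ₗ[ℂ] BlownUp n m where
  toFun z := WithLp.toLp 2 fun ir =>
    (∑ b : Fin n, coeffMat b (c.evY D (monomPoly ir.1.1)) *ᵥ z b) ir.2
  map_add' z z' := by
    ext ir
    simp [Matrix.mulVec_add, Finset.sum_add_distrib]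
  map_smul' a z := by
    ext ir
    simp [Matrix.mulVec_smul, Finset.mul_sum]

variable {D}

lemma comp_paramMap (z : Fin n → Fin m → ℂ) (i : Idx n) :
    comp (c.paramMap D n z) i =
      ∑ b : Fin n, coeffMat b (c.evY D (monomPoly i.1)) *ᵥ z b := rfl

lemma formValue_paramMap (z : Fin n → Fin m → ℂ) {f : S} {d : ℕ} (hf : f.IsHomogeneous d)
    (hd : d + 1 = n) :
    formValue (c.paramMap D n z) f = ∑ b : Fin n, coeffMat b (c.evY D f) *ᵥ z b := by
  have hsm : ∀ (b : ℕ) (a : ℂ) (M : Matrix (Fin m) (Fin m) (Polynomial ℂ)),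
      coeffMat b (a • M) = a • coeffMat b M := by
    intro b a M
    ext1 i r
    simp [coeffMat]
  conv_rhs => rw [← sum_coeff_smul_monomPoly hf hd]
  simp only [map_sum, map_smul, coeffMat_sum, hsm, Matrix.sum_mulVec, Matrix.smul_mulVec]
  rw [Finset.sum_comm, formValue_apply]
  refine Finset.sum_congr rfl fun i _ => ?_
  rw [comp_paramMap, Finset.smul_sum]

/-- On the chart `k` acts as `s` and `l` as the identity, so the form acts as `s ^ b` and taking
coefficients picks out one vector. This makes the parametrization injective and, with
`eq_zero_of_formValue`, surjective. -/
lemma formValue_paramMap_pow (z : Fin n → Fin m → ℂ) (b : Fin n) (d : ℕ) (hbd : b + d + 1 = n) :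
    formValue (c.paramMap D n z) (linForm c.k ^ (b : ℕ) * linForm c.l ^ d) = z b := by
  have hhom : (linForm c.k ^ (b : ℕ) * linForm c.l ^ d).IsHomogeneous (1 * b + 1 * d) :=
    ((linForm_isHomogeneous _).pow _).mul ((linForm_isHomogeneous _).pow _)
  rw [c.formValue_paramMap z hhom (by omega), Finset.sum_eq_single b]
  · have : coeffMat b (c.evY D (linForm c.k ^ (b : ℕ) * linForm c.l ^ d)) = 1 := by
      rw [map_mul, map_pow, map_pow, evY_linForm_k, evY_linForm_l, one_pow, mul_one, smul_pow,
        one_pow]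
      ext1 i r
      rcases eq_or_ne i r with rfl | h
      · simp [coeffMat]
      · simp [coeffMat, h]
    rw [this, Matrix.one_mulVec]
  · intro a _ hab
    have : coeffMat a (c.evY D (linForm c.k ^ (b : ℕ) * linForm c.l ^ d)) = 0 := by
      rw [map_mul, map_pow, map_pow, evY_linForm_k, evY_linForm_l, one_pow, mul_one, smul_pow,
        one_pow]
      have hne : (a : ℕ) ≠ b := fun h => hab (Fin.ext h)
      ext1 i r
      rcases eq_or_ne i r with rfl | h
      · simp [coeffMat, Polynomial.coeff_X_pow, hne]
      · simp [coeffMat, h]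
    rw [this, Matrix.zero_mulVec]
  · simp

/-- The matrices of the coordinates satisfy `D₀ Y₀ + D₁ Y₁ - D₂ Y₂ = L(v) T' + L(s u + e) = 0`; the
defining relation of `principal` is this identity times a monomial, coefficient by coefficient. -/
lemma paramMap_mem_principal (hv : IsUnit (pencilAt D c.v)) (z : Fin n → Fin m → ℂ) :
    c.paramMap D n z ∈ principal D n := by
  intro s i i' i'' hi hi' hi''
  have hrel : (D 0).map Polynomial.C * c.evY D (MvPolynomial.X 0) +
      (D 1).map Polynomial.C * c.evY D (MvPolynomial.X 1) -
      (D 2).map Polynomial.C * c.evY D (MvPolynomial.X 2) = 0 := by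
    have h1 := c.mul_actY hv
    have h2 : (D 0).map Polynomial.C * c.evY D (MvPolynomial.X 0) +
        (D 1).map Polynomial.C * c.evY D (MvPolynomial.X 1) -
        (D 2).map Polynomial.C * c.evY D (MvPolynomial.X 2) =
        (pencilAt D c.v).map Polynomial.C * c.actY D + pencilOver D c.base := by
      have h3 : (pencilAt D c.v).map Polynomial.C = pencilOver D
          (fun i => algebraMap ℂ (Polynomial ℂ) (c.v i)) := (pencilOver_algebraMap D c.v).symm
      rw [h3]
      simp only [evY, matEval_X, pencilOver, mul_add, add_mul, sub_mul, Matrix.mul_smul,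
        Matrix.smul_mul, mul_one, Polynomial.algebraMap_eq]
      abel
    rw [h2, h1, neg_add_cancel]
  have hcoef : ∀ (b : ℕ) (M : Matrix (Fin m) (Fin m) ℂ)
      (N : Matrix (Fin m) (Fin m) (Polynomial ℂ)),
      coeffMat b (M.map Polynomial.C * N) = M * coeffMat b N := by
    intro b M N
    ext1 i r
    simp [coeffMat, Matrix.mul_apply, Polynomial.finsetSum_coeff]
  simp only [comp_paramMap, hi, hi', hi'', monomPoly_add_single, map_mul]
  simp only [Matrix.mulVec_sum, Matrix.mulVec_mulVec, ← hcoef, ← Finset.sum_add_distrib,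
    ← Finset.sum_sub_distrib, ← Matrix.add_mulVec, ← Matrix.sub_mulVec, ← coeffMat_add,
    ← coeffMat_sub, ← mul_assoc, ← add_mul, ← sub_mul]
  rw [hrel]
  refine Finset.sum_eq_zero fun b _ => ?_
  rw [zero_mul]
  have : coeffMat b (0 : Matrix (Fin m) (Fin m) (Polynomial ℂ)) = 0 := by
    ext1 i r; simp [coeffMat]
  rw [this, Matrix.zero_mulVec]

/-- The parametrization of the principal subspace as a linear equivalence. -/
noncomputable def paramEquiv (hv : IsUnit (pencilAt D c.v)) (n : ℕ) :
    (Fin n → Fin m → ℂ) ≃ₗ[ℂ] principal D n :=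
  LinearEquiv.ofBijective
    ((c.paramMap D n).codRestrict (principal D n) (c.paramMap_mem_principal hv)) (by
    constructor
    · rw [← LinearMap.ker_eq_bot, LinearMap.ker_codRestrict, LinearMap.ker_eq_bot']
      intro z hz
      funext b
      rw [← c.formValue_paramMap_pow (D := D) z b (n - 1 - b) (by omega), hz, formValue_apply]
      exact Finset.sum_eq_zero fun i _ => smul_zero _
    · rintro ⟨w, hw⟩
      let z : Fin n → Fin m → ℂ := fun b =>
        formValue w (linForm c.k ^ (b : ℕ) * linForm c.l ^ (n - 1 - b : ℕ))
      refine ⟨z, Subtype.ext ?_⟩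
      have hsub : ∀ f, formValue (c.paramMap D n z - w) f =
          formValue (c.paramMap D n z) f - formValue w f := by
        intro f
        rw [formValue_apply, formValue_apply, formValue_apply, ← Finset.sum_sub_distrib]
        refine Finset.sum_congr rfl fun i _ => ?_
        rw [← smul_sub]
        rfl
      refine sub_eq_zero.mp (c.eq_zero_of_formValue hv
        (sub_mem (c.paramMap_mem_principal hv z) hw) fun b d hbd => ?_)
      obtain rfl : d = n - 1 - b := by omega
      refine (hsub _).trans ?_
      rw [sub_eq_zero, c.formValue_paramMap_pow z ⟨b, by omega⟩ _ hbd])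

lemma coe_paramEquiv (hv : IsUnit (pencilAt D c.v)) (z : Fin n → Fin m → ℂ) :
    (c.paramEquiv hv n z : BlownUp n m) = c.paramMap D n z := rfl

end Chart

end FormValue

end CurveBezout

/-! ### Orthogonality to the principal subspace, and the kernel of the Bezout matrix. -/

namespace CurveBezout

namespace Chart

variable (c : Chart) {m n : ℕ} (D : Fin 3 → Matrix (Fin m) (Fin m) ℂ)

/-- The generating function of the coordinates of the orthogonal projection to the principal
subspace. -/
noncomputable def coordMap (n : ℕ) (w : BlownUp n m) : Fin m → Polynomial ℂ :=
  ∑ i : Idx n, c.evX D (monomPoly i.1) *ᵥ constVec (comp w i)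

variable {D}

lemma coeff_mulVec_constVec (M : Matrix (Fin m) (Fin m) (Polynomial ℂ)) (w : Fin m → ℂ)
    (b : ℕ) (r : Fin m) : ((M *ᵥ constVec w) r).coeff b = (coeffMat b M *ᵥ w) r := by
  simp [Matrix.mulVec, dotProduct, Polynomial.finsetSum_coeff, constVec_apply, coeffMat]

lemma coeff_coordMap (w : BlownUp n m) (b : ℕ) (r : Fin m) :
    (c.coordMap D n w r).coeff b =
      (∑ i : Idx n, coeffMat b (c.evX D (monomPoly i.1)) *ᵥ comp w i) r := by
  rw [coordMap, Finset.sum_apply, Finset.sum_apply, Polynomial.finsetSum_coeff]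
  exact Finset.sum_congr rfl fun i _ => coeff_mulVec_constVec _ _ _ _

lemma coordMap_eq_zero_iff (w : BlownUp n m) :
    c.coordMap D n w = 0 ↔ ∀ b : Fin n,
      ∑ i : Idx n, coeffMat b (c.evX D (monomPoly i.1)) *ᵥ comp w i = 0 := by
  constructor
  · intro h b
    funext r
    rw [← coeff_coordMap, h]
    simp
  · intro h
    funext r
    ext b
    rw [coeff_coordMap]
    by_cases hb : b < n
    · rw [h ⟨b, hb⟩]
      simp
    · rw [Finset.sum_eq_zero]
      · simp
      · intro i _
        have : coeffMat b (c.evX D (monomPoly i.1)) = 0 := by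
          ext1 r s
          exact Polynomial.coeff_eq_zero_of_natDegree_lt
            ((c.natDegree_evX_monomPoly D i r s).trans_le (not_lt.mp hb))
        rw [this, Matrix.zero_mulVec]

/-- Moving the matrices across the inner product replaces the adjoint action by the action on the
cokernel, so `coordMap` collects the coordinates of the adjoint parametrization. -/
lemma inner_paramMap (hc : c.IsReal) (hD : ∀ k, (D k).IsHermitian) (z : Fin n → Fin m → ℂ)
    (w : BlownUp n m) : inner ℂ (c.paramMap D n z) w =
      ∑ b : Fin n, star (z b) ⬝ᵥ
        ∑ i : Idx n, coeffMat b (c.evX D (monomPoly i.1)) *ᵥ comp w i := by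
  have h1 : inner ℂ (c.paramMap D n z) w =
      ∑ i : Idx n, star (comp (c.paramMap D n z) i) ⬝ᵥ comp w i := by
    rw [EuclideanSpace.inner_eq_star_dotProduct, dotProduct_comm, dotProduct,
      Fintype.sum_prod_type]
    rfl
  rw [h1]
  simp only [comp_paramMap, star_sum, sum_dotProduct, dotProduct_sum]
  rw [Finset.sum_comm]
  refine Finset.sum_congr rfl fun b _ => Finset.sum_congr rfl fun i _ => ?_
  rw [Matrix.star_mulVec, Matrix.dotProduct_mulVec, ← coeffMat_adjMat, ← adjMat_evX hc hD]
  congr 2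
  rw [coeffMat_adjMat, coeffMat_adjMat, Matrix.conjTranspose_conjTranspose]

open scoped ComplexOrder in
lemma mem_orthogonal_principal_iff (hv : IsUnit (pencilAt D c.v)) (hc : c.IsReal)
    (hD : ∀ k, (D k).IsHermitian) (w : BlownUp n m) :
    w ∈ (principal D n)ᗮ ↔ c.coordMap D n w = 0 := by
  rw [coordMap_eq_zero_iff, Submodule.mem_orthogonal]
  constructor
  · intro h b
    -- Testing against the coordinate itself yields its squared norm.
    have h1 := h _ (c.paramMap_mem_principal hv (Pi.single b
      (∑ i : Idx n, coeffMat b (c.evX D (monomPoly i.1)) *ᵥ comp w i)))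
    rw [c.inner_paramMap hc hD, Finset.sum_eq_single b] at h1
    · rwa [Pi.single_eq_same, dotProduct_star_self_eq_zero] at h1
    · intro a _ hab
      rw [Pi.single_eq_of_ne hab, star_zero, zero_dotProduct]
    · simp
  · intro h w' hw'
    obtain ⟨z, hz⟩ := (c.paramEquiv hv n).surjective ⟨w', hw'⟩
    have hz' : c.paramMap D n z = w' := by rw [← coe_paramEquiv c hv, hz]
    rw [← hz', c.inner_paramMap hc hD]
    refine Finset.sum_eq_zero fun b _ => ?_
    rw [h b, dotProduct_zero]

lemma comp_blownUpBezout (β10 β20 β12 : Matrix (Idx n) (Idx n) ℂ) (w : BlownUp n m) (i : Idx n) :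
    comp (blownUpBezout D β10 β20 β12 w) i =
      ∑ j : Idx n, (β12 i j • D 0 + β20 i j • D 1 + β10 i j • D 2) *ᵥ comp w j := by
  funext r
  rw [Finset.sum_apply]
  change ((β12 ⊗ₖ D 0 + β20 ⊗ₖ D 1 + β10 ⊗ₖ D 2) *ᵥ w.ofLp) (i, r) = _
  rw [Matrix.mulVec, dotProduct, Fintype.sum_prod_type]
  refine Finset.sum_congr rfl fun j _ => ?_
  rw [Matrix.mulVec, dotProduct]
  refine Finset.sum_congr rfl fun s _ => ?_
  simp [comp, Matrix.kroneckerMap_apply]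

lemma constVec_mulVec (M : Matrix (Fin m) (Fin m) ℂ) (w : Fin m → ℂ) :
    constVec (M *ᵥ w) = M.map Polynomial.C *ᵥ constVec w := by
  funext r
  simp [constVec_apply, Matrix.mulVec, dotProduct, map_sum]

lemma coordMap_blownUpBezout (β10 β20 β12 : Matrix (Idx n) (Idx n) ℂ) (z : Fin n → Fin m → ℂ) :
    c.coordMap D n (blownUpBezout D β10 β20 β12 (c.paramMap D n z)) =
      seqMap n (c.bezoutCoeff D β10 β20 β12) z := by
  simp only [coordMap, comp_blownUpBezout, comp_paramMap, Matrix.mulVec_sum, map_sum,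
    constVec_mulVec, Matrix.mulVec_mulVec, seqMap_apply, bezoutCoeff, Matrix.sum_mulVec]
  rw [Finset.sum_congr rfl fun i _ => Finset.sum_comm, Finset.sum_comm]
  refine Finset.sum_congr rfl fun b _ => Finset.sum_congr rfl fun i _ =>
    Finset.sum_congr rfl fun j _ => ?_
  rw [Matrix.map_mul, mul_assoc]

variable (hv : IsUnit (pencilAt D c.v)) (hc : c.IsReal) (hD : ∀ k, (D k).IsHermitian)

-- The projection of `B w` vanishes exactly when `B w` is orthogonal to `V_n`, which `coordMap`
-- detects.
include hc hD in
lemma bezoutAlong_paramEquiv_eq_zero_iff (β10 β20 β12 : Matrix (Idx n) (Idx n) ℂ)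
    (z : Fin n → Fin m → ℂ) : bezoutAlong D β10 β20 β12 (c.paramEquiv hv n z) = 0 ↔
      seqMap n (c.bezoutCoeff D β10 β20 β12) z = 0 := by
  rw [← coordMap_blownUpBezout, ← c.mem_orthogonal_principal_iff hv hc hD,
    ← Submodule.orthogonalProjectionOnto_eq_zero_iff]
  rfl

-- The blown up Bezout matrix and the Bezoutian differ by the scalar `det(v, u, e)` and by `L(v)`
-- acting on each vector of the sequence, both invertible.
include hv hc hD in
theorem finrank_ker_bezoutAlong {p q : S} {β10 β20 β12 : Matrix (Idx n) (Idx n) ℂ}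
    (hβ : IsBezoutDecomposition n p q β10 β20 β12) (hp : p.IsHomogeneous n)
    (hq : q.IsHomogeneous n) (ht : tripleProduct c.v c.u c.e ≠ 0) :
    Module.finrank ℂ (LinearMap.ker (bezoutAlong D β10 β20 β12)) =
      Module.finrank ℂ (LinearMap.ker (seqMap n (bezoutian (c.evX D p) (c.evX D q)))) := by
  have hcoef := fun b => c.smul_bezoutCoeff hv hβ (c.hasLead_matEval (c.hasLead_actX D) hp).1
    (c.hasLead_matEval (c.hasLead_actX D) hq).1 (fun j b hb => c.coeffMat_evY_monomPoly D j b hb) b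
  have hdet : IsUnit (pencilAt D c.v).det := (Matrix.isUnit_iff_isUnit_det _).mp hv
  let E : (Fin n → Fin m → ℂ) ≃ₗ[ℂ] (Fin n → Fin m → ℂ) :=
    LinearEquiv.piCongrRight fun _ => Matrix.toLinearEquiv' (pencilAt D c.v)
      (Matrix.invertibleOfIsUnitDet _ hdet)
  have hE : ∀ z b, E z b = pencilAt D c.v *ᵥ z b := fun z b => rfl
  have hseq : ∀ z, tripleProduct c.v c.u c.e • seqMap n (c.bezoutCoeff D β10 β20 β12) z =
      seqMap n (bezoutian (c.evX D p) (c.evX D q)) (E z) := by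
    intro z
    rw [seqMap_apply, seqMap_apply, Finset.smul_sum]
    refine Finset.sum_congr rfl fun b _ => ?_
    rw [hE, constVec_mulVec, Matrix.mulVec_mulVec, ← hcoef, Matrix.smul_mulVec]
  have hker : LinearMap.ker (seqMap n (bezoutian (c.evX D p) (c.evX D q))) =
      (LinearMap.ker (bezoutAlong D β10 β20 β12)).map
        ((c.paramEquiv hv n).symm.trans E : principal D n →ₗ[ℂ] (Fin n → Fin m → ℂ)) := by
    ext z
    rw [Submodule.mem_map_equiv, LinearMap.mem_ker, LinearMap.mem_ker]
    have h1 : ((c.paramEquiv hv n).symm.trans E).symm z = c.paramEquiv hv n (E.symm z) := rfl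
    rw [h1, c.bezoutAlong_paramEquiv_eq_zero_iff hv hc hD,
      ← smul_eq_zero_iff_right (m := seqMap n _ (E.symm z)) ht, hseq,
      LinearEquiv.apply_symm_apply]
  rw [hker, LinearEquiv.finrank_map_eq]

end Chart
end CurveBezout

/-! ### The dimension formula in a suitable chart. -/

namespace CurveBezout
open Polynomial (aeval)

namespace Chart

variable (c : Chart) {m n : ℕ} {D : Fin 3 → Matrix (Fin m) (Fin m) ℂ}

/-- On the chart, the pencil is a multiple of the characteristic matrix of the action of `τ`. -/
lemma pencil_map_restrict (hv : IsUnit (pencilAt D c.v)) : (pencil D).map c.restrict =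
    (c.actX D).charmatrix * ((pencilAt D c.v).map Polynomial.C).map Polynomial.C := by
  rw [Matrix.charmatrix, sub_mul]
  have h1 : Polynomial.C.mapMatrix (c.actX D) * ((pencilAt D c.v).map Polynomial.C).map
      (Polynomial.C : Polynomial ℂ → Polynomial (Polynomial ℂ)) =
      -(pencilOver D c.base).map Polynomial.C := by
    rw [RingHom.mapMatrix_apply, ← Matrix.map_mul, c.actX_mul hv]
    ext1 a b
    simp
  rw [h1, Matrix.scalar_apply, ← Matrix.smul_eq_diagonal_mul]
  ext1 a b
  simp only [pencil, pencilAt, pencilOver, Matrix.map_apply, Matrix.add_apply, Matrix.sub_apply,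
    Matrix.smul_apply, Matrix.neg_apply, smul_eq_mul, map_add, map_sub, map_mul, restrict_X, base,
    MvPolynomial.algHom_C]
  simp only [Polynomial.algebraMap_eq, Polynomial.algebraMap_apply]
  ring

/-- Both sides are compared with the dimension of `ChartCoker`. The invertible leading coefficient
also yields that this space is finite-dimensional. -/
theorem finrank_ker_bezoutAlong_eq_finsum (hv : IsUnit (pencilAt D c.v)) (hc : c.IsReal)
    (hD : ∀ k, (D k).IsHermitian) {p q : S} {β10 β20 β12 : Matrix (Idx n) (Idx n) ℂ}
    (hβ : IsBezoutDecomposition n p q β10 β20 β12) (hp : p.IsHomogeneous n)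
    (hq : q.IsHomogeneous n) (ht : tripleProduct c.v c.u c.e ≠ 0)
    (hfin : (commonZeros D p q).Finite) (hl : ∀ x ∈ commonZeros D p q, c.l ⬝ᵥ x.rep ≠ 0)
    (hlead : IsUnit (matEval c.v c.u (-(pencilAt D c.u * (pencilAt D c.v)⁻¹)) p)) :
    (Module.finrank ℂ (LinearMap.ker (bezoutAlong D β10 β20 β12)) : ℕ∞) =
      ∑ᶠ x ∈ commonZeros D p q, zeroMult D p q x := by
  have hP := c.hasLead_matEval (c.hasLead_actX D) hp
  have hQ := c.hasLead_matEval (c.hasLead_actX D) hq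
  have hU : IsUnit (((pencilAt D c.v).map Polynomial.C).map
      (Polynomial.C : Polynomial ℂ → Polynomial (Polynomial ℂ))) :=
    (hv.map (Polynomial.C : ℂ →+* Polynomial ℂ).mapMatrix).map
      (Polynomial.C : Polynomial ℂ →+* Polynomial (Polynomial ℂ)).mapMatrix
  obtain ⟨φ⟩ := nonempty_coker_presMap_equiv (c.actX D) hU (c.pencil_map_restrict hv)
    (c.restrict p) (c.restrict q)
  obtain ⟨h1, h2⟩ := finrank_ker_bezoutian (matEval_mul_comm _ _ _ p q) hP.1 hQ.1
    (hP.2.symm ▸ hlead)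
  have h3 : Module.Finite ℂ ((Fin m → Polynomial ℂ) ⧸
      (LinearMap.range (aeval (c.actX D) (c.restrict p)).mulVecLin ⊔
        LinearMap.range (aeval (c.actX D) (c.restrict q)).mulVecLin)) := h1
  have : Module.Finite ℂ (c.ChartCoker D p q) := Module.Finite.equiv φ.symm
  rw [c.sum_zeroMult hp hq hfin hl, Module.length_eq_finrank,
    c.finrank_ker_bezoutAlong hv hc hD hβ hp hq ht]
  exact congrArg _ (h2.trans φ.finrank_eq.symm)

end Chart
end CurveBezout

/-! ### Choice of the chart and of a generic member of the pencil of `p` and `q`. -/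

namespace CurveBezout
open Polynomial (aeval)

/-- A basis of `ℂ³` with its dual basis. -/
noncomputable def Chart.ofTriple (v u e : Fin 3 → ℂ) (h : tripleProduct v u e ≠ 0) : Chart where
  v := v
  u := u
  e := e
  j := (tripleProduct v u e)⁻¹ • crossProduct u e
  k := (tripleProduct v u e)⁻¹ • crossProduct e v
  l := (tripleProduct v u e)⁻¹ • crossProduct v u
  expand x i := by
    rw [smul_dotProduct, smul_dotProduct, smul_dotProduct]
    simp only [smul_eq_mul, mul_assoc]
    rw [← mul_add, ← mul_add, inv_mul_eq_iff_eq_mul₀ h]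
    fin_cases i <;> simp [cross_apply, dotProduct, Fin.sum_univ_three, tripleProduct] <;> ring
  jv := by
    rw [smul_dotProduct, smul_eq_mul, inv_mul_eq_one₀ h]
    simp [cross_apply, dotProduct, Fin.sum_univ_three, tripleProduct]; ring
  ju := by
    rw [smul_dotProduct]
    simp [cross_apply, dotProduct, Fin.sum_univ_three]; ring_nf; simp
  je := by
    rw [smul_dotProduct]
    simp [cross_apply, dotProduct, Fin.sum_univ_three]; ring_nf; simp
  kv := by
    rw [smul_dotProduct]
    simp [cross_apply, dotProduct, Fin.sum_univ_three]; ring_nf; simp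
  ku := by
    rw [smul_dotProduct, smul_eq_mul, inv_mul_eq_one₀ h]
    simp [cross_apply, dotProduct, Fin.sum_univ_three, tripleProduct]; ring
  ke := by
    rw [smul_dotProduct]
    simp [cross_apply, dotProduct, Fin.sum_univ_three]; ring_nf; simp
  lv := by
    rw [smul_dotProduct]
    simp [cross_apply, dotProduct, Fin.sum_univ_three]; ring_nf; simp
  lu := by
    rw [smul_dotProduct]
    simp [cross_apply, dotProduct, Fin.sum_univ_three]; ring_nf; simp
  le := by
    rw [smul_dotProduct, smul_eq_mul, inv_mul_eq_one₀ h]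
    simp [cross_apply, dotProduct, Fin.sum_univ_three, tripleProduct]; ring

/-- A nonzero polynomial does not vanish at all real points. -/
lemma exists_real_eval_ne_zero {f : S} (hf : f ≠ 0) :
    ∃ a : Fin 3 → ℝ, MvPolynomial.eval (fun i => (a i : ℂ)) f ≠ 0 := by
  by_contra! h
  refine hf (MvPolynomial.funext_set (fun _ => Set.range ((↑) : ℝ → ℂ))
    (fun _ => Set.infinite_range_of_injective Complex.ofReal_injective) fun x hx => ?_)
  choose a ha using fun i => hx i trivial
  have hx' : x = fun i => (a i : ℂ) := funext fun i => (ha i).symm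
  rw [hx', h a, map_zero]

lemma linForm_ne_zero {a : Fin 3 → ℂ} (ha : a ≠ 0) : linForm a ≠ 0 := by
  obtain ⟨i, hi⟩ := Function.ne_iff.mp ha
  intro h
  have := eval_linForm a (Pi.single i 1)
  rw [h, map_zero, dotProduct_single_one] at this
  exact hi this.symm

/-- A real direction `u` such that no plane through `v` and `u` contains one of finitely many
vectors not parallel to `v`. -/
lemma exists_real_cross_dotProduct_ne_zero (v : Fin 3 → ℂ) {F : Set (Fin 3 → ℂ)} (hF : F.Finite)
    (h : ∀ x ∈ F, crossProduct x v ≠ 0) :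
    ∃ a : Fin 3 → ℝ, ∀ x ∈ F, crossProduct v (fun i => (a i : ℂ)) ⬝ᵥ x ≠ 0 := by
  have hprod : ∏ x ∈ hF.toFinset, linForm (crossProduct x v) ≠ 0 :=
    Finset.prod_ne_zero_iff.mpr fun x hx => linForm_ne_zero (h x (hF.mem_toFinset.mp hx))
  obtain ⟨a, ha⟩ := exists_real_eval_ne_zero hprod
  refine ⟨a, fun x hx => ?_⟩
  rw [map_prod, Finset.prod_ne_zero_iff] at ha
  have := ha x (hF.mem_toFinset.mpr hx)
  rwa [eval_linForm, dotProduct_comm, triple_product_permutation, dotProduct_comm] at this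

lemma exists_crossProduct_ne_zero {v : Fin 3 → ℂ} (hv : v ≠ 0) :
    ∃ x : Fin 3 → ℂ, crossProduct x v ≠ 0 := by
  by_contra! h
  apply hv
  have h0 := h ![1, 0, 0]
  have h1 := h ![0, 1, 0]
  simp [cross_apply] at h0 h1
  funext i
  fin_cases i
  · exact h1.2
  · exact h0.2
  · exact h1.1

section Generic

variable {m n : ℕ} {D : Fin 3 → Matrix (Fin m) (Fin m) ℂ} {p q : S}

lemma crossProduct_ne_zero_of_eval_discr {v x : Fin 3 → ℂ}
    (hv : MvPolynomial.eval v (discr D) ≠ 0) (hx0 : x ≠ 0)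
    (hx : MvPolynomial.eval x (discr D) = 0) : crossProduct x v ≠ 0 := by
  rw [crossProduct_ne_zero_iff_linearIndependent, LinearIndependent.pair_iff' hx0]
  rintro a rfl
  rw [eval_discr_smul, hx, mul_zero] at hv
  exact hv rfl

/-- A real chart containing finitely many given zeros of `Δ`, whose first vector is not a zero
of `Δ`. -/
lemma exists_chart (hΔ : discr D ≠ 0) {Z : Set Plane} (hZ : Z.Finite)
    (hZ0 : ∀ x ∈ Z, MvPolynomial.eval x.rep (discr D) = 0) :
    ∃ c : Chart, c.IsReal ∧ IsUnit (pencilAt D c.v) ∧ tripleProduct c.v c.u c.e ≠ 0 ∧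
      ∀ x ∈ Z, c.l ⬝ᵥ x.rep ≠ 0 := by
  -- The extra factor `x₀` forces `v ≠ 0`, which `Δ(v) ≠ 0` does not give when `m = 0`.
  obtain ⟨a, ha⟩ := exists_real_eval_ne_zero
    (mul_ne_zero hΔ (MvPolynomial.X_ne_zero (R := ℂ) (0 : Fin 3)))
  set v : Fin 3 → ℂ := fun i => (a i : ℂ)
  rw [map_mul, mul_ne_zero_iff, MvPolynomial.eval_X] at ha
  have hv0 : v ≠ 0 := fun h => ha.2 (congrFun h 0)
  -- An auxiliary vector that makes `v × u` nonzero even when there are no common zeros.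
  obtain ⟨w, hw⟩ := exists_crossProduct_ne_zero hv0
  obtain ⟨b, hb⟩ := exists_real_cross_dotProduct_ne_zero v
    ((hZ.image Projectivization.rep).insert w) (by
      rintro x (rfl | ⟨y, hy, rfl⟩)
      · exact hw
      · exact crossProduct_ne_zero_of_eval_discr ha.1 y.rep_nonzero (hZ0 y hy))
  -- With `e = v × u` real, `det(v, u, e)` is the sum of squares of its coordinates, hence nonzero.
  let e : Fin 3 → ℝ := crossProduct a b
  have he : crossProduct v (fun i => (b i : ℂ)) = fun i => (e i : ℂ) := by
    funext i
    fin_cases i <;> simp [e, v, cross_apply]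
  have hbw := hb w (Set.mem_insert _ _)
  have he0 : e ≠ 0 := by
    rintro h
    rw [he, h] at hbw
    exact hbw (by simp [dotProduct])
  have ht : tripleProduct v (fun i => (b i : ℂ)) (fun i => (e i : ℂ)) ≠ 0 := by
    have h1 : tripleProduct v (fun i => (b i : ℂ)) (fun i => (e i : ℂ)) =
        ((e ⬝ᵥ e : ℝ) : ℂ) := by
      simp [tripleProduct, dotProduct, Fin.sum_univ_three, e, cross_apply, v]
      ring
    rw [h1, Complex.ofReal_ne_zero]
    exact fun h => he0 (dotProduct_self_eq_zero.mp h)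
  refine ⟨Chart.ofTriple v _ _ ht, ⟨fun i => ?_, fun i => ?_, fun i => ?_⟩, ?_, ht,
    fun x hx => ?_⟩
  · exact Complex.conj_ofReal _
  · exact Complex.conj_ofReal _
  · exact Complex.conj_ofReal _
  · rw [Matrix.isUnit_iff_isUnit_det, isUnit_iff_ne_zero, ← eval_discr]
    exact ha.1
  · rw [Chart.ofTriple, smul_dotProduct]
    exact smul_ne_zero (inv_ne_zero ht) (hb _ (Set.mem_insert_of_mem _ ⟨x, hx, rfl⟩))

/-- By spectral mapping the eigenvalues of `f(T) + z g(T)` are `f(a) + z g(a)`. Each eigenvalue `a`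
of `T` excludes at most one `z`, since `f` and `g` do not both vanish there. -/
lemma exists_isUnit_aeval_add_smul (T : Matrix (Fin m) (Fin m) ℂ) (f g : Polynomial ℂ)
    (h : ∀ a ∈ spectrum ℂ T, f.eval a = 0 → g.eval a ≠ 0) :
    ∃ z : ℂ, IsUnit (aeval T (f + z • g)) := by
  rcases Nat.eq_zero_or_pos m with rfl | hm
  · exact ⟨0, isUnit_of_subsingleton _⟩
  have : Nonempty (Fin m) := ⟨⟨0, hm⟩⟩
  -- Where `g(a) = 0` the quotient is a default value; excluding it is harmless, as `f(a) ≠ 0`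
  -- there.
  have hfin := (Matrix.finite_spectrum T).image fun a => -(f.eval a / g.eval a)
  obtain ⟨z, hz⟩ := hfin.exists_notMem
  refine ⟨z, ?_⟩
  by_contra hu
  rw [← spectrum.zero_mem_iff ℂ, spectrum.map_polynomial_aeval_of_nonempty T _
    (spectrum.nonempty_of_isAlgClosed_of_finiteDimensional ℂ T)] at hu
  obtain ⟨a, ha, ha0⟩ := hu
  simp only [Polynomial.eval_add, Polynomial.eval_smul, smul_eq_mul] at ha0
  have hg : g.eval a ≠ 0 := by
    intro hg
    rw [hg, mul_zero, add_zero] at ha0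
    exact h a ha ha0 hg
  refine hz ⟨a, ha, ?_⟩
  rw [neg_eq_iff_eq_neg, div_eq_iff hg]
  linear_combination ha0

lemma eval_lineEval (v u : Fin 3 → ℂ) (a : ℂ) (f : S) :
    (lineEval v u f).eval a = MvPolynomial.eval (a • v + u) f := by
  have : (Polynomial.aeval a).comp (lineEval v u) = MvPolynomial.aeval (a • v + u) := by
    apply MvPolynomial.algHom_ext
    intro i
    rw [AlgHom.comp_apply, lineEval, MvPolynomial.aeval_X, MvPolynomial.aeval_X]
    simp [mul_comm a]
  exact DFunLike.congr_fun this f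

/-- The leading coefficient is governed by the line `l = 0` at infinity: eigenvalues `a` of `-L(u)
L(v)⁻¹` are the points `a v + u` of the curve on it, and none of them is a common zero. -/
lemma Chart.exists_isUnit_lead (c : Chart) (hv : IsUnit (pencilAt D c.v))
    (hp : p.IsHomogeneous n) (hq : q.IsHomogeneous n)
    (hl : ∀ x ∈ commonZeros D p q, c.l ⬝ᵥ x.rep ≠ 0) :
    ∃ z : ℂ, IsUnit (matEval c.v c.u (-(pencilAt D c.u * (pencilAt D c.v)⁻¹)) (p + z • q)) := by
  set T := -(pencilAt D c.u * (pencilAt D c.v)⁻¹)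
  obtain ⟨z, hz⟩ := exists_isUnit_aeval_add_smul T (lineEval c.v c.u p) (lineEval c.v c.u q) (by
    intro a ha h1 h2
    rw [eval_lineEval] at h1 h2
    have hk : c.k ⬝ᵥ (a • c.v + c.u) = 1 := by
      rw [dotProduct_add, dotProduct_smul, c.kv, c.ku, smul_zero, zero_add]
    have hl0 : c.l ⬝ᵥ (a • c.v + c.u) = 0 := by
      rw [dotProduct_add, dotProduct_smul, c.lv, c.lu, smul_zero, zero_add]
    have hy : a • c.v + c.u ≠ 0 := by
      intro h
      rw [h, dotProduct_zero] at hk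
      exact zero_ne_one hk
    have h0 : MvPolynomial.eval (a • c.v + c.u) (discr D) = 0 := by
      by_contra hne
      refine ha ?_
      have h3 : (algebraMap ℂ (Matrix (Fin m) (Fin m) ℂ) a - T) * pencilAt D c.v =
          pencilAt D (a • c.v + c.u) := by
        rw [sub_mul, neg_mul, mul_assoc,
          Matrix.nonsing_inv_mul _ ((Matrix.isUnit_iff_isUnit_det _).mp hv), mul_one,
          sub_neg_eq_add, Algebra.algebraMap_eq_smul_one, smul_mul_assoc, one_mul,
          ← pencilAt_smul]
        simp only [pencilAt, Pi.add_apply, add_smul]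
        abel
      have h4 : IsUnit (pencilAt D (a • c.v + c.u)) := by
        rwa [Matrix.isUnit_iff_isUnit_det, isUnit_iff_ne_zero, ← eval_discr]
      rw [← h3] at h4
      have h5 := h4.mul hv.ringInverse
      rwa [mul_assoc, Ring.mul_inverse_cancel _ hv, mul_one] at h5
    obtain ⟨b, hb⟩ := Projectivization.exists_smul_eq_mk_rep ℂ _ hy
    refine hl _ (mk_mem_commonZeros hp hq hy h0 h1 h2) ?_
    rw [← hb]
    change c.l ⬝ᵥ ((b : ℂ) • (a • c.v + c.u)) = 0
    rw [dotProduct_smul, hl0, smul_zero])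
  refine ⟨z, ?_⟩
  rw [← map_smul, ← map_add] at hz
  exact hz

/-- Here and in the next two lemmas: `p + z q` and `q` have the same common zeros, generate the same
ideal, and `p ⊗ q - q ⊗ p` is unchanged, so the same Bezout data serve. -/
lemma commonZeros_add_smul (z : ℂ) : commonZeros D (p + z • q) q = commonZeros D p q := by
  ext x
  simp only [commonZeros, Set.mem_ofPred_eq, map_add, MvPolynomial.smul_eval]
  constructor
  · rintro ⟨h0, h1, h2⟩
    exact ⟨h0, by simpa [h2] using h1, h2⟩
  · rintro ⟨h0, h1, h2⟩
    exact ⟨h0, by simp [h1, h2], h2⟩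

lemma zeroMult_add_smul (z : ℂ) (x : Plane) : zeroMult D (p + z • q) q x = zeroMult D p q x := by
  have h : Ideal.span {toLoc x (p + z • q), toLoc x q} = Ideal.span {toLoc x p, toLoc x q} := by
    rw [MvPolynomial.smul_eq_C_mul, map_add, map_mul, Ideal.span_pair_add_mul_right]
  rw [zeroMult, h, zeroMult]

lemma IsBezoutDecomposition.add_smul {β10 β20 β12 : Matrix (Idx n) (Idx n) ℂ}
    (hβ : IsBezoutDecomposition n p q β10 β20 β12) (z : ℂ) :
    IsBezoutDecomposition n (p + z • q) q β10 β20 β12 := by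
  refine ⟨hβ.symm10, hβ.symm20, hβ.symm12, fun x y => ?_⟩
  rw [← hβ.decomp x y]
  simp only [map_add, MvPolynomial.smul_eval]
  ring

/-- The dimension of the kernel of the Bezout matrix along the curve is the number of common zeros
counted with multiplicity. -/
theorem finrank_ker_bezoutAlong_eq_finsum_zeroMult (hD : ∀ k, (D k).IsHermitian)
    (hΔ : discr D ≠ 0) (hp : p.IsHomogeneous n) (hq : q.IsHomogeneous n)
    (hfin : (commonZeros D p q).Finite) {β10 β20 β12 : Matrix (Idx n) (Idx n) ℂ}
    (hβ : IsBezoutDecomposition n p q β10 β20 β12) :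
    (Module.finrank ℂ (LinearMap.ker (bezoutAlong D β10 β20 β12)) : ℕ∞) =
      ∑ᶠ x ∈ commonZeros D p q, zeroMult D p q x := by
  obtain ⟨c, hc, hv, ht, hl⟩ := exists_chart hΔ hfin fun x hx => hx.1
  obtain ⟨z, hz⟩ := c.exists_isUnit_lead hv hp hq hl
  have hpz : (p + z • q).IsHomogeneous n := by
    rw [MvPolynomial.smul_eq_C_mul]
    exact hp.add (by simpa using (MvPolynomial.isHomogeneous_C (Fin 3) z).mul hq)
  have hZ := commonZeros_add_smul (D := D) (p := p) (q := q) z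
  have h := c.finrank_ker_bezoutAlong_eq_finsum hv hc hD (hβ.add_smul z) hpz hq ht
    (hZ.symm ▸ hfin) (hZ.symm ▸ hl) hz
  rw [h, hZ]
  simp only [zeroMult_add_smul]

end Generic
end CurveBezout

/-! ### Local multiplicities at points with cyclic cokernel and at saturated points. -/

namespace CurveBezout

section Cyclic

variable {O : Type*} [CommRing O] {m : ℕ}

lemma adjugate_eq_det_updateCol (L : Matrix (Fin m) (Fin m) O) (i r : Fin m) :
    L.adjugate i r = (L.updateCol i (Pi.single r 1)).det := by
  rw [← Matrix.cramer_apply, Matrix.cramer_eq_adjugate_mulVec, Matrix.mulVec_single_one]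
  rfl

/-- If an entry of the adjugate is a unit, a vector in the kernel of the corresponding row of the
adjugate is in the range of the matrix. -/
lemma mem_range_of_adjugate_mulVec_eq_zero {L : Matrix (Fin m) (Fin m) O} {i r : Fin m}
    (hu : IsUnit (L.adjugate i r)) {w : Fin m → O} (hw : (L.adjugate *ᵥ w) i = 0) :
    w ∈ LinearMap.range L.mulVecLin := by
  set N := L.updateCol i (Pi.single r 1)
  have hN : N.det = L.adjugate i r := (adjugate_eq_det_updateCol L i r).symm
  -- By Cramer's rule the `i`-th coordinate of the solution for `N` is that of `adj(L) w`, which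
  -- vanishes. As `N` and `L` differ only in column `i`, the same vector solves the system for `L`.
  have hy : N.cramer w i = 0 := by
    rw [Matrix.cramer_apply, Matrix.updateCol_idem, ← Matrix.cramer_apply,
      Matrix.cramer_eq_adjugate_mulVec, hw]
  have hNL : N *ᵥ N.cramer w = L *ᵥ N.cramer w := by
    funext s
    rw [Matrix.mulVec, Matrix.mulVec, dotProduct, dotProduct]
    refine Finset.sum_congr rfl fun t _ => ?_
    rcases eq_or_ne t i with rfl | ht
    · rw [hy, mul_zero, mul_zero]
    · rw [show N s t = L s t from Matrix.updateCol_ne ht]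
  obtain ⟨a, ha⟩ := hu.exists_left_inv
  refine ⟨a • N.cramer w, ?_⟩
  rw [Matrix.mulVecLin_apply, Matrix.mulVec_smul, ← hNL, Matrix.mulVec_cramer, smul_smul, hN, ha,
    one_smul]

/-- If an entry of the adjugate is a unit, the cokernel is cyclic. -/
lemma nonempty_coker_equiv_of_isUnit_adjugate {L : Matrix (Fin m) (Fin m) O} {i r : Fin m}
    (hu : IsUnit (L.adjugate i r)) :
    Nonempty (((Fin m → O) ⧸ LinearMap.range L.mulVecLin) ≃ₗ[O] (O ⧸ Ideal.span {L.det})) := by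
  let φ : (Fin m → O) →ₗ[O] (O ⧸ Ideal.span {L.det}) :=
    (Ideal.span {L.det}).mkQ ∘ₗ LinearMap.proj i ∘ₗ L.adjugate.mulVecLin
  have hφ : Function.Surjective φ := by
    intro y
    obtain ⟨b, rfl⟩ := Submodule.mkQ_surjective _ y
    obtain ⟨a, ha⟩ := hu.exists_right_inv
    refine ⟨Pi.single r (a * b), congrArg (Ideal.span {L.det}).mkQ ?_⟩
    simp [← mul_assoc, ha]
  have hker : LinearMap.ker φ = LinearMap.range L.mulVecLin := by
    ext w
    constructor
    · intro h
      obtain ⟨b, hb⟩ := Ideal.mem_span_singleton'.mp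
        ((Submodule.Quotient.mk_eq_zero _).mp (LinearMap.mem_ker.mp h))
      -- Since `adj(L) L = det L`, subtracting `b` times column `i` of `L` removes the multiple of
      -- the determinant in row `i`.
      have h1 : (L.adjugate *ᵥ (w - L *ᵥ Pi.single i b)) i = 0 := by
        rw [Matrix.mulVec_sub, Matrix.mulVec_mulVec, Matrix.adjugate_mul, Matrix.smul_mulVec,
          Matrix.one_mulVec, Pi.sub_apply, Pi.smul_apply, Pi.single_eq_same, smul_eq_mul,
          mul_comm, hb]
        exact sub_self _
      have h2 := mem_range_of_adjugate_mulVec_eq_zero hu h1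
      rw [← sub_add_cancel w (L *ᵥ Pi.single i b)]
      exact add_mem h2 ⟨_, rfl⟩
    · rintro ⟨y, rfl⟩
      rw [LinearMap.mem_ker]
      refine (Submodule.Quotient.mk_eq_zero _).mpr (Ideal.mem_span_singleton'.mpr ⟨y i, ?_⟩)
      change y i * L.det = (L.adjugate *ᵥ (L *ᵥ y)) i
      rw [Matrix.mulVec_mulVec, Matrix.adjugate_mul, Matrix.smul_mulVec, Matrix.one_mulVec,
        Pi.smul_apply, smul_eq_mul, mul_comm]
  exact ⟨(Submodule.quotEquivOfEq _ _ hker.symm).trans (φ.quotKerEquivOfSurjective hφ)⟩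

lemma length_quotient_smul_top_eq {M N : Type*} [AddCommGroup M] [Module O M] [AddCommGroup N]
    [Module O N] (e : M ≃ₗ[O] N) (I : Ideal O) :
    Module.length O (M ⧸ (I • (⊤ : Submodule O M))) =
      Module.length O (N ⧸ (I • (⊤ : Submodule O N))) := by
  refine (Submodule.Quotient.equiv _ _ e ?_).length_eq
  rw [Submodule.map_smul'', Submodule.map_top, LinearEquiv.range]

lemma length_quotient_span_singleton (a b d : O) :
    Module.length O ((O ⧸ Ideal.span {d}) ⧸
      (Ideal.span {a, b} • (⊤ : Submodule O (O ⧸ Ideal.span {d})))) =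
      Module.length O (O ⧸ Ideal.span {d, a, b}) := by
  have h : Ideal.span {a, b} • (⊤ : Submodule O (O ⧸ Ideal.span {d})) =
      Submodule.map (Submodule.mkQ (Ideal.span {d})) (Ideal.span {a, b} : Submodule O O) := by
    conv_rhs => rw [← Ideal.mul_top (Ideal.span {a, b}), ← smul_eq_mul]
    rw [Submodule.map_smul'', Submodule.map_top, Submodule.range_mkQ]
  rw [h, (Submodule.quotientQuotientEquivQuotientSup _ _).length_eq, Ideal.span_insert d]

end Cyclic

section Adjugate

variable {m : ℕ}

/-- If `k` spans the kernel, `k_i ≠ 0` and `e_r` is not in the image, then replacing column `i` by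
`e_r` gives an injective matrix: a null vector has zero `i`-th entry, so it is a null vector of `M`
and a zero multiple of `k`. -/
lemma exists_adjugate_ne_zero_of_finrank_ker {M : Matrix (Fin m) (Fin m) ℂ}
    (h : Module.finrank ℂ (LinearMap.ker M.mulVecLin) = 1) : ∃ i r, M.adjugate i r ≠ 0 := by
  obtain ⟨⟨k, hk⟩, hk0, hspan⟩ := finrank_eq_one_iff'.mp h
  obtain ⟨i, hi⟩ := Function.ne_iff.mp fun h0 : k = 0 => hk0 (Subtype.ext h0)
  have hr : ∃ r, (Pi.single r 1 : Fin m → ℂ) ∉ LinearMap.range M.mulVecLin := by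
    by_contra! hr
    have htop : LinearMap.range M.mulVecLin = ⊤ := by
      rw [eq_top_iff, ← (Pi.basisFun ℂ (Fin m)).span_eq, Submodule.span_le]
      rintro _ ⟨r, rfl⟩
      rw [Pi.basisFun_apply]
      exact hr r
    have := LinearMap.finrank_range_add_finrank_ker M.mulVecLin
    rw [htop, finrank_top, h] at this
    omega
  obtain ⟨r, hr⟩ := hr
  refine ⟨i, r, fun h0 => ?_⟩
  rw [adjugate_eq_det_updateCol, ← Matrix.exists_mulVec_eq_zero_iff] at h0
  obtain ⟨y, hy0, hy⟩ := h0
  have hsplit : M *ᵥ (y - Pi.single i (y i)) + y i • Pi.single r 1 = 0 := by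
    rw [← hy]
    funext s
    rw [Pi.add_apply, Matrix.mulVec, Matrix.mulVec, dotProduct, dotProduct,
      ← Finset.add_sum_erase _ _ (Finset.mem_univ i),
      ← Finset.add_sum_erase _ _ (Finset.mem_univ i)]
    have h1 : ∀ t ∈ Finset.univ.erase i, M s t * (y - Pi.single i (y i) : Fin m → ℂ) t =
        M.updateCol i (Pi.single r 1) s t * y t := by
      intro t ht
      have hti := Finset.ne_of_mem_erase ht
      rw [Matrix.updateCol_ne hti]
      simp [hti]
    rw [Finset.sum_congr rfl h1]
    simp
    ring
  have hyi : y i = 0 := by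
    by_contra hne
    refine hr ⟨-(y i)⁻¹ • (y - Pi.single i (y i)), ?_⟩
    rw [Matrix.mulVecLin_apply, Matrix.mulVec_smul, eq_neg_of_add_eq_zero_left hsplit, smul_neg,
      neg_smul, neg_neg, smul_smul, inv_mul_cancel₀ hne, one_smul]
  rw [hyi, Pi.single_zero, sub_zero, zero_smul, add_zero] at hsplit
  obtain ⟨a, ha⟩ := hspan ⟨y, hsplit⟩
  have ha' : a • k = y := congrArg Subtype.val ha
  have ha0 : a = 0 := by
    have := congrFun ha' i
    rw [hyi, Pi.smul_apply, smul_eq_mul, mul_eq_zero] at this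
    exact this.resolve_right hi
  exact hy0 (by rw [← ha', ha0, zero_smul])

/-- The polynomial `f (x + t e_k)` in `t`. -/
noncomputable def coordLine (x : Fin 3 → ℂ) (k : Fin 3) : S →ₐ[ℂ] Polynomial ℂ :=
  MvPolynomial.aeval fun i =>
    Polynomial.C (x i) + Polynomial.C ((Pi.single k 1 : Fin 3 → ℂ) i) * Polynomial.X

lemma eval_zero_coordLine (x : Fin 3 → ℂ) (k : Fin 3) (f : S) :
    (coordLine x k f).eval 0 = MvPolynomial.eval x f := by
  have : (Polynomial.aeval (0 : ℂ)).comp (coordLine x k) = MvPolynomial.aeval x := by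
    apply MvPolynomial.algHom_ext
    intro i
    simp [coordLine]
  exact DFunLike.congr_fun this f

lemma eval_zero_derivative_coordLine (x : Fin 3 → ℂ) (k : Fin 3) (f : S) :
    (coordLine x k f).derivative.eval 0 = MvPolynomial.eval x (MvPolynomial.pderiv k f) := by
  induction f using MvPolynomial.induction_on with
  | C z => simp [coordLine]
  | add f g hf hg => simp [hf, hg]
  | mul_X f i hf =>
    rw [map_mul, Polynomial.derivative_mul, Polynomial.eval_add, Polynomial.eval_mul,
      Polynomial.eval_mul, hf, eval_zero_coordLine, eval_zero_coordLine, Derivation.leibniz,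
      MvPolynomial.pderiv_X]
    rcases eq_or_ne i k with rfl | h
    · simp [coordLine]
      ring
    · simp [coordLine, h]
      ring

/-- Along a coordinate line through `x`, suppose the adjugate vanishes at the point and write it as
`X N`, and `Δ = X g`. Then `M N = g`, and taking determinants at `0`, where `det M` vanishes, gives
`g(0) = 0`. But `g(0)` is the partial derivative. -/
lemma exists_adjugate_ne_zero_of_pderiv {D : Fin 3 → Matrix (Fin m) (Fin m) ℂ} {x : Fin 3 → ℂ}
    (h0 : MvPolynomial.eval x (discr D) = 0) {k : Fin 3}
    (hk : MvPolynomial.eval x (MvPolynomial.pderiv k (discr D)) ≠ 0) :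
    ∃ i r, (pencilAt D x).adjugate i r ≠ 0 := by
  by_contra! hadj
  set M : Matrix (Fin m) (Fin m) (Polynomial ℂ) := (pencil D).map (coordLine x k)
  have hdet : M.det = coordLine x k (discr D) := (AlgHom.map_det _ _).symm
  have hM0 : M.map (Polynomial.eval 0) = pencilAt D x := by
    ext i r
    simp only [M, Matrix.map_apply, eval_zero_coordLine]
    simp [pencil, pencilAt]
  have hadj0 : ∀ i r, (M.adjugate i r).eval 0 = 0 := by
    intro i r
    have h1 := RingHom.map_adjugate (Polynomial.evalRingHom (0 : ℂ)) M
    have h2 := congrFun (congrFun h1 i) r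
    have h3 : (Polynomial.evalRingHom (0 : ℂ)).mapMatrix M = pencilAt D x := hM0
    rw [h3, hadj] at h2
    exact h2
  choose N hN using fun i r => Polynomial.X_dvd_iff.mpr
    ((Polynomial.coeff_zero_eq_eval_zero _).trans (hadj0 i r))
  have hN' : M.adjugate = (Polynomial.X : Polynomial ℂ) • Matrix.of N := by
    ext1 i r
    exact hN i r
  obtain ⟨g, hg⟩ := Polynomial.X_dvd_iff.mpr ((Polynomial.coeff_zero_eq_eval_zero _).trans
    ((eval_zero_coordLine x k (discr D)).trans h0))
  have hMN : M * Matrix.of N = g • 1 := by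
    have h1 := M.mul_adjugate
    rw [hN', hdet, hg, Matrix.mul_smul, mul_smul] at h1
    ext1 i r
    have h2 := congrFun (congrFun h1 i) r
    exact mul_left_cancel₀ Polynomial.X_ne_zero h2
  have h1 := congrArg (fun A => (Matrix.det A).eval 0) hMN
  simp only [Matrix.det_mul, Polynomial.eval_mul, Matrix.det_smul, Matrix.det_one, mul_one,
    Polynomial.eval_pow, hdet, eval_zero_coordLine, h0, zero_mul] at h1
  have h2 : g.eval 0 = 0 := eq_zero_of_pow_eq_zero h1.symm
  rw [← eval_zero_derivative_coordLine, hg] at hk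
  exact hk (by simp [h2])

end Adjugate

section LocalMultiplicity

variable {m : ℕ} {D : Fin 3 → Matrix (Fin m) (Fin m) ℂ} {p q : S} {x : Plane}

lemma notMem_pointIdeal {f : S} (hf : MvPolynomial.eval x.rep f ≠ 0) : f ∉ pointIdeal x := by
  intro h
  apply hf
  have h1 : (Polynomial.aeval (1 : ℂ)).comp (MvPolynomial.aeval
      (fun k => Polynomial.C (x.rep k) * Polynomial.X) : S →ₐ[ℂ] Polynomial ℂ) =
      MvPolynomial.aeval x.rep := by
    apply MvPolynomial.algHom_ext
    intro i
    simp
  have h2 := DFunLike.congr_fun h1 f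
  rw [AlgHom.comp_apply, show MvPolynomial.aeval
      (fun k => Polynomial.C (x.rep k) * Polynomial.X) f = (0 : Polynomial ℂ) from h, map_zero]
    at h2
  exact h2.symm

/-- An entry of the adjugate nonzero at `x` is a unit in the local ring, so the cokernel is `O / Δ`.
-/
lemma zeroMult_eq_intersectionMult_of_adjugate {i r : Fin m}
    (h : (pencilAt D x.rep).adjugate i r ≠ 0) :
    zeroMult D p q x = intersectionMult D p q x := by
  have hadj : MvPolynomial.eval x.rep ((pencil D).adjugate i r) =
      (pencilAt D x.rep).adjugate i r := by
    have h1 := congrFun (congrFun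
      (RingHom.map_adjugate (MvPolynomial.eval x.rep) (pencil D)) i) r
    have h2 : (MvPolynomial.eval x.rep).mapMatrix (pencil D) = pencilAt D x.rep := by
      ext a b
      simp [pencil, pencilAt]
    rw [h2] at h1
    exact h1
  have hu : IsUnit (((pencil D).map (toLoc x)).adjugate i r) := by
    have h1 := congrFun (congrFun (RingHom.map_adjugate (toLoc x) (pencil D)) i) r
    refine (congrArg IsUnit h1).mp ?_
    exact (IsLocalization.AtPrime.isUnit_to_map_iff (Loc x) (pointIdeal x) _).mpr
      (notMem_pointIdeal (hadj.symm ▸ h))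
  have hdet : ((pencil D).map (toLoc x)).det = toLoc x (discr D) :=
    (RingHom.map_det (toLoc x) (pencil D)).symm
  obtain ⟨φ⟩ := nonempty_coker_equiv_of_isUnit_adjugate hu
  rw [zeroMult, length_quotient_smul_top_eq φ, hdet, length_quotient_span_singleton,
    intersectionMult]

lemma zeroMult_eq_intersectionMult (hx : MvPolynomial.eval x.rep (discr D) = 0)
    (h : IsNonsingularAt D x ∨
      Module.finrank ℂ (LinearMap.ker (pencilAt D x.rep).mulVecLin) = 1) :
    zeroMult D p q x = intersectionMult D p q x := by
  obtain ⟨i, r, hir⟩ : ∃ i r, (pencilAt D x.rep).adjugate i r ≠ 0 := by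
    rcases h with ⟨k, hk⟩ | h
    · exact exists_adjugate_ne_zero_of_pderiv hx hk
    · exact exists_adjugate_ne_zero_of_finrank_ker h
  exact zeroMult_eq_intersectionMult_of_adjugate hir

lemma zeroMult_eq_normalizationMult (h : IsSaturatedAt D x) :
    zeroMult D p q x = normalizationMult D p q x := by
  obtain ⟨e⟩ := h
  exact length_quotient_smul_top_eq e _

end LocalMultiplicity

end CurveBezout

theorem theorem2p6 (m n : ℕ) (D : Fin 3 → Matrix (Fin m) (Fin m) ℂ)
    (hD : ∀ k, (D k).IsHermitian) (hΔ : CurveBezout.discr D ≠ 0)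
    (p q : MvPolynomial (Fin 3) ℂ) (hp : p.IsHomogeneous n) (hq : q.IsHomogeneous n)
    (hfin : (CurveBezout.commonZeros D p q).Finite)
    (β10 β20 β12 : Matrix (CurveBezout.Idx n) (CurveBezout.Idx n) ℂ)
    (hβ : CurveBezout.IsBezoutDecomposition n p q β10 β20 β12) :
    ((Module.finrank ℂ (LinearMap.ker (CurveBezout.bezoutAlong D β10 β20 β12)) : ℕ) : ℕ∞)
        = ∑ᶠ x ∈ CurveBezout.commonZeros D p q, CurveBezout.zeroMult D p q x
    ∧ (∀ x ∈ CurveBezout.commonZeros D p q,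
        (CurveBezout.IsNonsingularAt D x ∨
          Module.finrank ℂ (LinearMap.ker (CurveBezout.pencilAt D x.rep).mulVecLin) = 1) →
        CurveBezout.zeroMult D p q x = CurveBezout.intersectionMult D p q x)
    ∧ (∀ x ∈ CurveBezout.commonZeros D p q, CurveBezout.IsSaturatedAt D x →
        CurveBezout.zeroMult D p q x = CurveBezout.normalizationMult D p q x)
    ∧ ((∀ x ∈ CurveBezout.commonZeros D p q, CurveBezout.IsNonsingularAt D x) →
        ((Module.finrank ℂ (LinearMap.ker (CurveBezout.bezoutAlong D β10 β20 β12)) : ℕ) : ℕ∞)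
          = ∑ᶠ x ∈ CurveBezout.commonZeros D p q, CurveBezout.intersectionMult D p q x) := by
  have hsum := CurveBezout.finrank_ker_bezoutAlong_eq_finsum_zeroMult hD hΔ hp hq hfin hβ
  refine ⟨hsum, fun x hx h => CurveBezout.zeroMult_eq_intersectionMult hx.1 h,
    fun x _ h => CurveBezout.zeroMult_eq_normalizationMult h, fun h => hsum.trans ?_⟩
  exact finsum_mem_congr rfl fun x hx =>
    CurveBezout.zeroMult_eq_intersectionMult hx.1 (Or.inl (h x hx))
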